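/- Let $\mathbb{C}/\langle i\rangle$ be the flat cylinder. A meromorphic function $g\colon \mathbb{C}/\langle i\rangle\to\mathbb{C}\cup\{\infty\}$ is called \emph{quasiperiodic} if (1) there is a constant $C>0$ such that any two distinct points of $g^{-1}(\{0,\infty\})$ are at distance at least $C$, and for every $p\in g^{-1}(\{0,\infty\})$ there is a point of $g^{-1}(\{0,\infty\})\setminus\{p\}$ at distance less than $1/C$ from $p$; (2) for every divergent sequence $(z_k)_k$ in $\mathbb{C}/\langle i\rangle$, a subsequence of the functions $z\mapsto g(z+z_k)$ converges, uniformly on compact subsets (for the spherical distance), to a non-constant meromorphic function $g_\infty\colon\mathbb{C}/\langle i\rangle\to\mathbb{C}\cup\{\infty\}$. Let $\mathcal{W}$ be the set of quasiperiodic meromorphic functions $g$ on $\mathbb{C}/\langle i\rangle$ whose principal divisor has the form $(g)=\prod_{j\in\mathbb{Z}}p_j^2q_j^{-2}$, with pairwise distinct points $p_j$ and $q_j$, and let $\mathcal{M}_{\mathrm{imm}}$ be the set of those $g\in\mathcal{W}$ for which $$\mathrm{Res}_{p_j}\Big(\frac{dz}{g}\Big)=0,\qquad \mathrm{Res}_{q_j}(g\,dz)=0\quad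 (j\in\mathbb{Z}),\qquad \int_\gamma\frac{dz}{g}=a,\qquad \int_\gamma g\,dz=\overline{a}$$ for some $a\in\mathbb{C}$, where $\gamma$ is the generator $t\mapsto x+it$, $t\in[0,1]$, of the homology of the cylinder (with any real $x$ for which $\gamma$ avoids $g^{-1}(\{0,\infty\})$; the integrals do not depend on $x$). A \emph{quasiperiodic, immersed minimal surface of Riemann type} is a minimal surface $M$ in $\mathbb{R}^3$ with a Weierstrass pair $(g,dz)$ on $(\mathbb{C}/\langle i\rangle)\setminus g^{-1}(\{0,\infty\})$, where $g\in\mathcal{M}_{\mathrm{imm}}$; that is, it is given by a conformal minimal immersion $$X\colon(\mathbb{C}/\langle i\rangle)\setminus g^{-1}(\{0,\infty\})\to\mathbb{R}^3,\qquad dX=\Re\Big(\big(\tfrac12(\tfrac1g-g),\ \tfrac i2(\tfrac1g+g),\ 1\big)\,dz\Big).$$ A \emph{Jacobi function} on $M$ is a real-valued function $v$ of class $C^2$ on $M$ with $\Delta v-2Kv=0$, where $\Delta$ and $K$ are the Laplacian and the Gaussian curvature of $M$ with the metric induced from $\mathbb{R}^3$. \textbf{Theorem.} For every quasiperiodic,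 immersed minimal surface $M\subset\mathbb{R}^3$ of Riemann type, the real vector space of bounded Jacobi functions on $M$ is finite-dimensional. -/

import Mathlib

open Complex Filter Topology Set

noncomputable section

namespace RiemannType

/-- The flat cylinder `ℂ / ⟨i⟩`, with its quotient topology and quotient distance. -/
abbrev Cylinder : Type := ℂ ⧸ AddSubgroup.zmultiples Complex.I

/-- The class in the cylinder of a complex number. -/
abbrev toCyl (z : ℂ) : Cylinder := (QuotientAddGroup.mk z : Cylinder)

/-- A meromorphic function on the cylinder, as an `i`-periodic meromorphic function on `ℂ`.
The normal form fixes the (otherwise irrelevant) values at the poles and removes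
removable singularities. -/
structure IsMeromorphicOnCylinder (g : ℂ → ℂ) : Prop where
  meromorphic : MeromorphicNFOn g univ
  periodic : Function.Periodic g Complex.I

open Classical in
/-- The value of a meromorphic function in the Riemann sphere `ℂ ∪ {∞}`. -/
def sphereValue (g : ℂ → ℂ) (z : ℂ) : OnePoint ℂ :=
  if meromorphicOrderAt g z < 0 then OnePoint.infty else ((g z : ℂ) : OnePoint ℂ)

/-- The unit vector of `ℝ³` corresponding to a point of `ℂ ∪ {∞}` under
stereographic projection from the north pole. -/
def stereo : OnePoint ℂ → EuclideanSpace ℝ (Fin 3)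
  | OnePoint.infty => !₂[0, 0, 1]
  | OnePoint.some w =>
      !₂[2 * w.re / (‖w‖ ^ 2 + 1), 2 * w.im / (‖w‖ ^ 2 + 1), (‖w‖ ^ 2 - 1) / (‖w‖ ^ 2 + 1)]

/-- The spherical Gauss map of stereographic projection `g`. -/
def gaussMap (g : ℂ → ℂ) (z : ℂ) : EuclideanSpace ℝ (Fin 3) := stereo (sphereValue g z)

/-- The subset `g⁻¹({0, ∞})` of the cylinder. -/
def zerosAndPoles (g : ℂ → ℂ) : Set Cylinder :=
  toCyl '' {z | sphereValue g z = ((0 : ℂ) : OnePoint ℂ) ∨ sphereValue g z = OnePoint.infty}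

/-- Quasiperiodic meromorphic functions on the cylinder. Uniform convergence on compact sets of
functions with values in `ℂ ∪ {∞}` is with respect to the chordal distance. -/
structure IsQuasiperiodic (g : ℂ → ℂ) : Prop where
  isMeromorphic : IsMeromorphicOnCylinder g
  spacing : ∃ C : ℝ, 0 < C ∧
    (∀ p ∈ zerosAndPoles g, ∀ q ∈ zerosAndPoles g, p ≠ q → C ≤ dist p q) ∧
    (∀ p ∈ zerosAndPoles g, ∃ q ∈ zerosAndPoles g, q ≠ p ∧ dist p q < 1 / C)
  limits : ∀ z : ℕ → ℂ, Tendsto (fun k => toCyl (z k)) atTop (cocompact Cylinder) →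
    ∃ s : ℕ → ℕ, StrictMono s ∧ ∃ gInf : ℂ → ℂ, IsMeromorphicOnCylinder gInf ∧
      (¬ ∃ c : ℂ, ∀ w, gInf w = c) ∧
      TendstoLocallyUniformly (fun k w => gaussMap g (w + z (s k))) (gaussMap gInf) atTop

/-- The space `𝒲` of quasiperiodic meromorphic functions on the cylinder with principal divisor
`∏_{j ∈ ℤ} p_j² q_j⁻²`. -/
structure MemW (g : ℂ → ℂ) : Prop where
  quasiperiodic : IsQuasiperiodic g
  divisor : ∃ p q : ℤ → Cylinder, Function.Injective p ∧ Function.Injective q ∧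
    (∀ z : ℂ, toCyl z ∈ range p ↔ meromorphicOrderAt g z = 2) ∧
    (∀ z : ℂ, toCyl z ∈ range q ↔ meromorphicOrderAt g z = -2) ∧
    (∀ z : ℂ, toCyl z ∉ range p → toCyl z ∉ range q → meromorphicOrderAt g z = 0)

/-- `f(z) dz` has residue `c` at the (isolated) singularity `z`. -/
def HasResidue (f : ℂ → ℂ) (z c : ℂ) : Prop :=
  ∀ᶠ r in 𝓝[>] (0 : ℝ), (2 * Real.pi * Complex.I)⁻¹ * (∮ w in C(z, r), f w) = c

/-- The integral of `f(z) dz` along the generator `t ↦ x + i t`, `t ∈ [0, 1]`,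
of the homology of the cylinder. -/
def generatorIntegral (f : ℂ → ℂ) (x : ℝ) : ℂ :=
  ∫ t in (0 : ℝ)..1, f (x + Complex.I * t) * Complex.I

/-- The space `𝓜_imm` of those `g ∈ 𝒲` whose period map takes a value `(a, a̅, 0, 0)`.
The generator of homology may be any vertical circle that avoids the zeros and poles of `g`:
when the residues vanish, the integrals do not depend on it. -/
structure MemMImm (g : ℂ → ℂ) : Prop where
  memW : MemW g
  residue_inv : ∀ z : ℂ, sphereValue g z = ((0 : ℂ) : OnePoint ℂ) →
    HasResidue (fun w => (g w)⁻¹) z 0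
  residue : ∀ z : ℂ, sphereValue g z = OnePoint.infty → HasResidue g z 0
  period : ∃ a : ℂ, ∀ x : ℝ, (∀ t : ℝ, toCyl (x + Complex.I * t) ∉ zerosAndPoles g) →
    generatorIntegral (fun w => (g w)⁻¹) x = a ∧
    generatorIntegral g x = starRingEnd ℂ a

/-- The Weierstrass form `(½ (1/g - g), i/2 (1/g + g), 1) dz` of the pair `(g, dz)`. -/
def weierstrassForm (g : ℂ → ℂ) (z : ℂ) : Fin 3 → ℂ :=
  ![1 / 2 * ((g z)⁻¹ - g z), Complex.I / 2 * ((g z)⁻¹ + g z), 1]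

open Classical in
/-- The lift to `ℂ` of a function on the complement of `E` in the cylinder
(with value `0` over `E`, where it is never used). -/
def lift {F : Type*} [Zero F] {E : Set Cylinder} (f : ↥Eᶜ → F) (z : ℂ) : F :=
  if h : toCyl z ∈ Eᶜ then f ⟨toCyl z, h⟩ else 0

/-- `X`, defined on the cylinder minus the set `E` of its planar ends, is a quasiperiodic, immersed
minimal surface of Riemann type: `E = g⁻¹({0, ∞})` and `dX_j = Re (Ψ_j)` for the Weierstrass form
`Ψ` of a pair `(g, dz)` with `g ∈ 𝓜_imm`. -/
def IsQuasiperiodicRiemannType (E : Set Cylinder) (X : ↥Eᶜ → EuclideanSpace ℝ (Fin 3)) : Prop :=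
  ∃ g : ℂ → ℂ, MemMImm g ∧ E = zerosAndPoles g ∧
    ∀ z : ℂ, toCyl z ∉ E → ∀ j : Fin 3,
      HasFDerivAt (fun w => lift X w j)
        (Complex.reCLM ∘L (weierstrassForm g z j • ContinuousLinearMap.id ℝ ℂ)) z

/-- The partial derivative `∂X/∂x`, where `z = x + i y`. -/
def partialX {F : Type*} [NormedAddCommGroup F] [NormedSpace ℝ F] (Y : ℂ → F) (z : ℂ) : F :=
  fderiv ℝ Y z 1

/-- The partial derivative `∂X/∂y`, where `z = x + i y`. -/
def partialY {F : Type*} [NormedAddCommGroup F] [NormedSpace ℝ F] (Y : ℂ → F) (z : ℂ) : F :=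
  fderiv ℝ Y z Complex.I

/-- The conformal factor `lam` of the metric `lam² |dz|²` that a conformal immersion `Y`
induces: the length of `∂Y/∂x`. -/
def conformalFactor (Y : ℂ → EuclideanSpace ℝ (Fin 3)) (z : ℂ) : ℝ :=
  ‖partialX Y z‖

/-- The unit normal `(Y_x × Y_y) / |Y_x × Y_y|` of an immersion `Y`. -/
def unitNormal (Y : ℂ → EuclideanSpace ℝ (Fin 3)) (z : ℂ) : EuclideanSpace ℝ (Fin 3) :=
  let n : EuclideanSpace ℝ (Fin 3) :=
    WithLp.toLp 2 (crossProduct (WithLp.ofLp (partialX Y z)) (WithLp.ofLp (partialY Y z)))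
  ‖n‖⁻¹ • n

/-- The Gaussian curvature of an immersion `Y`: the determinant of the shape operator, which is the
quotient of the determinants of the second and the first fundamental form. -/
def gaussCurvature (Y : ℂ → EuclideanSpace ℝ (Fin 3)) (z : ℂ) : ℝ :=
  (inner ℝ (partialX (partialX Y) z) (unitNormal Y z) *
      inner ℝ (partialY (partialY Y) z) (unitNormal Y z) -
    inner ℝ (partialY (partialX Y) z) (unitNormal Y z) ^ 2) /
  (inner ℝ (partialX Y z) (partialX Y z) * inner ℝ (partialY Y z) (partialY Y z) -
    inner ℝ (partialX Y z) (partialY Y z) ^ 2)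

/-- The Jacobi operator `L = Δ_M - 2 K` of a conformally immersed surface, `Δ_M` being the
Laplacian of the induced metric `lam² |dz|²`, that is, `lam⁻²` times the flat Laplacian. -/
def jacobiOperator {E : Set Cylinder} (X : ↥Eᶜ → EuclideanSpace ℝ (Fin 3)) (v : ↥Eᶜ → ℝ)
    (z : ℂ) : ℝ :=
  Laplacian.laplacian (lift v) z / conformalFactor (lift X) z ^ 2 -
    2 * gaussCurvature (lift X) z * lift v z

/-- Jacobi functions: functions of class `C²` on the surface, in the kernel of `L`. -/
def IsJacobiFunction {E : Set Cylinder} (X : ↥Eᶜ → EuclideanSpace ℝ (Fin 3))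
    (v : ↥Eᶜ → ℝ) : Prop :=
  ∀ z : ℂ, toCyl z ∉ E → ContDiffAt ℝ 2 (lift v) z ∧ jacobiOperator X v z = 0

theorem lift_add {E : Set Cylinder} (u v : ↥Eᶜ → ℝ) : lift (u + v) = lift u + lift v := by
  funext z
  by_cases h : toCyl z ∈ Eᶜ <;> simp only [lift, h, Pi.add_apply, dite_true, dite_false, add_zero]

theorem lift_smul {E : Set Cylinder} (c : ℝ) (v : ↥Eᶜ → ℝ) : lift (c • v) = c • lift v := by
  funext z
  by_cases h : toCyl z ∈ Eᶜ <;>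
    simp only [lift, h, Pi.smul_apply, dite_true, dite_false, smul_zero]

theorem lift_zero {E : Set Cylinder} : lift (0 : ↥Eᶜ → ℝ) = 0 := by
  funext z
  by_cases h : toCyl z ∈ Eᶜ <;> simp only [lift, h, Pi.zero_apply, dite_true, dite_false]

/-- The real linear space of bounded Jacobi functions on the surface. -/
def boundedJacobiFunctions {E : Set Cylinder} (X : ↥Eᶜ → EuclideanSpace ℝ (Fin 3)) :
    Submodule ℝ (↥Eᶜ → ℝ) where
  carrier := {v | IsJacobiFunction X v ∧ ∃ B : ℝ, ∀ p, |v p| ≤ B}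
  zero_mem' := by
    refine ⟨fun z _ => ⟨?_, ?_⟩, 0, fun p => by simp⟩
    · rw [lift_zero]; exact contDiffAt_const
    · have h1 : Laplacian.laplacian (0 : ℂ → ℝ) z = 0 :=
        congrFun (InnerProductSpace.laplacian_const (c := (0 : ℝ))) z
      simp [jacobiOperator, lift_zero, h1]
  add_mem' := by
    rintro u v ⟨hu, B, hB⟩ ⟨hv, B', hB'⟩
    refine ⟨fun z hz => ?_, B + B', fun p => (abs_add_le _ _).trans (add_le_add (hB p) (hB' p))⟩
    obtain ⟨hu1, hu2⟩ := hu z hz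
    obtain ⟨hv1, hv2⟩ := hv z hz
    refine ⟨by rw [lift_add]; exact hu1.add hv1, ?_⟩
    simp only [jacobiOperator] at hu2 hv2 ⊢
    rw [lift_add, ContDiffAt.laplacian_add hu1 hv1, Pi.add_apply]
    linear_combination hu2 + hv2
  smul_mem' := by
    rintro c v ⟨hv, B, hB⟩
    refine ⟨fun z hz => ?_, |c| * B, fun p => ?_⟩
    · obtain ⟨hv1, hv2⟩ := hv z hz
      refine ⟨by rw [lift_smul]; exact contDiffAt_const.smul hv1, ?_⟩
      simp only [jacobiOperator] at hv2 ⊢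
      rw [lift_smul, InnerProductSpace.laplacian_smul _ hv1, Pi.smul_apply]
      simp only [smul_eq_mul]
      linear_combination c * hv2
    · rw [Pi.smul_apply, smul_eq_mul, abs_mul]
      exact mul_le_mul_of_nonneg_left (hB p) (abs_nonneg c)

end RiemannType

end

open Complex Filter Topology Set

noncomputable section

namespace RiemannType

open MeasureTheory

/-! In the conformal coordinate `z` the Jacobi equation becomes `Δu = -8 (|g'| / (1 + |g|²))² u`,
with the flat Laplacian, off the zeros and poles of `g`. Quasiperiodicity bounds the spherical
derivative `|g'| / (1 + |g|²)`. Along a sequence on which it blew up, a subsequence either converges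
in the plane or has convergent translates of `g`. Near the limit point the Gauss map avoids a
neighbourhood of one of the two poles of the sphere, and Cauchy's estimate for `g` or `1/g` gives a
contradiction (`IsQuasiperiodic.exists_deriv_bound`). From then on only the inequality `|Δu| ≤ M
|u|` matters, for bounded functions on the cylinder with isolated singularities
(`exists_laplacian_bound`).

Such a function turns out to be determined by finitely many numbers. Boundedness makes the
singularities invisible to distributions: logarithmic cut-offs remove them with an error `O(1/n)`
(`hasWeakLaplacian_of_bounded`). Hence the Fourier coefficients `a_k(x)` of `u` on the vertical
circles are genuine solutions of `a_k'' = (2πk)² a_k + f_k` on the whole line, even where a circle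
meets a singularity (`circleCoeff_ode`). Parseval turns `|f| ≤ M |u|` into `∑ |f_k|² ≤ M² ∑ |a_k|²`.

Suppose that `a_k(0) = a_k'(0) = 0` for all `|k| ≤ N`, where `N ≥ M`. Measure growth against `exp
(μ|x|)`, with `μ` in the middle of the gap between `2πN` and `2π(N+1)`. Low modes are integrated
from zero Cauchy data and grow no faster than the weight. High modes are bounded, hence controlled
by the decaying Green kernel, whose rate beats the weight. Both solution operators have norm of
order `1/N`, because the gap has constant width, so that a growth bound for `u` improves by a factor
2. Iteration gives `u = 0` (`eq_zero_of_lowModes`). The Cauchy data of the modes `|k| ≤ N` therefore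
embed the space into a finite-dimensional one (`finiteDimensional_of_laplacian_le`). -/

/-! ### Directional derivatives, the flat Laplacian and Green's formula -/

/-- The derivative of `f` in the direction `v`. -/
def dirDeriv (v : ℂ) (f : ℂ → ℂ) (z : ℂ) : ℂ := fderiv ℝ f z v

/-- The flat Laplacian, in terms of iterated directional derivatives. -/
def flatLaplacian (f : ℂ → ℂ) (z : ℂ) : ℂ :=
  dirDeriv 1 (dirDeriv 1 f) z + dirDeriv I (dirDeriv I f) z

theorem dirDeriv_congr {v : ℂ} {f g : ℂ → ℂ} {z : ℂ} (h : f =ᶠ[𝓝 z] g) :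
    dirDeriv v f =ᶠ[𝓝 z] dirDeriv v g := by
  filter_upwards [h.eventuallyEq_nhds] with w hw
  simp only [dirDeriv, hw.fderiv_eq]

theorem flatLaplacian_congr {f g : ℂ → ℂ} {z : ℂ} (h : f =ᶠ[𝓝 z] g) :
    flatLaplacian f z = flatLaplacian g z := by
  simp only [flatLaplacian]
  rw [(dirDeriv_congr (dirDeriv_congr h)).eq_of_nhds,
    (dirDeriv_congr (dirDeriv_congr h)).eq_of_nhds]

theorem contDiffAt_dirDeriv {v : ℂ} {f : ℂ → ℂ} {z : ℂ} {m n : WithTop ℕ∞}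
    (hf : ContDiffAt ℝ n f z) (hmn : m + 1 ≤ n) : ContDiffAt ℝ m (dirDeriv v f) z :=
  (hf.fderiv_right hmn).clm_apply contDiffAt_const

theorem dirDeriv_dirDeriv {v : ℂ} {f : ℂ → ℂ} {z : ℂ} (hf : ContDiffAt ℝ 2 f z) :
    dirDeriv v (dirDeriv v f) z = fderiv ℝ (fderiv ℝ f) z v v := by
  have h : DifferentiableAt ℝ (fderiv ℝ f) z :=
    (hf.fderiv_right (m := 1) (by norm_num)).differentiableAt (by norm_num)
  have := (h.hasFDerivAt.clm_apply (hasFDerivAt_const v z)).fderiv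
  unfold dirDeriv
  rw [this]
  simp

theorem flatLaplacian_eq_laplacian {f : ℂ → ℂ} {z : ℂ} (hf : ContDiffAt ℝ 2 f z) :
    flatLaplacian f z = Laplacian.laplacian f z := by
  rw [InnerProductSpace.laplacian_eq_iteratedFDeriv_complexPlane]
  simp only [flatLaplacian, dirDeriv_dirDeriv hf, iteratedFDeriv_two_apply]
  simp

theorem tsupport_dirDeriv_subset (v : ℂ) (f : ℂ → ℂ) : tsupport (dirDeriv v f) ⊆ tsupport f := by
  refine closure_minimal (fun z hz => ?_) (isClosed_tsupport f)
  refine support_fderiv_subset (𝕜 := ℝ) (fun h => hz ?_)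
  simp [dirDeriv, h]

/-- Off the support of `h` the product vanishes identically, so singularities of `u` there do not
affect its continuity. -/
theorem integrable_mul_of_tsupport {u h : ℂ → ℂ} (hh : Continuous h) (hc : HasCompactSupport h)
    (hu : ∀ z ∈ tsupport h, ContinuousAt u z) : Integrable (fun z => u z * h z) := by
  refine Continuous.integrable_of_hasCompactSupport ?_ hc.mul_left
  refine continuous_of_tsupport fun z hz => ?_
  exact (hu z (tsupport_mul_subset_right hz)).mul hh.continuousAt

/-- Two integrations by parts; no boundary terms arise, and `u` may be singular off the support of
`ψ`. -/
theorem integral_mul_dirDeriv_dirDeriv {u ψ : ℂ → ℂ} (v : ℂ) (hψ : ContDiff ℝ 2 ψ)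
    (hc : HasCompactSupport ψ) (hu : ∀ z ∈ tsupport ψ, ContDiffAt ℝ 2 u z) :
    ∫ z, u z * dirDeriv v (dirDeriv v ψ) z = ∫ z, dirDeriv v (dirDeriv v u) z * ψ z := by
  have hψ1 : ContDiff ℝ 1 (dirDeriv v ψ) :=
    contDiff_iff_contDiffAt.2 fun z => contDiffAt_dirDeriv hψ.contDiffAt (by norm_num)
  have hψ2 : ContDiff ℝ 0 (dirDeriv v (dirDeriv v ψ)) :=
    contDiff_iff_contDiffAt.2 fun z => contDiffAt_dirDeriv hψ1.contDiffAt (by norm_num)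
  have t1 := tsupport_dirDeriv_subset v ψ
  have t2 := (tsupport_dirDeriv_subset v (dirDeriv v ψ)).trans t1
  have hc1 : HasCompactSupport (dirDeriv v ψ) := hc.of_isClosed_subset (isClosed_tsupport _) t1
  have hc2 : HasCompactSupport (dirDeriv v (dirDeriv v ψ)) :=
    hc.of_isClosed_subset (isClosed_tsupport _) t2
  have hu1 : ∀ z ∈ tsupport ψ, ContDiffAt ℝ 1 (dirDeriv v u) z := fun z hz =>
    contDiffAt_dirDeriv (hu z hz) (by norm_num)
  have hu2 : ∀ z ∈ tsupport ψ, ContDiffAt ℝ 0 (dirDeriv v (dirDeriv v u)) z := fun z hz =>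
    contDiffAt_dirDeriv (hu1 z hz) (by norm_num)
  have e1 := integral_mul_fderiv_eq_neg_fderiv_mul_of_integrable (μ := volume) (v := v)
    (f := u) (g := dirDeriv v ψ)
    (integrable_mul_of_tsupport (u := dirDeriv v u) hψ1.continuous hc1
      fun z hz => (hu1 z (t1 hz)).continuousAt)
    (integrable_mul_of_tsupport hψ2.continuous hc2 fun z hz => (hu z (t2 hz)).continuousAt)
    (integrable_mul_of_tsupport hψ1.continuous hc1 fun z hz => (hu z (t1 hz)).continuousAt)
    (fun z hz => (hu z (t1 hz)).differentiableAt (by norm_num))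
    (fun z _ => hψ1.contDiffAt.differentiableAt (by norm_num))
  have e2 := integral_mul_fderiv_eq_neg_fderiv_mul_of_integrable (μ := volume) (v := v)
    (f := dirDeriv v u) (g := ψ)
    (integrable_mul_of_tsupport (u := dirDeriv v (dirDeriv v u)) hψ.continuous hc
      fun z hz => (hu2 z hz).continuousAt)
    (integrable_mul_of_tsupport hψ1.continuous hc1 fun z hz => (hu1 z (t1 hz)).continuousAt)
    (integrable_mul_of_tsupport hψ.continuous hc fun z hz => (hu1 z hz).continuousAt)
    (fun z hz => (hu1 z hz).differentiableAt (by norm_num))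
    (fun z _ => hψ.contDiffAt.differentiableAt (by norm_num))
  calc _ = -∫ z, dirDeriv v u z * dirDeriv v ψ z := e1
    _ = -(-∫ z, dirDeriv v (dirDeriv v u) z * ψ z) := congrArg _ e2
    _ = _ := neg_neg _

theorem continuous_dirDeriv_dirDeriv {ψ : ℂ → ℂ} (v : ℂ) (hψ : ContDiff ℝ 2 ψ) :
    Continuous (dirDeriv v (dirDeriv v ψ)) := by
  have hψ1 : ContDiff ℝ 1 (dirDeriv v ψ) :=
    contDiff_iff_contDiffAt.2 fun z => contDiffAt_dirDeriv hψ.contDiffAt (by norm_num)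
  exact (contDiff_iff_contDiffAt.2 fun z =>
    contDiffAt_dirDeriv (m := 0) hψ1.contDiffAt (by norm_num)).continuous

theorem continuous_flatLaplacian {ψ : ℂ → ℂ} (hψ : ContDiff ℝ 2 ψ) :
    Continuous (flatLaplacian ψ) :=
  (continuous_dirDeriv_dirDeriv 1 hψ).add (continuous_dirDeriv_dirDeriv I hψ)

theorem tsupport_flatLaplacian_subset (f : ℂ → ℂ) : tsupport (flatLaplacian f) ⊆ tsupport f := by
  refine (tsupport_add _ _).trans (union_subset ?_ ?_)
  · exact (tsupport_dirDeriv_subset _ _).trans (tsupport_dirDeriv_subset _ _)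
  · exact (tsupport_dirDeriv_subset _ _).trans (tsupport_dirDeriv_subset _ _)

/-- Green's formula against a test function whose support avoids the singularities. -/
theorem integral_mul_flatLaplacian {u ψ : ℂ → ℂ} (hψ : ContDiff ℝ 2 ψ)
    (hc : HasCompactSupport ψ) (hu : ∀ z ∈ tsupport ψ, ContDiffAt ℝ 2 u z) :
    ∫ z, u z * flatLaplacian ψ z = ∫ z, flatLaplacian u z * ψ z := by
  have hi (v : ℂ) : Integrable (fun z => u z * dirDeriv v (dirDeriv v ψ) z) := by
    have t := (tsupport_dirDeriv_subset v (dirDeriv v ψ)).trans (tsupport_dirDeriv_subset v ψ)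
    exact integrable_mul_of_tsupport (continuous_dirDeriv_dirDeriv v hψ)
      (hc.of_isClosed_subset (isClosed_tsupport _) t) fun z hz => (hu z (t hz)).continuousAt
  have hi' (v : ℂ) : Integrable (fun z => dirDeriv v (dirDeriv v u) z * ψ z) :=
    integrable_mul_of_tsupport hψ.continuous hc fun z hz =>
      (contDiffAt_dirDeriv (m := 0) (contDiffAt_dirDeriv (m := 1) (hu z hz) (by norm_num))
        (by norm_num)).continuousAt
  simp only [flatLaplacian, mul_add, add_mul]
  rw [integral_add (hi 1) (hi I), integral_add (hi' 1) (hi' I),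
    integral_mul_dirDeriv_dirDeriv 1 hψ hc hu, integral_mul_dirDeriv_dirDeriv I hψ hc hu]

/-! ### Product and chain rules -/

theorem dirDeriv_mul {v : ℂ} {f g : ℂ → ℂ} {z : ℂ} (hf : DifferentiableAt ℝ f z)
    (hg : DifferentiableAt ℝ g z) :
    dirDeriv v (fun w => f w * g w) z = f z * dirDeriv v g z + dirDeriv v f z * g z := by
  unfold dirDeriv
  rw [fderiv_fun_mul hf hg]
  simp [mul_comm]

theorem dirDeriv_add {v : ℂ} {f g : ℂ → ℂ} {z : ℂ} (hf : DifferentiableAt ℝ f z)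
    (hg : DifferentiableAt ℝ g z) :
    dirDeriv v (fun w => f w + g w) z = dirDeriv v f z + dirDeriv v g z := by
  unfold dirDeriv
  rw [fderiv_fun_add hf hg]
  simp

theorem dirDeriv_dirDeriv_mul {v : ℂ} {f g : ℂ → ℂ} {z : ℂ} (hf : ContDiffAt ℝ 2 f z)
    (hg : ContDiffAt ℝ 2 g z) :
    dirDeriv v (dirDeriv v fun w => f w * g w) z =
      f z * dirDeriv v (dirDeriv v g) z + 2 * (dirDeriv v f z * dirDeriv v g z) +
        dirDeriv v (dirDeriv v f) z * g z := by
  have h1 : dirDeriv v (fun w => f w * g w) =ᶠ[𝓝 z]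
      fun w => f w * dirDeriv v g w + dirDeriv v f w * g w := by
    filter_upwards [hf.eventually (by norm_num), hg.eventually (by norm_num)] with w h h'
    exact dirDeriv_mul (h.differentiableAt (by norm_num)) (h'.differentiableAt (by norm_num))
  have df := hf.differentiableAt (by norm_num)
  have dg := hg.differentiableAt (by norm_num)
  have df1 : DifferentiableAt ℝ (dirDeriv v f) z :=
    (contDiffAt_dirDeriv (m := 1) hf (by norm_num)).differentiableAt (by norm_num)
  have dg1 : DifferentiableAt ℝ (dirDeriv v g) z :=
    (contDiffAt_dirDeriv (m := 1) hg (by norm_num)).differentiableAt (by norm_num)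
  rw [(dirDeriv_congr h1).eq_of_nhds, dirDeriv_add (df.fun_mul dg1) (df1.fun_mul dg),
    dirDeriv_mul df dg1, dirDeriv_mul df1 dg]
  ring

theorem flatLaplacian_mul {f g : ℂ → ℂ} {z : ℂ} (hf : ContDiffAt ℝ 2 f z)
    (hg : ContDiffAt ℝ 2 g z) :
    flatLaplacian (fun w => f w * g w) z = f z * flatLaplacian g z +
      (2 * (dirDeriv 1 f z * dirDeriv 1 g z + dirDeriv I f z * dirDeriv I g z) +
        flatLaplacian f z * g z) := by
  simp only [flatLaplacian, dirDeriv_dirDeriv_mul hf hg]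
  ring

theorem contDiffAt_ofReal_comp {f : ℂ → ℝ} {z : ℂ} {n : WithTop ℕ∞} (hf : ContDiffAt ℝ n f z) :
    ContDiffAt ℝ n (fun w => (f w : ℂ)) z :=
  ofRealCLM.contDiff.contDiffAt.comp z hf

theorem flatLaplacian_ofReal {f : ℂ → ℝ} {z : ℂ} (hf : ContDiffAt ℝ 2 f z) :
    flatLaplacian (fun w => (f w : ℂ)) z = (Laplacian.laplacian f z : ℂ) := by
  rw [flatLaplacian_eq_laplacian (contDiffAt_ofReal_comp hf)]
  exact hf.laplacian_CLM_comp_left (l := ofRealCLM)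

theorem dirDeriv_comp {S : ℝ → ℝ} {f : ℂ → ℝ} {v z : ℂ} (hS : DifferentiableAt ℝ S (f z))
    (hf : DifferentiableAt ℝ f z) :
    dirDeriv v (fun w => (S (f w) : ℂ)) z = deriv S (f z) * dirDeriv v (fun w => (f w : ℂ)) z := by
  have h1 : HasFDerivAt (fun w => (S (f w) : ℂ))
      (ofRealCLM.comp (deriv S (f z) • fderiv ℝ f z)) z :=
    ofRealCLM.hasFDerivAt.comp z (hS.hasDerivAt.comp_hasFDerivAt z hf.hasFDerivAt)
  have h2 : HasFDerivAt (fun w => (f w : ℂ)) (ofRealCLM.comp (fderiv ℝ f z)) z :=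
    ofRealCLM.hasFDerivAt.comp z hf.hasFDerivAt
  unfold dirDeriv
  rw [h1.fderiv, h2.fderiv]
  simp

theorem dirDeriv_dirDeriv_comp {S : ℝ → ℝ} {f : ℂ → ℝ} {v z : ℂ} (hS : ContDiff ℝ 2 S)
    (hf : ContDiffAt ℝ 2 f z) :
    dirDeriv v (dirDeriv v fun w => (S (f w) : ℂ)) z =
      ((deriv (deriv S) (f z) : ℝ) : ℂ) * dirDeriv v (fun w => (f w : ℂ)) z ^ 2 +
        ((deriv S (f z) : ℝ) : ℂ) * dirDeriv v (dirDeriv v fun w => (f w : ℂ)) z := by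
  have hS1 : Differentiable ℝ (deriv S) :=
    (hS.iterate_deriv' 1 1).differentiable (by norm_num)
  have h1 : (dirDeriv v fun w => (S (f w) : ℂ)) =ᶠ[𝓝 z]
      fun w => ((deriv S (f w) : ℝ) : ℂ) * dirDeriv v (fun w => (f w : ℂ)) w := by
    filter_upwards [hf.eventually (by norm_num)] with w h
    exact dirDeriv_comp (hS.differentiable (by norm_num) _) (h.differentiableAt (by norm_num))
  have df := hf.differentiableAt (by norm_num)
  have d1 : DifferentiableAt ℝ (fun w => ((deriv S (f w) : ℝ) : ℂ)) z :=
    ofRealCLM.differentiableAt.comp z ((hS1 _).comp z df)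
  have d2 : DifferentiableAt ℝ (dirDeriv v fun w => (f w : ℂ)) z :=
    (contDiffAt_dirDeriv (m := 1) (contDiffAt_ofReal_comp hf) (by norm_num)).differentiableAt
      (by norm_num)
  rw [(dirDeriv_congr h1).eq_of_nhds, dirDeriv_mul d1 d2, dirDeriv_comp (hS1 _) df]
  ring

/-! ### Logarithmic cut-offs at a point -/

theorem contDiffAt_log_norm_sub {z p : ℂ} (h : z ≠ p) {n : WithTop ℕ∞} :
    ContDiffAt ℝ n (fun w => Real.log ‖w - p‖) z := by
  refine ContDiffAt.log ?_ (norm_ne_zero_iff.2 (sub_ne_zero.2 h))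
  exact (contDiffAt_id.sub contDiffAt_const).norm ℝ (sub_ne_zero.2 h)

/-- The harmonicity of `log ‖w - p‖` is what makes logarithmic cut-offs efficient: in the Laplacian
of a function of it, the term with the first derivative disappears. -/
theorem flatLaplacian_log_norm_sub {z p : ℂ} (h : z ≠ p) :
    flatLaplacian (fun w => (Real.log ‖w - p‖ : ℂ)) z = 0 := by
  rw [flatLaplacian_ofReal (contDiffAt_log_norm_sub h)]
  have h2 : AnalyticAt ℂ (fun w : ℂ => w - p) z := by fun_prop
  have := (h2.harmonicAt_log_norm (sub_ne_zero.2 h)).2.eq_of_nhds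
  simp [this]

/-- The norm is 1-Lipschitz, and the derivative of `log` contributes `1 / ‖z - p‖`. -/
theorem norm_dirDeriv_log_norm_sub_le {z p v : ℂ} (h : z ≠ p) :
    ‖dirDeriv v (fun w => (Real.log ‖w - p‖ : ℂ)) z‖ ≤ ‖v‖ / ‖z - p‖ := by
  have h0 : (fun w : ℂ => ‖w - p‖) z ≠ 0 := norm_ne_zero_iff.2 (sub_ne_zero.2 h)
  have hd : DifferentiableAt ℝ (fun w : ℂ => ‖w - p‖) z :=
    ((contDiffAt_id.sub contDiffAt_const).norm ℝ (sub_ne_zero.2 h) :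
      ContDiffAt ℝ 1 (fun w : ℂ => ‖w - p‖) z).differentiableAt (by norm_num)
  rw [dirDeriv_comp (S := Real.log) (f := fun w : ℂ => ‖w - p‖)
    (Real.differentiableAt_log h0) hd, Real.deriv_log, norm_mul]
  have hl : ‖fderiv ℝ (fun w : ℂ => ‖w - p‖) z‖ ≤ (1 : NNReal) := by
    refine norm_fderiv_le_of_lipschitz ℝ (LipschitzWith.of_dist_le_mul fun a b => ?_)
    simpa [dist_eq_norm] using abs_norm_sub_norm_le (a - p) (b - p)
  have h2 : HasFDerivAt (fun w => (‖w - p‖ : ℂ))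
      (ofRealCLM.comp (fderiv ℝ (fun w : ℂ => ‖w - p‖) z)) z :=
    ofRealCLM.hasFDerivAt.comp z hd.hasFDerivAt
  have h3 : ‖dirDeriv v (fun w => (‖w - p‖ : ℂ)) z‖ ≤ ‖v‖ := by
    unfold dirDeriv
    rw [h2.fderiv]
    simp only [ContinuousLinearMap.comp_apply, ofRealCLM_apply, norm_real]
    refine (ContinuousLinearMap.le_opNorm _ v).trans ?_
    simpa using mul_le_mul_of_nonneg_right hl (norm_nonneg v)
  rw [norm_real, norm_inv, norm_norm, div_eq_inv_mul]
  exact mul_le_mul_of_nonneg_left h3 (by positivity)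

open Classical in
/-- A logarithmic cut-off: it vanishes for `‖z - p‖ ≤ exp (-2 n)` and is `1` for
`exp (-n) ≤ ‖z - p‖`. -/
def logCutoff (p : ℂ) (n : ℝ) (z : ℂ) : ℂ :=
  if z = p then 0 else (Real.smoothTransition (2 + Real.log ‖z - p‖ / n) : ℝ)

theorem logCutoff_of_ne {p z : ℂ} (n : ℝ) (h : z ≠ p) :
    logCutoff p n z = (Real.smoothTransition (2 + Real.log ‖z - p‖ / n) : ℝ) := if_neg h

theorem logCutoff_eventuallyEq {p z : ℂ} (n : ℝ) (h : z ≠ p) :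
    logCutoff p n =ᶠ[𝓝 z] fun w => (Real.smoothTransition (2 + Real.log ‖w - p‖ / n) : ℝ) := by
  filter_upwards [isOpen_ne.mem_nhds h] with w hw using logCutoff_of_ne n hw

theorem logCutoff_eq_zero {p z : ℂ} {n : ℝ} (hn : 0 < n) (h : ‖z - p‖ ≤ Real.exp (-2 * n)) :
    logCutoff p n z = 0 := by
  by_cases hz : z = p
  · exact if_pos hz
  · rw [logCutoff_of_ne n hz, Real.smoothTransition.zero_of_nonpos, ofReal_zero]
    have h1 := (Real.log_le_iff_le_exp (norm_pos_iff.2 (sub_ne_zero.2 hz))).2 h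
    have h2 : Real.log ‖z - p‖ / n ≤ -2 := by rw [div_le_iff₀ hn]; exact h1
    linarith

theorem logCutoff_eq_one {p z : ℂ} {n : ℝ} (hn : 0 < n) (h : Real.exp (-n) ≤ ‖z - p‖) :
    logCutoff p n z = 1 := by
  have h0 : 0 < ‖z - p‖ := (Real.exp_pos _).trans_le h
  rw [logCutoff_of_ne n (sub_ne_zero.1 (norm_pos_iff.1 h0)),
    Real.smoothTransition.one_of_one_le, ofReal_one]
  have h1 := (Real.le_log_iff_exp_le h0).2 h
  have h2 : -1 ≤ Real.log ‖z - p‖ / n := by rw [le_div_iff₀ hn]; linarith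
  linarith

theorem norm_logCutoff_le (p : ℂ) (n : ℝ) (z : ℂ) : ‖logCutoff p n z‖ ≤ 1 := by
  unfold logCutoff
  split_ifs
  · simp
  · rw [norm_real, Real.norm_of_nonneg (Real.smoothTransition.nonneg _)]
    exact Real.smoothTransition.le_one _

/-- At `p`, where `log ‖w - p‖` is singular, the cut-off is zero on a whole disc of radius `exp (-2
n)`. -/
theorem contDiff_logCutoff (p : ℂ) {n : ℝ} (hn : 0 < n) : ContDiff ℝ 2 (logCutoff p n) := by
  rw [contDiff_iff_contDiffAt]
  intro z
  by_cases hz : z = p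
  · have : logCutoff p n =ᶠ[𝓝 z] fun _ => 0 := by
      filter_upwards [Metric.ball_mem_nhds z (Real.exp_pos (-2 * n))] with w hw
      rw [hz, Metric.mem_ball, dist_eq_norm] at hw
      exact logCutoff_eq_zero hn hw.le
    exact contDiffAt_const.congr_of_eventuallyEq this
  · refine ContDiffAt.congr_of_eventuallyEq ?_ (logCutoff_eventuallyEq n hz)
    refine contDiffAt_ofReal_comp ?_
    refine (Real.smoothTransition.contDiffAt (n := 2)).comp z ?_
    exact contDiffAt_const.add ((contDiffAt_log_norm_sub hz).div_const n)

/-- The bounds for the derivatives of logarithmic cut-offs. -/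
theorem exists_logCutoff_bound : ∃ K : ℝ, 0 ≤ K ∧ ∀ (p : ℂ) (n : ℝ), 0 < n → ∀ z : ℂ,
    (z - p ∈ {w : ℂ | Real.exp (-2 * n) ≤ ‖w‖ ∧ ‖w‖ ≤ Real.exp (-n)} →
      (∀ v : ℂ, ‖dirDeriv v (logCutoff p n) z‖ ≤ K * ‖v‖ / (n * ‖z - p‖)) ∧
      ‖flatLaplacian (logCutoff p n) z‖ ≤ K / (n * ‖z - p‖) ^ 2) ∧
    (z - p ∉ {w : ℂ | Real.exp (-2 * n) ≤ ‖w‖ ∧ ‖w‖ ≤ Real.exp (-n)} →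
      (∀ v : ℂ, dirDeriv v (logCutoff p n) z = 0) ∧ flatLaplacian (logCutoff p n) z = 0) := by
  have hS : ContDiff ℝ 2 Real.smoothTransition := Real.smoothTransition.contDiff (n := 2)
  have hS1 : ContDiff ℝ 1 (deriv Real.smoothTransition) := hS.iterate_deriv' 1 1
  have hS2 : Continuous (deriv (deriv Real.smoothTransition)) := hS1.continuous_deriv le_rfl
  obtain ⟨K1, hK1⟩ := (isCompact_Icc (a := (0 : ℝ)) (b := 1)).exists_bound_of_continuousOn
    hS1.continuous.continuousOn
  obtain ⟨K2, hK2⟩ := (isCompact_Icc (a := (0 : ℝ)) (b := 1)).exists_bound_of_continuousOn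
    hS2.continuousOn
  have hK10 : 0 ≤ K1 := (norm_nonneg _).trans (hK1 0 (by simp))
  have hK20 : 0 ≤ K2 := (norm_nonneg _).trans (hK2 0 (by simp))
  -- `K1` serves the gradient; `2 * K2` serves the Laplacian, to which both coordinate directions
  -- contribute.
  refine ⟨K1 + 2 * K2, by positivity, fun p n hn z => ⟨fun hz => ?_, fun hz => ?_⟩⟩
  · obtain ⟨ha, hb⟩ := hz
    have h0 : 0 < ‖z - p‖ := (Real.exp_pos _).trans_le ha
    have hzp : z ≠ p := sub_ne_zero.1 (norm_pos_iff.1 h0)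
    -- The profile as a function of `log ‖z - p‖`; each derivative of it yields a factor `1 / n`.
    set S : ℝ → ℝ := fun x => Real.smoothTransition (2 + x / n) with hSdef
    have hSc : ContDiff ℝ 2 S := hS.comp (contDiff_const.add (contDiff_id.div_const n))
    have hd (g : ℝ → ℝ) (hg : Differentiable ℝ g) (x : ℝ) :
        deriv (fun x => g (2 + x / n)) x = deriv g (2 + x / n) / n := by
      have h1 : HasDerivAt (fun x : ℝ => 2 + x / n) (1 / n) x :=
        ((hasDerivAt_id x).div_const n).const_add 2
      have := ((hg _).hasDerivAt.comp x h1).deriv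
      rw [show (fun x => g (2 + x / n)) = g ∘ fun x => 2 + x / n from rfl, this]
      ring
    have hd1 : deriv S = fun x => deriv Real.smoothTransition (2 + x / n) / n :=
      funext fun x => hd _ (hS.differentiable (by norm_num)) x
    have hd2 (x : ℝ) : deriv (deriv S) x =
        deriv (deriv Real.smoothTransition) (2 + x / n) / n ^ 2 := by
      rw [hd1]
      simp only [deriv_div_const]
      rw [hd _ (hS1.differentiable (by norm_num))]
      field_simp
    have hmem : 2 + Real.log ‖z - p‖ / n ∈ Icc (0 : ℝ) 1 := by
      have h1 := (Real.le_log_iff_exp_le h0).2 ha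
      have h2 := (Real.log_le_iff_le_exp h0).2 hb
      constructor
      · have : -2 ≤ Real.log ‖z - p‖ / n := by rw [le_div_iff₀ hn]; exact h1
        linarith
      · have : Real.log ‖z - p‖ / n ≤ -1 := by rw [div_le_iff₀ hn]; linarith
        linarith
    have hl := contDiffAt_log_norm_sub (n := 2) hzp
    have b1 : ‖((deriv S (Real.log ‖z - p‖) : ℝ) : ℂ)‖ ≤ K1 / n := by
      rw [hd1, norm_real, norm_div, Real.norm_of_nonneg hn.le]
      exact div_le_div_of_nonneg_right (hK1 _ hmem) hn.le
    have b2 : ‖((deriv (deriv S) (Real.log ‖z - p‖) : ℝ) : ℂ)‖ ≤ K2 / n ^ 2 := by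
      rw [hd2, norm_real, norm_div, Real.norm_of_nonneg (by positivity : 0 ≤ n ^ 2)]
      exact div_le_div_of_nonneg_right (hK2 _ hmem) (by positivity)
    refine ⟨fun v => ?_, ?_⟩
    · rw [(dirDeriv_congr (logCutoff_eventuallyEq n hzp)).eq_of_nhds,
        dirDeriv_comp (S := S) (f := fun w => Real.log ‖w - p‖)
          (hSc.differentiable (by norm_num) _) (hl.differentiableAt (by norm_num)), norm_mul]
      calc _ ≤ K1 / n * (‖v‖ / ‖z - p‖) :=
            mul_le_mul b1 (norm_dirDeriv_log_norm_sub_le hzp) (norm_nonneg _) (by positivity)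
        _ = K1 * ‖v‖ / (n * ‖z - p‖) := by field_simp
        _ ≤ _ := by gcongr; linarith
    · rw [flatLaplacian_congr (logCutoff_eventuallyEq n hzp)]
      have e : flatLaplacian (fun w => (S (Real.log ‖w - p‖) : ℂ)) z =
          ((deriv (deriv S) (Real.log ‖z - p‖) : ℝ) : ℂ) *
            (dirDeriv 1 (fun w => (Real.log ‖w - p‖ : ℂ)) z ^ 2 +
              dirDeriv I (fun w => (Real.log ‖w - p‖ : ℂ)) z ^ 2) +
          ((deriv S (Real.log ‖z - p‖) : ℝ) : ℂ) *
            flatLaplacian (fun w => (Real.log ‖w - p‖ : ℂ)) z := by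
        simp only [flatLaplacian]
        rw [dirDeriv_dirDeriv_comp hSc hl, dirDeriv_dirDeriv_comp hSc hl]
        ring
      rw [e, flatLaplacian_log_norm_sub hzp, mul_zero, add_zero, norm_mul]
      have c1 := norm_dirDeriv_log_norm_sub_le (v := 1) hzp
      have c2 := norm_dirDeriv_log_norm_sub_le (v := I) hzp
      rw [norm_one] at c1
      rw [norm_I] at c2
      have c3 : ‖dirDeriv 1 (fun w => (Real.log ‖w - p‖ : ℂ)) z ^ 2 +
          dirDeriv I (fun w => (Real.log ‖w - p‖ : ℂ)) z ^ 2‖ ≤ 2 * (1 / ‖z - p‖) ^ 2 := by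
        refine (norm_add_le _ _).trans ?_
        rw [norm_pow, norm_pow, two_mul]
        gcongr
      calc _ ≤ K2 / n ^ 2 * (2 * (1 / ‖z - p‖) ^ 2) :=
            mul_le_mul b2 c3 (norm_nonneg _) (by positivity)
        _ = 2 * K2 / (n * ‖z - p‖) ^ 2 := by field_simp
        _ ≤ _ := by gcongr; linarith
  -- Off the closed annulus the cut-off is locally constant, equal to 0 inside and to 1 outside.
  · have hc : ∃ c : ℂ, logCutoff p n =ᶠ[𝓝 z] fun _ => c := by
      simp only [mem_ofPred_eq, not_and_or, not_le] at hz
      rcases hz with hz | hz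
      · refine ⟨0, ?_⟩
        have : ∀ᶠ w in 𝓝 z, ‖w - p‖ < Real.exp (-2 * n) :=
          (continuous_id.sub continuous_const).norm.continuousAt.eventually_lt
            continuousAt_const hz
        filter_upwards [this] with w hw using logCutoff_eq_zero hn hw.le
      · refine ⟨1, ?_⟩
        have : ∀ᶠ w in 𝓝 z, Real.exp (-n) < ‖w - p‖ :=
          continuousAt_const.eventually_lt
            (continuous_id.sub continuous_const).norm.continuousAt hz
        filter_upwards [this] with w hw using logCutoff_eq_one hn hw.le
    obtain ⟨c, hc⟩ := hc
    have h0 (c v w : ℂ) : dirDeriv v (fun _ => c) w = 0 := by simp [dirDeriv]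
    have h1 (v : ℂ) : (dirDeriv v fun _ => c) = fun _ => 0 := funext fun w => h0 c v w
    refine ⟨fun v => by rw [(dirDeriv_congr hc).eq_of_nhds, h0], ?_⟩
    rw [flatLaplacian_congr hc]
    simp only [flatLaplacian, h1, h0, add_zero]

/-- The annulus on which the logarithmic cut-off varies. -/
def cutoffAnnulus (n : ℝ) : Set ℂ := {w : ℂ | Real.exp (-2 * n) ≤ ‖w‖ ∧ ‖w‖ ≤ Real.exp (-n)}

theorem measurableSet_cutoffAnnulus (n : ℝ) : MeasurableSet (cutoffAnnulus n) :=
  (measurableSet_le measurable_const measurable_norm).inter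
    (measurableSet_le measurable_norm measurable_const)

theorem integrableOn_cutoffAnnulus (n : ℝ) :
    IntegrableOn (fun w : ℂ => (‖w‖ ^ 2)⁻¹) (cutoffAnnulus n) := by
  have hc : IsCompact (cutoffAnnulus n) := by
    refine Metric.isCompact_of_isClosed_isBounded ?_ ?_
    · exact (isClosed_le continuous_const continuous_norm).inter
        (isClosed_le continuous_norm continuous_const)
    · refine (Metric.isBounded_closedBall (x := (0 : ℂ)) (r := Real.exp (-n))).subset ?_
      intro w hw
      simpa using hw.2
  refine ContinuousOn.integrableOn_compact hc (ContinuousOn.inv₀ (by fun_prop) ?_)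
  intro w hw
  have := (Real.exp_pos _).trans_le hw.1
  positivity

/-- In polar coordinates this is `2π ∫ dr / r`. Growth that is only linear in `n` loses against the
factor `1 / n²` in the bound for the Laplacian of the cut-off. -/
theorem integral_cutoffAnnulus {n : ℝ} (hn : 0 < n) :
    ∫ w in cutoffAnnulus n, (‖w‖ ^ 2)⁻¹ = 2 * Real.pi * n := by
  rw [← integral_indicator (measurableSet_cutoffAnnulus n)]
  have e : (cutoffAnnulus n).indicator (fun w : ℂ => (‖w‖ ^ 2)⁻¹) =
      fun w => (Icc (Real.exp (-2 * n)) (Real.exp (-n))).indicator (fun y : ℝ => (y ^ 2)⁻¹) ‖w‖ := by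
    funext w
    by_cases h : w ∈ cutoffAnnulus n
    · rw [indicator_of_mem h, indicator_of_mem (by exact h)]
    · rw [indicator_of_notMem h, indicator_of_notMem (by exact h)]
  have hlt : Real.exp (-2 * n) ≤ Real.exp (-n) := Real.exp_le_exp.2 (by linarith)
  rw [e, integral_fun_norm_addHaar volume
    ((Icc (Real.exp (-2 * n)) (Real.exp (-n))).indicator (fun y : ℝ => (y ^ 2)⁻¹)),
    Complex.finrank_real_complex]
  have e2 : (fun y : ℝ => y ^ (2 - 1) •
      (Icc (Real.exp (-2 * n)) (Real.exp (-n))).indicator (fun y : ℝ => (y ^ 2)⁻¹) y) =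
      (Icc (Real.exp (-2 * n)) (Real.exp (-n))).indicator fun y => y⁻¹ := by
    funext y
    by_cases h : y ∈ Icc (Real.exp (-2 * n)) (Real.exp (-n))
    · have : 0 < y := (Real.exp_pos _).trans_le h.1
      rw [indicator_of_mem h, indicator_of_mem h]
      simp only [smul_eq_mul]
      field_simp
      norm_num
    · rw [indicator_of_notMem h, indicator_of_notMem h, smul_zero]
  rw [e2, setIntegral_indicator measurableSet_Icc,
    show Ioi (0 : ℝ) ∩ Icc (Real.exp (-2 * n)) (Real.exp (-n)) = Icc _ _ from
      inter_eq_self_of_subset_right fun y hy => (Real.exp_pos _).trans_le hy.1,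
    integral_Icc_eq_integral_Ioc, ← intervalIntegral.integral_of_le hlt,
    integral_inv_of_pos (Real.exp_pos _) (Real.exp_pos _), ← Real.exp_sub, Real.log_exp]
  have hv : volume.real (Metric.ball (0 : ℂ) 1) = Real.pi := by
    rw [measureReal_def, Complex.volume_ball]
    simp
  rw [hv]
  simp only [smul_eq_mul, nsmul_eq_mul]
  push_cast
  ring

/-! ### Removal of isolated singularities -/

/-- `Δ u = f` in the sense of distributions. -/
def HasWeakLaplacian (u f : ℂ → ℂ) : Prop :=
  ∀ ψ : ℂ → ℂ, ContDiff ℝ 2 ψ → HasCompactSupport ψ →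
    ∫ z, u z * flatLaplacian ψ z = ∫ z, f z * ψ z

theorem integrable_bounded_mul {u h : ℂ → ℂ} {B : ℝ} (hum : Measurable u) (hub : ∀ z, ‖u z‖ ≤ B)
    (hh : Continuous h) (hc : HasCompactSupport h) : Integrable (fun z => u z * h z) :=
  (hh.integrable_of_hasCompactSupport hc).bdd_mul hum.aestronglyMeasurable
    (Eventually.of_forall hub)

/-- If the weak equation holds against all products of a test function with cut-offs at `p`,
it holds against the test function. -/
theorem integral_eq_of_logCutoff {u f ψ : ℂ → ℂ} {B : ℝ} (p : ℂ) (hum : Measurable u)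
    (hfm : Measurable f) (hub : ∀ z, ‖u z‖ ≤ B) (hfb : ∀ z, ‖f z‖ ≤ B)
    (hψ : ContDiff ℝ 2 ψ) (hc : HasCompactSupport ψ)
    (h : ∀ n : ℕ, 0 < n → ∫ z, u z * flatLaplacian (fun w => logCutoff p n w * ψ w) z =
      ∫ z, f z * (logCutoff p n z * ψ z)) :
    ∫ z, u z * flatLaplacian ψ z = ∫ z, f z * ψ z := by
  have hlim (z : ℂ) (hz : z ≠ p) : Tendsto (fun n : ℕ => logCutoff p n z) atTop (𝓝 1) := by
    have h1 : Tendsto (fun n : ℕ => Real.exp (-(n : ℝ))) atTop (𝓝 0) :=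
      Real.tendsto_exp_neg_atTop_nhds_zero.comp tendsto_natCast_atTop_atTop
    have h2 := h1.eventually_lt_const (norm_pos_iff.2 (sub_ne_zero.2 hz))
    refine tendsto_const_nhds.congr' ?_
    filter_upwards [h2, eventually_gt_atTop 0] with n hn h0
    exact (logCutoff_eq_one (by exact_mod_cast h0) hn.le).symm
  have hcut (n : ℕ) : Measurable (logCutoff p n) := by
    unfold logCutoff
    refine Measurable.ite (measurableSet_singleton p) measurable_const ?_
    refine measurable_ofReal.comp (Real.smoothTransition.continuous.measurable.comp ?_)
    exact measurable_const.add ((Real.measurable_log.comp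
      (measurable_id.sub measurable_const).norm).div_const _)
  have hne : ∀ᵐ z : ℂ, z ≠ p := by
    simp [ae_iff]
  have hB : 0 ≤ B := (norm_nonneg _).trans (hub 0)
  -- Dominated convergence: the cut-offs are bounded by 1 and tend to 1 off the null set `{p}`.
  have key (a b : ℂ → ℂ) (ham : Measurable a) (hab : ∀ z, ‖a z‖ ≤ B) (hb : Continuous b)
      (hbc : HasCompactSupport b) :
      Tendsto (fun n : ℕ => ∫ z, a z * (logCutoff p n z * b z)) atTop (𝓝 (∫ z, a z * b z)) := by
    refine tendsto_integral_of_dominated_convergence (fun z => B * ‖b z‖) (fun n => ?_) ?_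
      (fun n => ?_) ?_
    · exact (ham.mul ((hcut n).mul hb.measurable)).aestronglyMeasurable
    · exact (hb.integrable_of_hasCompactSupport hbc).norm.const_mul B
    · refine Eventually.of_forall fun z => ?_
      rw [norm_mul, norm_mul]
      refine mul_le_mul (hab z) ?_ (by positivity) hB
      exact mul_le_of_le_one_left (norm_nonneg _) (norm_logCutoff_le p n z)
    · filter_upwards [hne] with z hz
      simpa using tendsto_const_nhds.mul ((hlim z hz).mul_const (b z))
  have hLc : HasCompactSupport (flatLaplacian ψ) :=
    hc.of_isClosed_subset (isClosed_tsupport _) (tsupport_flatLaplacian_subset ψ)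
  have k1 := key u (flatLaplacian ψ) hum hub (continuous_flatLaplacian hψ) hLc
  have k2 := key f ψ hfm hfb hψ.continuous hc
  obtain ⟨K, hK0, hK⟩ := exists_logCutoff_bound
  have hcd (v : ℂ) : Continuous (dirDeriv v ψ) :=
    (contDiff_iff_contDiffAt.2 fun z =>
      contDiffAt_dirDeriv (m := 1) hψ.contDiffAt (by norm_num)).continuous
  have hcs (v : ℂ) : HasCompactSupport (dirDeriv v ψ) :=
    hc.of_isClosed_subset (isClosed_tsupport _) (tsupport_dirDeriv_subset v ψ)
  obtain ⟨C0, hC0⟩ := hc.exists_bound_of_continuous hψ.continuous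
  obtain ⟨C1, hC1⟩ := (hcs 1).exists_bound_of_continuous (hcd 1)
  obtain ⟨C2, hC2⟩ := (hcs I).exists_bound_of_continuous (hcd I)
  have hC00 := (norm_nonneg _).trans (hC0 0)
  have hC10 := (norm_nonneg _).trans (hC1 0)
  have hC20 := (norm_nonneg _).trans (hC2 0)
  -- The terms of the Leibniz rule in which the cut-off is differentiated; their integral against
  -- `u` has to tend to 0.
  let R : ℕ → ℂ → ℂ := fun n z =>
    2 * (dirDeriv 1 (logCutoff p n) z * dirDeriv 1 ψ z +
      dirDeriv I (logCutoff p n) z * dirDeriv I ψ z) + flatLaplacian (logCutoff p n) z * ψ z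
  set C : ℝ := 2 * (K * C1 + K * C2) + K * C0
  have hC : 0 ≤ C := by positivity
  have hR (n : ℕ) (hn : 0 < n) (z : ℂ) : ‖u z * R n z‖ ≤
      B * C / n ^ 2 * (cutoffAnnulus n).indicator (fun w : ℂ => (‖w‖ ^ 2)⁻¹) (z - p) := by
    have hn' : (0 : ℝ) < n := by exact_mod_cast hn
    by_cases hz : z - p ∈ cutoffAnnulus n
    · obtain ⟨hA, hB'⟩ := (hK p n hn' z).1 hz
      have h0 : 0 < ‖z - p‖ := (Real.exp_pos _).trans_le hz.1
      -- On the annulus `n ‖z - p‖ ≤ n exp (-n) ≤ 1`, so the gradient terms, of size `1 / q`, are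
      -- also at most `1 / q²`.
      have hle : (n : ℝ) * ‖z - p‖ ≤ 1 := by
        have h1 : (n : ℝ) ≤ Real.exp n := by linarith [Real.add_one_le_exp (n : ℝ)]
        calc (n : ℝ) * ‖z - p‖ ≤ Real.exp n * Real.exp (-n) :=
              mul_le_mul h1 hz.2 h0.le (Real.exp_pos _).le
          _ = 1 := by rw [← Real.exp_add]; simp
      set q := (n : ℝ) * ‖z - p‖ with hq
      have hq0 : 0 < q := by positivity
      have hqq : 1 / q ≤ 1 / q ^ 2 :=
        one_div_le_one_div_of_le (by positivity) (by nlinarith)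
      have hA1 : ‖dirDeriv 1 (logCutoff p n) z‖ ≤ K * (1 / q ^ 2) := by
        refine (hA 1).trans ?_
        rw [norm_one, mul_one, div_eq_mul_one_div]
        gcongr
      have hA2 : ‖dirDeriv I (logCutoff p n) z‖ ≤ K * (1 / q ^ 2) := by
        refine (hA I).trans ?_
        rw [norm_I, mul_one, div_eq_mul_one_div]
        gcongr
      have hA3 : ‖flatLaplacian (logCutoff p n) z‖ ≤ K * (1 / q ^ 2) := by
        refine hB'.trans_eq ?_
        rw [div_eq_mul_one_div]
      have hRb : ‖R n z‖ ≤ C * (1 / q ^ 2) := by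
        calc ‖R n z‖ ≤ 2 * (K * (1 / q ^ 2) * C1 + K * (1 / q ^ 2) * C2) +
              K * (1 / q ^ 2) * C0 := by
              refine (norm_add_le _ _).trans (add_le_add ?_ ?_)
              · rw [norm_mul, Complex.norm_ofNat]
                refine mul_le_mul_of_nonneg_left ((norm_add_le _ _).trans ?_) (by norm_num)
                rw [norm_mul, norm_mul]
                exact add_le_add (mul_le_mul hA1 (hC1 z) (norm_nonneg _) (by positivity))
                  (mul_le_mul hA2 (hC2 z) (norm_nonneg _) (by positivity))
              · rw [norm_mul]
                exact mul_le_mul hA3 (hC0 z) (norm_nonneg _) (by positivity)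
          _ = C * (1 / q ^ 2) := by ring
      rw [indicator_of_mem hz, norm_mul]
      calc _ ≤ B * (C * (1 / q ^ 2)) := mul_le_mul (hub z) hRb (norm_nonneg _) hB
        _ = _ := by rw [hq]; field_simp
    · obtain ⟨hA, hB'⟩ := (hK p n hn' z).2 hz
      rw [indicator_of_notMem hz]
      simp [R, hA, hB']
  have hind (n : ℕ) : Integrable fun z : ℂ => B * C / n ^ 2 *
      (cutoffAnnulus n).indicator (fun w : ℂ => (‖w‖ ^ 2)⁻¹) (z - p) := by
    refine Integrable.const_mul (Integrable.comp_sub_right ?_ p) _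
    exact (integrable_indicator_iff (measurableSet_cutoffAnnulus n)).2
      (integrableOn_cutoffAnnulus n)
  have hint (n : ℕ) (hn : 0 < n) : ‖∫ z, u z * R n z‖ ≤ 2 * Real.pi * (B * C) * (1 / n) := by
    have hn' : (0 : ℝ) < n := by exact_mod_cast hn
    refine (norm_integral_le_of_norm_le (hind n) (Eventually.of_forall (hR n hn))).trans_eq ?_
    rw [integral_const_mul, integral_sub_right_eq_self
      ((cutoffAnnulus n).indicator (fun w : ℂ => (‖w‖ ^ 2)⁻¹)),
      integral_indicator (measurableSet_cutoffAnnulus n), integral_cutoffAnnulus hn']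
    field_simp
  have k3 : Tendsto (fun n : ℕ => ∫ z, u z * R n z) atTop (𝓝 0) := by
    refine squeeze_zero_norm' ?_
      (by simpa using tendsto_one_div_atTop_nhds_zero_nat.const_mul (2 * Real.pi * (B * C)))
    filter_upwards [eventually_gt_atTop 0] with n hn
    simpa using hint n hn
  have hRm (n : ℕ) (hn : 0 < n) : Integrable fun z => u z * R n z := by
    have hn' : (0 : ℝ) < n := by exact_mod_cast hn
    have hχ := contDiff_logCutoff p hn'
    have hd (v : ℂ) : Continuous (dirDeriv v (logCutoff p n)) :=
      (contDiff_iff_contDiffAt.2 fun z =>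
        contDiffAt_dirDeriv (m := 1) hχ.contDiffAt (by norm_num)).continuous
    refine integrable_bounded_mul hum hub ?_ ?_
    · exact (continuous_const.mul (((hd 1).mul (hcd 1)).add ((hd I).mul (hcd I)))).add
        ((continuous_flatLaplacian hχ).mul hψ.continuous)
    · exact ((((hcs 1).mul_left).add ((hcs I).mul_left)).mul_left).add hc.mul_left
  have k4 := k1.add k3
  rw [add_zero] at k4
  -- For each `n`, the assumed identity splits into the main term plus the integral of `u * R n`;
  -- both sides converge.
  refine tendsto_nhds_unique k4 (k2.congr' ?_)
  filter_upwards [eventually_gt_atTop 0] with n hn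
  have hn' : (0 : ℝ) < n := by exact_mod_cast hn
  have hχ := contDiff_logCutoff p hn'
  rw [← h n hn, ← integral_add _ (hRm n hn)]
  · refine integral_congr_ae (Eventually.of_forall fun z => ?_)
    simp only [flatLaplacian_mul hχ.contDiffAt hψ.contDiffAt, R]
    ring
  · refine integrable_bounded_mul hum hub ?_ hLc.mul_left
    exact hχ.continuous.mul (continuous_flatLaplacian hψ)

/-- Isolated singularities of bounded solutions of `Δ u = f` are removable. -/
theorem hasWeakLaplacian_of_bounded {D : Set ℂ} {u f : ℂ → ℂ} {B : ℝ}
    (hD : ∀ K : Set ℂ, IsCompact K → (K ∩ D).Finite) (hum : Measurable u) (hfm : Measurable f)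
    (hub : ∀ z, ‖u z‖ ≤ B) (hfb : ∀ z, ‖f z‖ ≤ B) (hu : ∀ z ∉ D, ContDiffAt ℝ 2 u z)
    (huf : ∀ z ∉ D, flatLaplacian u z = f z) : HasWeakLaplacian u f := by
  -- Only finitely many singularities lie in the support of a test function. By induction,
  -- multiplication with the cut-offs at `p` takes one point out of the support at a time.
  have main : ∀ (F : Finset ℂ) (ψ : ℂ → ℂ), ContDiff ℝ 2 ψ → HasCompactSupport ψ →
      tsupport ψ ∩ D ⊆ F → ∫ z, u z * flatLaplacian ψ z = ∫ z, f z * ψ z := by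
    intro F
    induction F using Finset.induction_on with
    | empty =>
      intro ψ hψ hc hF
      have hF' : ∀ z ∈ tsupport ψ, z ∉ D := fun z hz hzD => by simpa using hF ⟨hz, hzD⟩
      rw [integral_mul_flatLaplacian hψ hc fun z hz => hu z (hF' z hz)]
      refine integral_congr_ae (Eventually.of_forall fun z => ?_)
      by_cases hz : z ∈ tsupport ψ
      · simp only [huf z (hF' z hz)]
      · simp [image_eq_zero_of_notMem_tsupport hz]
    | insert p F hp ih =>
      intro ψ hψ hc hF
      refine integral_eq_of_logCutoff p hum hfm hub hfb hψ hc fun n hn => ?_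
      have hn' : (0 : ℝ) < n := by exact_mod_cast hn
      refine ih _ ((contDiff_logCutoff p hn').mul hψ) hc.mul_left ?_
      rintro z ⟨hz, hzD⟩
      have h1 := hF ⟨tsupport_mul_subset_right hz, hzD⟩
      rw [Finset.coe_insert] at h1
      refine h1.resolve_left fun hzp => ?_
      refine notMem_tsupport_iff_eventuallyEq.2 ?_ hz
      filter_upwards [Metric.ball_mem_nhds z (Real.exp_pos (-2 * n))] with w hw
      rw [hzp, Metric.mem_ball, dist_eq_norm] at hw
      simp [logCutoff_eq_zero hn' hw.le]
  intro ψ hψ hc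
  exact main (hD _ hc).toFinset ψ hψ hc (by simp)

/-! ### Weak second derivatives on the line -/

/-- A continuous function whose second derivative vanishes weakly is affine. -/
theorem eq_affine_of_weak {d : ℝ → ℂ} (hd : Continuous d)
    (h : ∀ φ : ℝ → ℂ, ContDiff ℝ 2 φ → HasCompactSupport φ → ∫ t, d t * deriv (deriv φ) t = 0)
    (t : ℝ) : d t = d 0 + t * (d 1 - d 0) := by
  let b : ℕ → ContDiffBump (0 : ℝ) := fun n =>
    ⟨1 / ((n : ℝ) + 1), 2 / ((n : ℝ) + 1), by positivity,
      div_lt_div_of_pos_right (by norm_num) (by positivity)⟩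
  have hr : Tendsto (fun n => (b n).rOut) atTop (𝓝 0) := by
    have := tendsto_one_div_add_atTop_nhds_zero_nat (𝕜 := ℝ).const_mul 2
    simpa [b, div_eq_mul_inv] using this
  let A : ℕ → ℝ → ℂ := fun n =>
    convolution ((b n).normed volume) d (ContinuousLinearMap.lsmul ℝ ℝ) volume
  have hA (s : ℝ) : Tendsto (fun n => A n s) atTop (𝓝 (d s)) :=
    ContDiffBump.convolution_tendsto_right_of_continuous hr hd s
  -- Mollification moves both derivatives onto the bump, whose reflected translates are test
  -- functions; so each mollification has vanishing second derivative. Affinity survives the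
  -- pointwise limit.
  have haff (n : ℕ) (s : ℝ) : A n s = A n 0 + s * (A n 1 - A n 0) := by
    set f : ℝ → ℝ := (b n).normed volume
    have hf : ContDiff ℝ 2 f := (b n).contDiff_normed (n := 2)
    have hfc : HasCompactSupport f := (b n).hasCompactSupport_normed
    have hf1 : ContDiff ℝ 1 (deriv f) := hf.iterate_deriv' 1 1
    have h1 (x : ℝ) := hfc.hasDerivAt_convolution_left (μ := volume)
      (ContinuousLinearMap.lsmul ℝ ℝ) (hf.of_le (by norm_num)) hd.locallyIntegrable x
    have h2 (x : ℝ) := hfc.deriv.hasDerivAt_convolution_left (μ := volume)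
      (ContinuousLinearMap.lsmul ℝ ℝ) hf1 hd.locallyIntegrable x
    have h3 (x : ℝ) : convolution (deriv (deriv f)) d (ContinuousLinearMap.lsmul ℝ ℝ) volume x
        = 0 := by
      rw [convolution_eq_swap]
      have hφ : ContDiff ℝ 2 (fun s : ℝ => (f (x - s) : ℂ)) :=
        ofRealCLM.contDiff.comp (hf.comp (contDiff_const.sub contDiff_id))
      have hφc : HasCompactSupport (fun s : ℝ => (f (x - s) : ℂ)) :=
        (hfc.comp_homeomorph (Homeomorph.subLeft x)).comp_left (g := ((↑) : ℝ → ℂ)) (by simp)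
      have key (g : ℝ → ℝ) (hg : Differentiable ℝ g) :
          deriv (fun s : ℝ => (g (x - s) : ℂ)) = fun s => -((deriv g (x - s) : ℝ) : ℂ) := by
        funext s
        have e1 : HasDerivAt (fun s : ℝ => x - s) (-1) s := by
          simpa using (hasDerivAt_id s).const_sub x
        have e2 := ((hg (x - s)).hasDerivAt.comp s e1).ofReal_comp
        simpa [Function.comp_def] using e2.deriv
      have e := h _ hφ hφc
      rw [key f (hf.differentiable (by norm_num))] at e
      simp only [deriv.fun_neg', key (deriv f) (hf1.differentiable (by norm_num)), neg_neg] at e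
      rw [← e]
      refine integral_congr_ae (Eventually.of_forall fun s => ?_)
      simp [mul_comm]
    have hc1 (x : ℝ) : convolution (deriv f) d (ContinuousLinearMap.lsmul ℝ ℝ) volume x =
        convolution (deriv f) d (ContinuousLinearMap.lsmul ℝ ℝ) volume 0 :=
      is_const_of_deriv_eq_zero (fun y => (h2 y).differentiableAt)
        (fun y => by rw [(h2 y).deriv, h3]) x 0
    set c := convolution (deriv f) d (ContinuousLinearMap.lsmul ℝ ℝ) volume 0
    have hc2 (x : ℝ) : A n x - x * c = A n 0 - (0 : ℝ) * c := by
      have hd' (y : ℝ) : HasDerivAt (fun x : ℝ => A n x - x * c) 0 y := by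
        have := (h1 y).sub ((hasDerivAt_id y).ofReal_comp.mul_const c)
        rw [hc1 y] at this
        exact this.congr_deriv (by simp)
      exact is_const_of_deriv_eq_zero (fun y => (hd' y).differentiableAt)
        (fun y => (hd' y).deriv) x 0
    have e1 := hc2 1
    have e2 := hc2 s
    push_cast at e1 e2
    linear_combination e2 - s * e1
  refine tendsto_nhds_unique (hA t) ?_
  exact ((hA 0).add (tendsto_const_nhds.mul ((hA 1).sub (hA 0)))).congr fun n => (haff n t).symm

theorem integral_mul_deriv_of_hasCompactSupport {w w' φ : ℝ → ℂ} (hw : ∀ t, HasDerivAt w (w' t) t)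
    (hw' : Continuous w') (hφ : ContDiff ℝ 1 φ) (hc : HasCompactSupport φ) :
    ∫ t, w t * deriv φ t = -∫ t, w' t * φ t := by
  have hwc : Continuous w := continuous_iff_continuousAt.2 fun t => (hw t).continuousAt
  have hφ' : Continuous (deriv φ) := hφ.continuous_deriv le_rfl
  exact integral_mul_deriv_eq_deriv_mul_of_integrable (fun t _ => hw t)
    (fun t _ => (hφ.differentiable (by norm_num) t).hasDerivAt)
    ((hwc.mul hφ').integrable_of_hasCompactSupport hc.deriv.mul_left)
    ((hw'.mul hφ.continuous).integrable_of_hasCompactSupport hc.mul_left)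
    ((hwc.mul hφ.continuous).integrable_of_hasCompactSupport hc.mul_left)

/-- A continuous function with continuous weak second derivative is twice differentiable. -/
theorem exists_hasDerivAt_of_weak {a q : ℝ → ℂ} (ha : Continuous a) (hq : Continuous q)
    (h : ∀ φ : ℝ → ℂ, ContDiff ℝ 2 φ → HasCompactSupport φ →
      ∫ t, a t * deriv (deriv φ) t = ∫ t, q t * φ t) :
    ∃ a' : ℝ → ℂ, ∀ t, HasDerivAt a (a' t) t ∧ HasDerivAt a' (q t) t := by
  let Q1 : ℝ → ℂ := fun t => ∫ s in (0 : ℝ)..t, q s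
  have hQ1 (t : ℝ) : HasDerivAt Q1 (q t) t := (hq.integral_hasStrictDerivAt 0 t).hasDerivAt
  have hQ1c : Continuous Q1 := continuous_iff_continuousAt.2 fun t => (hQ1 t).continuousAt
  let Q : ℝ → ℂ := fun t => ∫ s in (0 : ℝ)..t, Q1 s
  have hQ (t : ℝ) : HasDerivAt Q (Q1 t) t := (hQ1c.integral_hasStrictDerivAt 0 t).hasDerivAt
  have hQc : Continuous Q := continuous_iff_continuousAt.2 fun t => (hQ t).continuousAt
  -- Subtracting the iterated primitive `Q` of `q` leaves a function with vanishing weak second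
  -- derivative.
  have hd := eq_affine_of_weak (d := fun t => a t - Q t) (ha.sub hQc) (fun φ hφ hc => by
    have hφ1 : ContDiff ℝ 1 (deriv φ) := hφ.iterate_deriv' 1 1
    have hφ2 : Continuous (deriv (deriv φ)) := hφ1.continuous_deriv le_rfl
    have i1 : Integrable fun t => a t * deriv (deriv φ) t :=
      (ha.mul hφ2).integrable_of_hasCompactSupport hc.deriv.deriv.mul_left
    have i2 : Integrable fun t => Q t * deriv (deriv φ) t :=
      (hQc.mul hφ2).integrable_of_hasCompactSupport hc.deriv.deriv.mul_left
    simp only [sub_mul]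
    rw [integral_sub i1 i2, h φ hφ hc,
      integral_mul_deriv_of_hasCompactSupport hQ hQ1c hφ1 hc.deriv,
      integral_mul_deriv_of_hasCompactSupport hQ1 hq (hφ.of_le (by norm_num)) hc, neg_neg,
      sub_self])
  refine ⟨fun t => Q1 t + (a 1 - Q 1 - (a 0 - Q 0)), fun t => ⟨?_, (hQ1 t).add_const _⟩⟩
  have := (hQ t).add (((hasDerivAt_id t).ofReal_comp.mul_const
    (a 1 - Q 1 - (a 0 - Q 0))).const_add (a 0 - Q 0))
  refine (this.congr_of_eventuallyEq (Eventually.of_forall fun s => ?_)).congr_deriv (by simp)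
  simp only [Pi.add_apply, id]
  linear_combination hd s

/-! ### From the weak equation on the plane to Fourier coefficients -/

theorem integral_complex_eq_integral_integral {F : ℂ → ℂ} (hF : Integrable F) :
    ∫ z, F z = ∫ x : ℝ, ∫ y : ℝ, F (x + y * I) := by
  have h1 := Complex.volume_preserving_equiv_real_prod.symm
  have e (p : ℝ × ℝ) : Complex.measurableEquivRealProd.symm p = p.1 + p.2 * I :=
    Complex.equivRealProd_symm_apply p
  rw [← h1.integral_comp (MeasurableEquiv.measurableEmbedding _), Measure.volume_eq_prod,
    integral_prod]
  · simp only [e]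
  · rw [← Measure.volume_eq_prod]
    exact (h1.integrable_comp_emb (MeasurableEquiv.measurableEmbedding _)).2 hF

theorem dirDeriv_re_mul_im {a b : ℝ → ℂ} (ha : Differentiable ℝ a) (hb : Differentiable ℝ b)
    (v : ℂ) : dirDeriv v (fun z => a z.re * b z.im) =
      fun z => v.re * (deriv a z.re * b z.im) + v.im * (a z.re * deriv b z.im) := by
  funext z
  have h1 : HasFDerivAt (fun z : ℂ => a z.re)
      ((ContinuousLinearMap.toSpanSingleton ℝ (deriv a z.re)).comp reCLM) z :=
    (ha z.re).hasDerivAt.hasFDerivAt.comp z reCLM.hasFDerivAt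
  have h2 : HasFDerivAt (fun z : ℂ => b z.im)
      ((ContinuousLinearMap.toSpanSingleton ℝ (deriv b z.im)).comp imCLM) z :=
    (hb z.im).hasDerivAt.hasFDerivAt.comp z imCLM.hasFDerivAt
  unfold dirDeriv
  rw [HasFDerivAt.fderiv (f := fun z : ℂ => a z.re * b z.im) (h1.mul h2)]
  simp
  ring

theorem flatLaplacian_re_mul_im {a b : ℝ → ℂ} (ha : ContDiff ℝ 2 a) (hb : ContDiff ℝ 2 b) (z : ℂ) :
    flatLaplacian (fun z => a z.re * b z.im) z =
      deriv (deriv a) z.re * b z.im + a z.re * deriv (deriv b) z.im := by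
  have ha0 := ha.differentiable (by norm_num)
  have hb0 := hb.differentiable (by norm_num)
  have ha1 : Differentiable ℝ (deriv a) :=
    (ha.iterate_deriv' 1 1 : ContDiff ℝ 1 (deriv a)).differentiable (by norm_num)
  have hb1 : Differentiable ℝ (deriv b) :=
    (hb.iterate_deriv' 1 1 : ContDiff ℝ 1 (deriv b)).differentiable (by norm_num)
  simp only [flatLaplacian, dirDeriv_re_mul_im ha0 hb0, one_re, one_im, I_re, I_im, ofReal_one,
    ofReal_zero, one_mul, zero_mul, add_zero, zero_add, dirDeriv_re_mul_im ha1 hb0,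
    dirDeriv_re_mul_im ha0 hb1]

/-- Unfolding an integral over a period: `y ↦ G (y + 1) - G y` plays the role of a partition of
unity times the periodic function `P`. -/
theorem integral_mul_telescope {v G P : ℝ → ℂ} {B : ℝ} (hv : Measurable v)
    (hvb : ∀ y, ‖v y‖ ≤ B) (hvp : ∀ y, v (y + 1) = v y) (hG : Continuous G)
    (hP : ∀ y, P (y + 1) = P y) (h0 : ∀ y ≤ 0, G y = 0) (h1 : ∀ y, 1 ≤ y → G y = P y) :
    ∫ y, v y * (G (y + 1) - G y) = ∫ y in (0 : ℝ)..1, v y * P y := by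
  have hi (F : ℝ → ℂ) (hF : Continuous F) (a b : ℝ) :
      IntervalIntegrable (fun y => v y * F y) volume a b := by
    rw [intervalIntegrable_iff]
    exact ((hF.intervalIntegrable a b).def').bdd_mul hv.aestronglyMeasurable
      (Eventually.of_forall hvb)
  have hG1 : Continuous fun y => G (y + 1) := hG.comp (continuous_add_const 1)
  have hGd : Continuous fun y => G (y + 1) - G y := hG1.sub hG
  have e1 : ∫ y, v y * (G (y + 1) - G y) = ∫ y in (-1 : ℝ)..1, v y * (G (y + 1) - G y) := by
    rw [intervalIntegral.integral_of_le (by norm_num), setIntegral_eq_integral_of_forall_compl_eq_zero]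
    intro y hy
    rw [mem_Ioc, not_and_or, not_lt, not_le] at hy
    rcases hy with hy | hy
    · rw [h0 _ (by linarith), h0 _ (by linarith), sub_zero, mul_zero]
    · rw [h1 _ (by linarith), h1 _ (by linarith), hP, sub_self, mul_zero]
  -- On `[-1, 0]` the term `G y` vanishes; the shift by one period gives exactly the integral that
  -- is subtracted on `[0, 1]`.
  have e2 : ∫ y in (-1 : ℝ)..0, v y * (G (y + 1) - G y) = ∫ y in (0 : ℝ)..1, v y * G y := by
    have := intervalIntegral.integral_comp_add_right (a := -1) (b := 0) (fun y => v y * G y) 1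
    norm_num at this
    rw [← this]
    refine intervalIntegral.integral_congr fun y hy => ?_
    rw [uIcc_of_le (by norm_num)] at hy
    simp only [h0 y hy.2, sub_zero, hvp]
  have e3 : ∫ y in (0 : ℝ)..1, v y * (G (y + 1) - G y) =
      (∫ y in (0 : ℝ)..1, v y * P y) - ∫ y in (0 : ℝ)..1, v y * G y := by
    rw [eq_sub_iff_add_eq, ← intervalIntegral.integral_add (hi _ hGd 0 1) (hi _ hG 0 1)]
    refine intervalIntegral.integral_congr fun y hy => ?_
    rw [uIcc_of_le (by norm_num)] at hy
    simp only [h1 (y + 1) (by linarith [hy.1]), hP]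
    ring
  rw [e1, ← intervalIntegral.integral_add_adjacent_intervals (hi _ hGd (-1) 0)
    (hi _ hGd 0 1), e2, e3]
  ring

/-- The character `y ↦ exp (-i ω y)`. -/
def character (ω y : ℝ) : ℂ := cexp (-(ω * y * I))

/-- The Fourier coefficient, of frequency `ω`, of the restriction of `u` to the vertical circle
over `x`. -/
def circleCoeff (u : ℂ → ℂ) (ω x : ℝ) : ℂ := ∫ y in (0 : ℝ)..1, u (x + y * I) * character ω y

theorem contDiff_character (ω : ℝ) {n : WithTop ℕ∞} : ContDiff ℝ n (character ω) := by
  unfold character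
  have h : ContDiff ℝ n fun y : ℝ => (y : ℂ) := ofRealCLM.contDiff
  exact (((contDiff_const.mul h).mul contDiff_const).neg).cexp

theorem norm_character (ω y : ℝ) : ‖character ω y‖ = 1 := by
  rw [character, ← neg_mul, ← ofReal_mul, ← ofReal_neg, norm_exp_ofReal_mul_I]

theorem hasDerivAt_character (ω y : ℝ) :
    HasDerivAt (character ω) (-(ω * I) * character ω y) y := by
  have h : HasDerivAt (fun y : ℝ => -(ω * y * I : ℂ)) (-(ω * I)) y := by
    exact ((((hasDerivAt_id y).ofReal_comp.const_mul (ω : ℂ)).mul_const I).neg).congr_deriv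
      (by simp)
  have := h.cexp
  rw [mul_comm] at this
  exact this

theorem deriv_deriv_character (ω y : ℝ) :
    deriv (deriv (character ω)) y = -(ω : ℂ) ^ 2 * character ω y := by
  have h1 : deriv (character ω) = fun y => -(ω * I) * character ω y :=
    funext fun y => (hasDerivAt_character ω y).deriv
  rw [h1, ((hasDerivAt_character ω y).const_mul _).deriv]
  linear_combination (ω : ℂ) ^ 2 * character ω y * I_sq

theorem character_add_one (k : ℤ) (y : ℝ) :
    character (2 * Real.pi * k) (y + 1) = character (2 * Real.pi * k) y := by
  unfold character
  have : (-(((2 * Real.pi * k : ℝ) : ℂ) * ((y + 1 : ℝ) : ℂ) * I)) =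
      -(((2 * Real.pi * k : ℝ) : ℂ) * y * I) + ((-k : ℤ) : ℂ) * (2 * Real.pi * I) := by
    push_cast; ring
  rw [this, exp_add, exp_int_mul_two_pi_mul_I, mul_one]

theorem norm_circleCoeff_le {u : ℂ → ℂ} {B : ℝ} (hub : ∀ z, ‖u z‖ ≤ B) (ω x : ℝ) :
    ‖circleCoeff u ω x‖ ≤ B := by
  have := intervalIntegral.norm_integral_le_of_norm_le_const (a := 0) (b := 1) (C := B)
    (f := fun y : ℝ => u (x + y * I) * character ω y) (fun y _ => by
      rw [norm_mul, norm_character, mul_one]; exact hub _)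
  simpa [circleCoeff] using this

theorem measurable_vertical (x : ℝ) : Measurable fun y : ℝ => (x + y * I : ℂ) := by fun_prop

theorem intervalIntegrable_circle {u : ℂ → ℂ} {B : ℝ} (hum : Measurable u)
    (hub : ∀ z, ‖u z‖ ≤ B) (ω x a b : ℝ) :
    IntervalIntegrable (fun y : ℝ => u (x + y * I) * character ω y) volume a b := by
  rw [intervalIntegrable_iff]
  exact (((contDiff_character ω (n := 0)).continuous.intervalIntegrable a b).def').bdd_mul
    (hum.comp (measurable_vertical x)).aestronglyMeasurable (Eventually.of_forall fun _ => hub _)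

/-- A vertical circle meets the countable set `D` in a null set, so dominated convergence with the
constant bound applies even over circles through singularities. -/
theorem continuous_circleCoeff {D : Set ℂ} {u : ℂ → ℂ} {B : ℝ} (hD : D.Countable)
    (hum : Measurable u) (hub : ∀ z, ‖u z‖ ≤ B) (hu : ∀ z ∉ D, ContinuousAt u z) (ω : ℝ) :
    Continuous (circleCoeff u ω) := by
  rw [continuous_iff_continuousAt]
  intro x
  have hn : ∀ᵐ y : ℝ, (x + y * I : ℂ) ∉ D := by
    refine (hD.preimage_of_injOn (f := fun y : ℝ => (x + y * I : ℂ)) ?_).ae_notMem _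
    intro y _ y' _ h
    simpa using h
  refine intervalIntegral.continuousAt_of_dominated_interval (bound := fun _ => B) ?_ ?_
    intervalIntegrable_const ?_
  · exact Eventually.of_forall fun x => ((hum.comp (measurable_vertical x)).mul
      (contDiff_character ω (n := 0)).continuous.measurable).aestronglyMeasurable
  · refine Eventually.of_forall fun x => Eventually.of_forall fun y _ => ?_
    rw [norm_mul, norm_character, mul_one]
    exact hub _
  · filter_upwards [hn] with y hy _
    have h1 : ContinuousAt (fun x : ℝ => (x + y * I : ℂ)) x := by fun_prop
    exact (ContinuousAt.comp (f := fun x : ℝ => (x + y * I : ℂ)) (hu _ hy) h1).mul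
      continuousAt_const

/-- The equation for the Fourier coefficients of a weak solution of `Δ u = f` on the cylinder. -/
theorem integral_circleCoeff {u f : ℂ → ℂ} {B : ℝ} (hum : Measurable u) (hfm : Measurable f)
    (hub : ∀ z, ‖u z‖ ≤ B) (hfb : ∀ z, ‖f z‖ ≤ B) (hup : Function.Periodic u I)
    (hfp : Function.Periodic f I) (h : HasWeakLaplacian u f) (k : ℤ) {φ : ℝ → ℂ}
    (hφ : ContDiff ℝ 2 φ) (hφc : HasCompactSupport φ) :
    ∫ x, (circleCoeff u (2 * Real.pi * k) x * deriv (deriv φ) x -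
        ((2 * Real.pi * k : ℝ) : ℂ) ^ 2 * circleCoeff u (2 * Real.pi * k) x * φ x) =
      ∫ x, circleCoeff f (2 * Real.pi * k) x * φ x := by
  set ω : ℝ := 2 * Real.pi * k with hω
  -- `G` passes from 0 to the character within `[1/3, 2/3]`; the margins make `G` and the character
  -- (or 0) agree near the ends of `[0, 1]`, hence also their second derivatives.
  let G : ℝ → ℂ := fun y => (Real.smoothTransition (3 * y - 1) : ℝ) * character ω y
  have hG : ContDiff ℝ 2 G := by
    refine ContDiff.mul (ofRealCLM.contDiff.comp (Real.smoothTransition.contDiff (n := 2) |>.comp ?_))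
      (contDiff_character ω)
    exact (contDiff_const.mul contDiff_id).sub contDiff_const
  have hGz (y : ℝ) (hy : y < 1 / 3) : G y = 0 := by
    simp only [G]
    rw [Real.smoothTransition.zero_of_nonpos (by linarith), ofReal_zero, zero_mul]
  have hGo (y : ℝ) (hy : 2 / 3 < y) : G y = character ω y := by
    simp only [G]
    rw [Real.smoothTransition.one_of_one_le (by linarith), ofReal_one, one_mul]
  have hG1 : ContDiff ℝ 1 (deriv G) := hG.iterate_deriv' 1 1
  have hG2c : Continuous (deriv (deriv G)) := hG1.continuous_deriv le_rfl
  have hG2z (y : ℝ) (hy : y ≤ 0) : deriv (deriv G) y = 0 := by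
    have : G =ᶠ[𝓝 y] fun _ => 0 := by
      filter_upwards [Iio_mem_nhds (by linarith : y < 1 / 3)] with s hs using hGz s hs
    rw [this.deriv.deriv_eq]
    simp
  have hG2o (y : ℝ) (hy : 1 ≤ y) : deriv (deriv G) y = -(ω : ℂ) ^ 2 * character ω y := by
    have : G =ᶠ[𝓝 y] character ω := by
      filter_upwards [Ioi_mem_nhds (by linarith : 2 / 3 < y)] with s hs using hGo s hs
    rw [this.deriv.deriv_eq, deriv_deriv_character]
  -- A compactly supported replacement for the character: integrated against a 1-periodic function
  -- over the line, it gives the Fourier integral over one period.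
  let η : ℝ → ℂ := fun y => G (y + 1) - G y
  have hη : ContDiff ℝ 2 η := (hG.comp (contDiff_id.add contDiff_const)).sub hG
  have hη2 : deriv (deriv η) = fun y => deriv (deriv G) (y + 1) - deriv (deriv G) y := by
    have e (g : ℝ → ℂ) (hg : Differentiable ℝ g) :
        deriv (fun y => g (y + 1) - g y) = fun y => deriv g (y + 1) - deriv g y := by
      funext y
      have h1 : DifferentiableAt ℝ (fun y => g (y + 1)) y :=
        (hg _).comp y (differentiableAt_id.add_const 1)
      rw [deriv_fun_sub h1 (hg y), deriv_comp_add_const]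
    simp only [η]
    rw [e G (hG.differentiable (by norm_num)), e _ (hG1.differentiable (by norm_num))]
  have hη0 (y : ℝ) (hy : y ∉ Icc (-1 : ℝ) 1) : η y = 0 := by
    rw [mem_Icc, not_and_or, not_le, not_le] at hy
    simp only [η]
    rcases hy with hy | hy
    · rw [hGz _ (by linarith), hGz _ (by linarith), sub_zero]
    · rw [hGo _ (by linarith), hGo _ (by linarith), hω, character_add_one, sub_self]
  let ψ : ℂ → ℂ := fun z => φ z.re * η z.im
  have hψ : ContDiff ℝ 2 ψ :=
    (hφ.comp reCLM.contDiff).mul (hη.comp imCLM.contDiff)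
  have hψc : HasCompactSupport ψ := by
    refine HasCompactSupport.intro (IsCompact.reProdIm hφc (isCompact_Icc (a := -1) (b := 1)))
      fun z hz => ?_
    rw [mem_reProdIm, not_and_or] at hz
    rcases hz with hz | hz
    · simp [ψ, image_eq_zero_of_notMem_tsupport hz]
    · simp [ψ, hη0 _ hz]
  have per (w : ℂ → ℂ) (hw : Function.Periodic w I) (x y : ℝ) :
      w (x + ((y + 1 : ℝ) : ℂ) * I) = w (x + y * I) := by
    rw [← hw (x + y * I)]
    congr 1
    push_cast
    ring
  have hper (y : ℝ) : character ω (y + 1) = character ω y := by rw [hω, character_add_one]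
  have t1 (w : ℂ → ℂ) (hwm : Measurable w) (hwb : ∀ z, ‖w z‖ ≤ B) (hwp : Function.Periodic w I)
      (x : ℝ) : ∫ y : ℝ, w (x + y * I) * η y = circleCoeff w ω x :=
    integral_mul_telescope (hwm.comp (measurable_vertical x)) (fun _ => hwb _) (per w hwp x)
      hG.continuous hper (fun y hy => hGz y (by linarith)) (fun y hy => hGo y (by linarith))
  -- The second derivative of `η` is a difference of the same type, built from that of `G`, so it
  -- telescopes to the second derivative of the character.
  have t2 (x : ℝ) : ∫ y : ℝ, u (x + y * I) * deriv (deriv η) y =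
      -(ω : ℂ) ^ 2 * circleCoeff u ω x := by
    rw [hη2, circleCoeff, ← intervalIntegral.integral_const_mul]
    refine (integral_mul_telescope (P := fun y => -(ω : ℂ) ^ 2 * character ω y)
      (hum.comp (measurable_vertical x)) (fun _ => hub _) (per u hup x) hG2c
      (fun y => by rw [hper]) hG2z hG2o).trans ?_
    exact intervalIntegral.integral_congr fun y _ => mul_left_comm _ _ _
  have e := h ψ hψ hψc
  have hηc : HasCompactSupport η := HasCompactSupport.intro isCompact_Icc hη0
  have hη1 : ContDiff ℝ 1 (deriv η) := hη.iterate_deriv' 1 1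
  have hη2c : Continuous (deriv (deriv η)) := hη1.continuous_deriv le_rfl
  have hLc : HasCompactSupport (flatLaplacian ψ) :=
    hψc.of_isClosed_subset (isClosed_tsupport _) (tsupport_flatLaplacian_subset ψ)
  have hre (x y : ℝ) : ((x : ℂ) + y * I).re = x := by simp
  have him (x y : ℝ) : ((x : ℂ) + y * I).im = y := by simp
  rw [integral_complex_eq_integral_integral
      (integrable_bounded_mul hum hub (continuous_flatLaplacian hψ) hLc),
    integral_complex_eq_integral_integral
      (integrable_bounded_mul hfm hfb hψ.continuous hψc)] at e
  refine Eq.trans (integral_congr_ae (Eventually.of_forall fun x => ?_))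
    (e.trans (integral_congr_ae (Eventually.of_forall fun x => ?_)))
  · have i1 : Integrable fun y : ℝ => deriv (deriv φ) x * (u (x + y * I) * η y) :=
      ((hη.continuous.integrable_of_hasCompactSupport hηc).bdd_mul
        (hum.comp (measurable_vertical x)).aestronglyMeasurable
        (Eventually.of_forall fun _ => hub _)).const_mul _
    have i2 : Integrable fun y : ℝ => φ x * (u (x + y * I) * deriv (deriv η) y) :=
      ((hη2c.integrable_of_hasCompactSupport hηc.deriv.deriv).bdd_mul
        (hum.comp (measurable_vertical x)).aestronglyMeasurable
        (Eventually.of_forall fun _ => hub _)).const_mul _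
    have e3 (y : ℝ) : u (x + y * I) * flatLaplacian ψ (x + y * I) =
        deriv (deriv φ) x * (u (x + y * I) * η y) +
          φ x * (u (x + y * I) * deriv (deriv η) y) := by
      rw [flatLaplacian_re_mul_im hφ hη, hre, him]
      ring
    simp only [e3]
    rw [integral_add i1 i2, integral_const_mul, integral_const_mul, t1 u hum hub hup x, t2 x]
    ring
  · have e4 (y : ℝ) : f (x + y * I) * ψ (x + y * I) = φ x * (f (x + y * I) * η y) := by
      simp only [ψ, hre, him]
      ring
    simp only [e4]
    rw [integral_const_mul, t1 f hfm hfb hfp x, mul_comm]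

/-- The Fourier coefficients of a bounded solution of `Δ u = f` with isolated singularities solve
the expected ordinary differential equation. -/
theorem circleCoeff_ode {D : Set ℂ} {u f : ℂ → ℂ} {B : ℝ}
    (hD : ∀ K : Set ℂ, IsCompact K → (K ∩ D).Finite) (hum : Measurable u) (hfm : Measurable f)
    (hub : ∀ z, ‖u z‖ ≤ B) (hfb : ∀ z, ‖f z‖ ≤ B) (hu : ∀ z ∉ D, ContDiffAt ℝ 2 u z)
    (hf : ∀ z ∉ D, ContinuousAt f z) (huf : ∀ z ∉ D, flatLaplacian u z = f z)
    (hup : Function.Periodic u I) (hfp : Function.Periodic f I) (k : ℤ) :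
    Continuous (circleCoeff f (2 * Real.pi * k)) ∧ ∃ a' : ℝ → ℂ, ∀ t,
      HasDerivAt (circleCoeff u (2 * Real.pi * k)) (a' t) t ∧
      HasDerivAt a' (((2 * Real.pi * k : ℝ) : ℂ) ^ 2 * circleCoeff u (2 * Real.pi * k) t +
        circleCoeff f (2 * Real.pi * k) t) t := by
  have hDc : D.Countable := by
    have : D = ⋃ n : ℕ, Metric.closedBall (0 : ℂ) n ∩ D := by
      rw [← iUnion_inter, Metric.iUnion_closedBall_nat, univ_inter]
    rw [this]
    exact countable_iUnion fun n => (hD _ (isCompact_closedBall _ _)).countable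
  have hcu := continuous_circleCoeff hDc hum hub (fun z hz => (hu z hz).continuousAt)
    (2 * Real.pi * k)
  have hcf := continuous_circleCoeff hDc hfm hfb hf (2 * Real.pi * k)
  refine ⟨hcf, exists_hasDerivAt_of_weak hcu ((continuous_const.mul hcu).add hcf)
    fun φ hφ hc => ?_⟩
  have h := integral_circleCoeff hum hfm hub hfb hup hfp
    (hasWeakLaplacian_of_bounded hD hum hfm hub hfb hu huf) k hφ hc
  have hφ1 : ContDiff ℝ 1 (deriv φ) := hφ.iterate_deriv' 1 1
  have hφ2 : Continuous (deriv (deriv φ)) := hφ1.continuous_deriv le_rfl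
  have i1 : Integrable fun x => circleCoeff u (2 * Real.pi * k) x * deriv (deriv φ) x :=
    (hcu.mul hφ2).integrable_of_hasCompactSupport (μ := volume) hc.deriv.deriv.mul_left
  have i2 : Integrable fun x =>
      ((2 * Real.pi * k : ℝ) : ℂ) ^ 2 * circleCoeff u (2 * Real.pi * k) x * φ x := ((continuous_const (y := ((2 * Real.pi * k : ℝ) : ℂ) ^ 2)).mul hcu |>.mul
    hφ.continuous).integrable_of_hasCompactSupport (μ := volume) hc.mul_left
  have i3 : Integrable fun x => circleCoeff f (2 * Real.pi * k) x * φ x :=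
    (hcf.mul hφ.continuous).integrable_of_hasCompactSupport (μ := volume) hc.mul_left
  rw [integral_sub i1 i2, sub_eq_iff_eq_add] at h
  simp only [add_mul]
  rw [integral_add i2 i3, h, add_comm]

/-! ### The equation of a single mode -/

/-- `A'' = ω² A + F`, with `A'` the derivative of `A`. -/
def IsModeSolution (ω : ℝ) (A A' F : ℝ → ℂ) : Prop :=
  ∀ t, HasDerivAt A (A' t) t ∧ HasDerivAt A' ((ω : ℂ) ^ 2 * A t + F t) t

theorem IsModeSolution.abs {ω : ℝ} {A A' F : ℝ → ℂ} (h : IsModeSolution ω A A' F) :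
    IsModeSolution |ω| A A' F := by
  intro t
  rw [← ofReal_pow, sq_abs, ofReal_pow]
  exact h t

/-- The equation has no first-order term, so time reversal preserves it; this transfers estimates
for `t ≥ 0` to `t ≤ 0`. -/
theorem IsModeSolution.reflect {ω : ℝ} {A A' F : ℝ → ℂ} (h : IsModeSolution ω A A' F) :
    IsModeSolution ω (fun t => A (-t)) (fun t => -A' (-t)) (fun t => F (-t)) := by
  intro t
  have h1 := (h (-t)).1.scomp t (hasDerivAt_neg t)
  have h2 := ((h (-t)).2.scomp t (hasDerivAt_neg t)).neg
  exact ⟨h1.congr_deriv (by simp), h2.congr_deriv (by rw [neg_smul, one_smul, neg_neg])⟩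

/-- Duhamel's formula, for a fundamental system `C`, `S`. -/
theorem IsModeSolution.duhamel {ω : ℝ} {A A' F : ℝ → ℂ} (h : IsModeSolution ω A A' F)
    (hF : Continuous F) {S C : ℝ → ℝ} (hS : ∀ r, HasDerivAt S (C r) r)
    (hC : ∀ r, HasDerivAt C (ω ^ 2 * S r) r) (hS0 : S 0 = 0) (hC0 : C 0 = 1) (t R : ℝ) :
    A (t + R) = A' t * S R + A t * C R + ∫ r in (0 : ℝ)..R, F (t + r) * S (R - r) := by
  -- The homogeneous parts cancel in this derivative, because `S' = C` and `C' = ω² S`; only the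
  -- forcing term survives.
  have hd (r : ℝ) : HasDerivAt (fun r => A' (t + r) * (S (R - r) : ℂ) + A (t + r) * (C (R - r) : ℂ))
      (F (t + r) * S (R - r)) r := by
    have hsub : HasDerivAt (fun r : ℝ => R - r) (-1) r := by
      simpa using (hasDerivAt_id r).const_sub R
    have h1 : HasDerivAt (fun r => A (t + r)) (A' (t + r)) r := (h (t + r)).1.comp_const_add t r
    have h2 : HasDerivAt (fun r => A' (t + r)) ((ω : ℂ) ^ 2 * A (t + r) + F (t + r)) r :=
      (h (t + r)).2.comp_const_add t r
    have h3 : HasDerivAt (fun r => (S (R - r) : ℂ)) ((C (R - r) * -1 : ℝ) : ℂ) r :=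
      ((hS (R - r)).comp r hsub).ofReal_comp
    have h4 : HasDerivAt (fun r => (C (R - r) : ℂ)) ((ω ^ 2 * S (R - r) * -1 : ℝ) : ℂ) r :=
      ((hC (R - r)).comp r hsub).ofReal_comp
    refine ((h2.mul h3).add (h1.mul h4)).congr_deriv ?_
    push_cast
    ring
  have hSc : Continuous S := continuous_iff_continuousAt.2 fun r => (hS r).continuousAt
  have hcont : Continuous fun r => F (t + r) * (S (R - r) : ℂ) :=
    (hF.comp (continuous_const_add t)).mul
      (continuous_ofReal.comp (hSc.comp (continuous_const.sub continuous_id)))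
  rw [intervalIntegral.integral_eq_sub_of_hasDerivAt (fun r _ => hd r)
    (hcont.intervalIntegrable _ _)]
  simp only [sub_self, sub_zero, hS0, hC0, add_zero, ofReal_zero, ofReal_one]
  ring

/-- Write `sinh x = exp x * (1 - exp (-2 x)) / 2` and use `1 - exp (-2 x) ≤ 2 x`. -/
theorem sinh_le_mul_exp {x : ℝ} : Real.sinh x ≤ x * Real.exp x := by
  have h1 := Real.add_one_le_exp (-2 * x)
  have h2 : Real.exp (-2 * x) * Real.exp x = Real.exp (-x) := by
    rw [← Real.exp_add]; ring_nf
  rw [Real.sinh_eq, ← h2]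
  nlinarith [Real.exp_pos x]

/-- Existence of a fundamental system of `y'' = ω² y` with controlled growth. -/
theorem exists_fundamentalSystem {ω : ℝ} (hω : 0 ≤ ω) : ∃ S C : ℝ → ℝ,
    (∀ r, HasDerivAt S (C r) r) ∧ (∀ r, HasDerivAt C (ω ^ 2 * S r) r) ∧ S 0 = 0 ∧ C 0 = 1 ∧
    ∀ r, 0 ≤ r → 0 ≤ S r ∧ ∀ ω₁, 0 < ω₁ → ω ≤ ω₁ → S r ≤ 2 / ω₁ * Real.exp (ω₁ * r) := by
  -- The mode of frequency 0 has the fundamental system `r`, `1`; the others have `sinh (ω r) / ω`,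
  -- `cosh (ω r)`.
  rcases hω.eq_or_lt with rfl | hω
  · refine ⟨fun r => r, fun _ => 1, fun r => hasDerivAt_id r, fun r => ?_, rfl, rfl,
      fun r hr => ⟨hr, fun ω₁ h1 _ => ?_⟩⟩
    · simpa using hasDerivAt_const r (1 : ℝ)
    · have := Real.add_one_le_exp (ω₁ * r)
      have h2 : r = 1 / ω₁ * (ω₁ * r) := by field_simp
      calc r = 1 / ω₁ * (ω₁ * r) := h2
        _ ≤ 2 / ω₁ * Real.exp (ω₁ * r) := by
          refine mul_le_mul ?_ (by linarith) (by positivity) (by positivity)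
          exact div_le_div_of_nonneg_right (by norm_num) h1.le
  · have hm (r : ℝ) : HasDerivAt (fun r : ℝ => ω * r) ω r := by
      simpa using (hasDerivAt_id r).const_mul ω
    refine ⟨fun r => Real.sinh (ω * r) / ω, fun r => Real.cosh (ω * r), fun r => ?_, fun r => ?_,
      by simp, by simp, fun r hr => ⟨?_, fun ω₁ h1 hle => ?_⟩⟩
    · refine (((Real.hasDerivAt_sinh _).comp r (hm r)).div_const ω).congr_deriv ?_
      field_simp
    · refine ((Real.hasDerivAt_cosh _).comp r (hm r)).congr_deriv ?_
      field_simp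
    · exact div_nonneg (Real.sinh_nonneg_iff.2 (by positivity)) hω.le
    -- For `ω ≥ ω₁ / 2` the factor `1 / ω` is at most `2 / ω₁`. For smaller `ω` it may be huge, but
    -- then `S r ≤ r exp (ω₁ r / 2)`, and the factor `r` is absorbed by the unused half of the
    -- exponential.
    · rcases le_total (ω₁ / 2) ω with h | h
      · have h3 : Real.sinh (ω * r) ≤ Real.exp (ω₁ * r) := by
          have : Real.exp (ω * r) ≤ Real.exp (ω₁ * r) :=
            Real.exp_le_exp.2 (mul_le_mul_of_nonneg_right hle hr)
          rw [Real.sinh_eq]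
          linarith [Real.exp_pos (ω * r), Real.exp_pos (-(ω * r))]
        rw [div_mul_eq_mul_div]
        rw [div_le_div_iff₀ hω h1]
        nlinarith [Real.exp_pos (ω₁ * r)]
      · have h3 : Real.sinh (ω * r) / ω ≤ r * Real.exp (ω * r) := by
          rw [div_le_iff₀ hω]
          linarith [sinh_le_mul_exp (x := ω * r)]
        have h4 := Real.add_one_le_exp (ω₁ / 2 * r)
        have h5 : Real.exp (ω * r) ≤ Real.exp (ω₁ / 2 * r) :=
          Real.exp_le_exp.2 (mul_le_mul_of_nonneg_right h hr)
        have h6 : Real.exp (ω₁ * r) = Real.exp (ω₁ / 2 * r) * Real.exp (ω₁ / 2 * r) := by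
          rw [← Real.exp_add]; ring_nf
        calc _ ≤ r * Real.exp (ω * r) := h3
          _ ≤ r * Real.exp (ω₁ / 2 * r) := mul_le_mul_of_nonneg_left h5 hr
          _ = 2 / ω₁ * ((ω₁ / 2 * r) * Real.exp (ω₁ / 2 * r)) := by field_simp
          _ ≤ 2 / ω₁ * Real.exp (ω₁ * r) := by
            rw [h6]
            gcongr
            linarith

/-- Solutions with vanishing Cauchy data grow at most like the forcing term allows. -/
theorem IsModeSolution.norm_le_of_cauchyData {ω ω₁ : ℝ} {A A' F : ℝ → ℂ}
    (h : IsModeSolution ω A A' F) (hF : Continuous F) (h0 : A 0 = 0) (h0' : A' 0 = 0)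
    (h1 : 0 < ω₁) (hω : |ω| ≤ ω₁) {R : ℝ} (hR : 0 ≤ R) :
    ‖A R‖ ≤ ∫ r in (0 : ℝ)..R, 2 / ω₁ * Real.exp (ω₁ * (R - r)) * ‖F r‖ := by
  obtain ⟨S, C, hS, hC, hS0, hC0, hb⟩ := exists_fundamentalSystem (abs_nonneg ω)
  have e := h.abs.duhamel hF hS hC hS0 hC0 0 R
  simp only [h0, h0', zero_mul, zero_add] at e
  rw [e]
  refine intervalIntegral.norm_integral_le_of_norm_le hR ?_ (Continuous.intervalIntegrable ?_ _ _)
  · refine Eventually.of_forall fun r hr => ?_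
    obtain ⟨b1, b2⟩ := hb (R - r) (by linarith [hr.2])
    rw [norm_mul, norm_real, Real.norm_of_nonneg b1, mul_comm]
    exact mul_le_mul_of_nonneg_right (b2 ω₁ h1 hω) (norm_nonneg _)
  · fun_prop

/-- A priori estimate for bounded solutions. -/
theorem IsModeSolution.norm_le_of_bounded {ω ω₀ B : ℝ} {A A' F : ℝ → ℂ}
    (h : IsModeSolution ω A A' F) (hF : Continuous F) (hB : ∀ t, ‖A t‖ ≤ B)
    (h1 : 0 < ω₀) (hω : ω₀ ≤ |ω|) (t : ℝ) {R : ℝ} (hR : 0 ≤ R) :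
    ‖A t‖ ≤ 2 * B * Real.exp (-ω₀ * R) + ∫ r in (0 : ℝ)..R,
      1 / (2 * ω₀) * Real.exp (-ω₀ * r) * (‖F (t + r)‖ + ‖F (t - r)‖) := by
  have hw : 0 < |ω| := h1.trans_le hω
  have hm (r : ℝ) : HasDerivAt (fun r : ℝ => |ω| * r) |ω| r := by
    simpa using (hasDerivAt_id r).const_mul |ω|
  have hS (r : ℝ) : HasDerivAt (fun r => Real.sinh (|ω| * r) / |ω|) (Real.cosh (|ω| * r)) r := by
    refine (((Real.hasDerivAt_sinh _).comp r (hm r)).div_const |ω|).congr_deriv ?_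
    field_simp
  have hC (r : ℝ) : HasDerivAt (fun r => Real.cosh (|ω| * r))
      (|ω| ^ 2 * (Real.sinh (|ω| * r) / |ω|)) r := by
    refine ((Real.hasDerivAt_cosh _).comp r (hm r)).congr_deriv ?_
    field_simp
  have hFn : Continuous fun t => F (-t) := hF.comp continuous_neg
  have e1 := h.abs.duhamel hF hS hC (by simp) (by simp) t R
  have e2 := h.abs.reflect.duhamel hFn hS hC (by simp) (by simp) (-t) R
  simp only [neg_add_rev, neg_neg] at e2
  set K : ℝ → ℝ := fun r => Real.sinh (|ω| * (R - r)) / |ω| with hK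
  have hKc : Continuous K := by
    simp only [hK]
    exact (Real.continuous_sinh.comp (by fun_prop)).div_const _
  have i1 : IntervalIntegrable (fun r => F (t + r) * (K r : ℂ)) volume 0 R :=
    ((hF.comp (continuous_const_add t)).mul
      (continuous_ofReal.comp hKc)).intervalIntegrable _ _
  have i2 : IntervalIntegrable (fun r => F (-r + t) * (K r : ℂ)) volume 0 R :=
    ((hF.comp (continuous_neg.add continuous_const)).mul
      (continuous_ofReal.comp hKc)).intervalIntegrable _ _
  -- Adding Duhamel's formulas forwards and backwards from `t` eliminates `A' t`. Division by the
  -- hyperbolic cosine then damps the bounded boundary values `A (t ± R)`.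
  have e3 : (2 * Real.cosh (|ω| * R) : ℝ) * A t = A (t + R) + A (-R + t) -
      ∫ r in (0 : ℝ)..R, (F (t + r) * K r + F (-r + t) * K r) := by
    rw [intervalIntegral.integral_add i1 i2, e1, e2]
    simp only [hK]
    push_cast
    ring
  have hcosh : Real.exp (|ω| * R) ≤ 2 * Real.cosh (|ω| * R) := by
    rw [Real.cosh_eq]
    linarith [Real.exp_pos (-(|ω| * R))]
  have hb : ‖∫ r in (0 : ℝ)..R, (F (t + r) * K r + F (-r + t) * K r)‖ ≤
      ∫ r in (0 : ℝ)..R, Real.exp (|ω| * R) *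
        (1 / (2 * ω₀) * Real.exp (-ω₀ * r) * (‖F (t + r)‖ + ‖F (t - r)‖)) := by
    refine intervalIntegral.norm_integral_le_of_norm_le hR ?_
      (Continuous.intervalIntegrable (by fun_prop) _ _)
    refine Eventually.of_forall fun r hr => ?_
    have hr0 : 0 ≤ r := hr.1.le
    have hK0 : 0 ≤ K r :=
      div_nonneg (Real.sinh_nonneg_iff.2 (mul_nonneg hw.le (by linarith [hr.2]))) hw.le
    have hK1 : K r ≤ Real.exp (|ω| * R) * (1 / (2 * ω₀) * Real.exp (-ω₀ * r)) := by
      have h2 : Real.sinh (|ω| * (R - r)) ≤ Real.exp (|ω| * R) * Real.exp (-|ω| * r) / 2 := by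
        rw [← Real.exp_add, Real.sinh_eq, show |ω| * R + -|ω| * r = |ω| * (R - r) by ring]
        linarith [Real.exp_pos (-(|ω| * (R - r)))]
      have h3 : Real.exp (-|ω| * r) ≤ Real.exp (-ω₀ * r) := by
        refine Real.exp_le_exp.2 ?_
        nlinarith
      calc K r ≤ (Real.exp (|ω| * R) * Real.exp (-|ω| * r) / 2) / |ω| :=
            div_le_div_of_nonneg_right h2 hw.le
        _ ≤ (Real.exp (|ω| * R) * Real.exp (-ω₀ * r) / 2) / ω₀ := by gcongr
        _ = _ := by field_simp
    rw [← add_mul, norm_mul, norm_real, Real.norm_of_nonneg hK0, neg_add_eq_sub]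
    calc _ ≤ (‖F (t + r)‖ + ‖F (t - r)‖) *
          (Real.exp (|ω| * R) * (1 / (2 * ω₀) * Real.exp (-ω₀ * r))) :=
          mul_le_mul (norm_add_le _ _) hK1 hK0 (by positivity)
      _ = _ := by ring
  rw [intervalIntegral.integral_const_mul] at hb
  set J := ∫ r in (0 : ℝ)..R, 1 / (2 * ω₀) * Real.exp (-ω₀ * r) * (‖F (t + r)‖ + ‖F (t - r)‖)
  have hn : Real.exp (|ω| * R) * ‖A t‖ ≤ 2 * B + Real.exp (|ω| * R) * J := by
    calc Real.exp (|ω| * R) * ‖A t‖ ≤ (2 * Real.cosh (|ω| * R)) * ‖A t‖ :=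
          mul_le_mul_of_nonneg_right hcosh (norm_nonneg _)
      _ = ‖((2 * Real.cosh (|ω| * R) : ℝ) : ℂ) * A t‖ := by
          rw [norm_mul, norm_real, Real.norm_of_nonneg (by positivity)]
      _ ≤ (B + B) + Real.exp (|ω| * R) * J := by
          rw [e3]
          exact (norm_sub_le _ _).trans
            (add_le_add ((norm_add_le _ _).trans (add_le_add (hB _) (hB _))) hb)
      _ = _ := by ring
  have hB0 : 0 ≤ B := (norm_nonneg _).trans (hB 0)
  have he : Real.exp (-|ω| * R) * Real.exp (|ω| * R) = 1 := by rw [← Real.exp_add]; simp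
  calc ‖A t‖ = Real.exp (-|ω| * R) * (Real.exp (|ω| * R) * ‖A t‖) := by
        rw [← mul_assoc, he, one_mul]
    _ ≤ Real.exp (-|ω| * R) * (2 * B + Real.exp (|ω| * R) * J) :=
        mul_le_mul_of_nonneg_left hn (Real.exp_pos _).le
    _ = 2 * B * Real.exp (-|ω| * R) + J := by linear_combination J * he
    _ ≤ _ := by
        gcongr

theorem integral_exp_const_mul {c : ℝ} (hc : c ≠ 0) (R : ℝ) :
    ∫ r in (0 : ℝ)..R, Real.exp (c * r) = (Real.exp (c * R) - 1) / c := by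
  have hd (r : ℝ) : HasDerivAt (fun r => Real.exp (c * r) / c) (Real.exp (c * r)) r := by
    have hm : HasDerivAt (fun r : ℝ => c * r) c r := by
      simpa using (hasDerivAt_id r).const_mul c
    refine (hm.exp.div_const c).congr_deriv ?_
    field_simp
  rw [intervalIntegral.integral_eq_sub_of_hasDerivAt (fun r _ => hd r)
    (Continuous.intervalIntegrable (by fun_prop) _ _)]
  simp
  ring

/-! ### Weighted growth estimates for low and high modes -/

/-- The growth estimate for finitely many low modes with vanishing Cauchy data. -/
theorem sum_lowModes_le {J : Finset ℤ} {c ω : ℤ → ℝ} {A A' F : ℤ → ℝ → ℂ} {ω₁ μ δ G : ℝ}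
    (hc : ∀ k, 0 ≤ c k) (hF : ∀ k ∈ J, Continuous (F k))
    (h : ∀ k ∈ J, IsModeSolution (ω k) (A k) (A' k) (F k)) (h0 : ∀ k ∈ J, A k 0 = 0)
    (h0' : ∀ k ∈ J, A' k 0 = 0) (h1 : 0 < ω₁) (hω : ∀ k ∈ J, |ω k| ≤ ω₁) (hδ : 0 < δ)
    (hμ : μ = ω₁ + δ) (hG : ∀ s, ∑ k ∈ J, c k * ‖F k s‖ ≤ G * Real.exp (μ * |s|)) (t : ℝ) :
    ∑ k ∈ J, c k * ‖A k t‖ ≤ 2 * G / (ω₁ * δ) * Real.exp (μ * |t|) := by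
  wlog ht : 0 ≤ t generalizing A A' F t
  · have := this (A := fun k t => A k (-t)) (A' := fun k t => -A' k (-t))
      (F := fun k t => F k (-t)) (fun k hk => (hF k hk).comp continuous_neg)
      (fun k hk => (h k hk).reflect) (fun k hk => by simpa using h0 k hk)
      (fun k hk => by simpa using h0' k hk) (fun s => by simpa using hG (-s)) (-t) (by linarith)
    simpa using this
  have hG0 : 0 ≤ G := by
    have := hG 0
    simp only [abs_zero, mul_zero, Real.exp_zero, mul_one] at this
    exact (Finset.sum_nonneg fun k _ => mul_nonneg (hc k) (norm_nonneg _)).trans this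
  have hint (k : ℤ) (hk : k ∈ J) : IntervalIntegrable
      (fun r => c k * (2 / ω₁ * Real.exp (ω₁ * (t - r)) * ‖F k r‖)) volume 0 t := by
    have := hF k hk
    exact Continuous.intervalIntegrable (by fun_prop) _ _
  calc ∑ k ∈ J, c k * ‖A k t‖
      ≤ ∑ k ∈ J, c k * ∫ r in (0 : ℝ)..t, 2 / ω₁ * Real.exp (ω₁ * (t - r)) * ‖F k r‖ :=
        Finset.sum_le_sum fun k hk => mul_le_mul_of_nonneg_left
          ((h k hk).norm_le_of_cauchyData (hF k hk) (h0 k hk) (h0' k hk) h1 (hω k hk) ht) (hc k)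
    _ = ∫ r in (0 : ℝ)..t, ∑ k ∈ J, c k * (2 / ω₁ * Real.exp (ω₁ * (t - r)) * ‖F k r‖) := by
        rw [intervalIntegral.integral_finsetSum hint]
        simp only [intervalIntegral.integral_const_mul]
    -- As `μ = ω₁ + δ`, the product of `exp (ω₁ (t - r))` and `exp (μ r)` is `exp (ω₁ t) exp (δ r)`,
    -- and integration produces the factor `1 / δ`.
    _ ≤ ∫ r in (0 : ℝ)..t, 2 * G / ω₁ * Real.exp (ω₁ * t) * Real.exp (δ * r) := by
        refine intervalIntegral.integral_mono_on ht ?_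
          (Continuous.intervalIntegrable (by fun_prop) _ _) fun r hr => ?_
        · have : Continuous fun r => ∑ k ∈ J, c k * (2 / ω₁ * Real.exp (ω₁ * (t - r)) * ‖F k r‖) :=
            continuous_finsetSum _ fun k hk => by
              have := hF k hk
              fun_prop
          exact this.intervalIntegrable _ _
        · have e : ∑ k ∈ J, c k * (2 / ω₁ * Real.exp (ω₁ * (t - r)) * ‖F k r‖) =
              2 / ω₁ * Real.exp (ω₁ * (t - r)) * ∑ k ∈ J, c k * ‖F k r‖ := by
            rw [Finset.mul_sum]
            exact Finset.sum_congr rfl fun k _ => by ring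
          have hs := hG r
          rw [abs_of_nonneg hr.1] at hs
          rw [e]
          calc _ ≤ 2 / ω₁ * Real.exp (ω₁ * (t - r)) * (G * Real.exp (μ * r)) :=
                mul_le_mul_of_nonneg_left hs (by positivity)
            _ = 2 * G / ω₁ * (Real.exp (ω₁ * (t - r)) * Real.exp (μ * r)) := by ring
            _ = _ := by rw [← Real.exp_add, mul_assoc, ← Real.exp_add, hμ]; ring_nf
    _ = 2 * G / ω₁ * Real.exp (ω₁ * t) * ((Real.exp (δ * t) - 1) / δ) := by
        rw [intervalIntegral.integral_const_mul, integral_exp_const_mul hδ.ne']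
    _ ≤ 2 * G / ω₁ * Real.exp (ω₁ * t) * (Real.exp (δ * t) / δ) := by
        gcongr
        linarith
    _ = _ := by
        rw [abs_of_nonneg ht, hμ, add_mul, Real.exp_add]
        field_simp

/-- The growth estimate for finitely many high modes of bounded solutions. -/
theorem sum_highModes_le {J : Finset ℤ} {c ω : ℤ → ℝ} {A A' F : ℤ → ℝ → ℂ} {ω₀ μ δ G B : ℝ}
    (hc : ∀ k, 0 ≤ c k) (hF : ∀ k ∈ J, Continuous (F k))
    (h : ∀ k ∈ J, IsModeSolution (ω k) (A k) (A' k) (F k)) (hB : ∀ k t, ‖A k t‖ ≤ B)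
    (h1 : 0 < ω₀) (hω : ∀ k ∈ J, ω₀ ≤ |ω k|) (hδ : 0 < δ) (hμ0 : 0 ≤ μ)
    (hμ : ω₀ = μ + δ) (hG : ∀ s, ∑ k ∈ J, c k * ‖F k s‖ ≤ G * Real.exp (μ * |s|)) (t : ℝ) :
    ∑ k ∈ J, c k * ‖A k t‖ ≤ G / (ω₀ * δ) * Real.exp (μ * |t|) := by
  have hG0 : 0 ≤ G := by
    have := hG 0
    simp only [abs_zero, mul_zero, Real.exp_zero, mul_one] at this
    exact (Finset.sum_nonneg fun k _ => mul_nonneg (hc k) (norm_nonneg _)).trans this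
  -- The a priori estimate on windows of radius `R` around `t`; its boundary term disappears as `R →
  -- ∞`, the sum over `J` being finite.
  have hR (R : ℝ) (hR : 0 ≤ R) : ∑ k ∈ J, c k * ‖A k t‖ ≤
      (∑ k ∈ J, c k) * (2 * B) * Real.exp (-(ω₀ * R)) +
        G / (ω₀ * δ) * Real.exp (μ * |t|) := by
    have hint (k : ℤ) (hk : k ∈ J) : IntervalIntegrable (fun r => c k *
        (1 / (2 * ω₀) * Real.exp (-ω₀ * r) * (‖F k (t + r)‖ + ‖F k (t - r)‖))) volume 0 R := by
      have := hF k hk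
      exact Continuous.intervalIntegrable (by fun_prop) _ _
    calc ∑ k ∈ J, c k * ‖A k t‖
        ≤ ∑ k ∈ J, c k * (2 * B * Real.exp (-ω₀ * R) + ∫ r in (0 : ℝ)..R,
            1 / (2 * ω₀) * Real.exp (-ω₀ * r) * (‖F k (t + r)‖ + ‖F k (t - r)‖)) :=
          Finset.sum_le_sum fun k hk => mul_le_mul_of_nonneg_left
            ((h k hk).norm_le_of_bounded (hF k hk) (hB k) h1 (hω k hk) t hR) (hc k)
      _ = (∑ k ∈ J, c k) * (2 * B) * Real.exp (-(ω₀ * R)) + ∫ r in (0 : ℝ)..R, ∑ k ∈ J, c k *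
            (1 / (2 * ω₀) * Real.exp (-ω₀ * r) * (‖F k (t + r)‖ + ‖F k (t - r)‖)) := by
          rw [intervalIntegral.integral_finsetSum hint]
          rw [Finset.sum_mul, Finset.sum_mul, ← Finset.sum_add_distrib]
          refine Finset.sum_congr rfl fun k _ => ?_
          rw [intervalIntegral.integral_const_mul, mul_add, neg_mul, mul_assoc (c k)]
      -- The kernel decays at rate `ω₀ = μ + δ` while the forcing grows at rate at most `μ`; the
      -- surplus `exp (-δ r)` is integrable.
      _ ≤ (∑ k ∈ J, c k) * (2 * B) * Real.exp (-(ω₀ * R)) + ∫ r in (0 : ℝ)..R,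
            G / ω₀ * Real.exp (μ * |t|) * Real.exp (-δ * r) := by
          gcongr
          refine intervalIntegral.integral_mono_on hR ?_
            (Continuous.intervalIntegrable (by fun_prop) _ _) fun r hr => ?_
          · have : Continuous fun r => ∑ k ∈ J, c k *
                (1 / (2 * ω₀) * Real.exp (-ω₀ * r) * (‖F k (t + r)‖ + ‖F k (t - r)‖)) :=
              continuous_finsetSum _ fun k hk => by
                have := hF k hk
                fun_prop
            exact this.intervalIntegrable _ _
          · have e : ∑ k ∈ J, c k *
                (1 / (2 * ω₀) * Real.exp (-ω₀ * r) * (‖F k (t + r)‖ + ‖F k (t - r)‖)) =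
                1 / (2 * ω₀) * Real.exp (-ω₀ * r) *
                  (∑ k ∈ J, c k * ‖F k (t + r)‖ + ∑ k ∈ J, c k * ‖F k (t - r)‖) := by
              rw [← Finset.sum_add_distrib, Finset.mul_sum]
              exact Finset.sum_congr rfl fun k _ => by ring
            have hs (s : ℝ) (hs : |s| ≤ |t| + r) :
                ∑ k ∈ J, c k * ‖F k s‖ ≤ G * Real.exp (μ * (|t| + r)) :=
              (hG s).trans (mul_le_mul_of_nonneg_left
                (Real.exp_le_exp.2 (mul_le_mul_of_nonneg_left hs hμ0)) hG0)
            have hs1 := hs (t + r) ((abs_add_le t r).trans_eq (by rw [abs_of_nonneg hr.1]))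
            have hs2 := hs (t - r) ((abs_sub t r).trans_eq (by rw [abs_of_nonneg hr.1]))
            rw [e]
            calc _ ≤ 1 / (2 * ω₀) * Real.exp (-ω₀ * r) *
                  (G * Real.exp (μ * (|t| + r)) + G * Real.exp (μ * (|t| + r))) :=
                  mul_le_mul_of_nonneg_left (add_le_add hs1 hs2) (by positivity)
              _ = G / ω₀ * (Real.exp (-ω₀ * r) * Real.exp (μ * (|t| + r))) := by
                  field_simp
                  ring
              _ = _ := by rw [← Real.exp_add, mul_assoc, ← Real.exp_add, hμ]; ring_nf
      _ = (∑ k ∈ J, c k) * (2 * B) * Real.exp (-(ω₀ * R)) +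
            G / ω₀ * Real.exp (μ * |t|) * ((1 - Real.exp (-δ * R)) / δ) := by
          rw [intervalIntegral.integral_const_mul, integral_exp_const_mul (by linarith)]
          congr 2
          rw [div_neg, ← neg_div, neg_sub]
      _ ≤ (∑ k ∈ J, c k) * (2 * B) * Real.exp (-(ω₀ * R)) +
            G / ω₀ * Real.exp (μ * |t|) * (1 / δ) := by
          gcongr
          linarith [Real.exp_pos (-δ * R)]
      _ = _ := by
          congr 1
          field_simp
  have hlim : Tendsto (fun R : ℝ => (∑ k ∈ J, c k) * (2 * B) * Real.exp (-(ω₀ * R)) +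
        G / (ω₀ * δ) * Real.exp (μ * |t|)) atTop
      (𝓝 ((∑ k ∈ J, c k) * (2 * B) * 0 + G / (ω₀ * δ) * Real.exp (μ * |t|))) := by
    refine (tendsto_const_nhds.mul ?_).add tendsto_const_nhds
    exact Real.tendsto_exp_neg_atTop_nhds_zero.comp (tendsto_id.const_mul_atTop h1)
  rw [mul_zero, zero_add] at hlim
  exact ge_of_tendsto hlim (by filter_upwards [eventually_ge_atTop 0] with R h using hR R h)

/-- The gaps between the frequencies force a bounded solution to vanish as soon as sufficiently
many modes have vanishing Cauchy data. -/
theorem eq_zero_of_lowModes {A A' F : ℤ → ℝ → ℂ} {U : ℝ → ℝ} {B M : ℝ} {N : ℕ} (hN : 0 < N)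
    (hM : 0 ≤ M) (hMN : M ≤ N)
    (h : ∀ k : ℤ, IsModeSolution (2 * Real.pi * k) (A k) (A' k) (F k))
    (hF : ∀ k, Continuous (F k)) (hB : ∀ k t, ‖A k t‖ ≤ B)
    (h0 : ∀ k : ℤ, |k| ≤ N → A k 0 = 0 ∧ A' k 0 = 0)
    (hU : ∀ t, HasSum (fun k => ‖A k t‖ ^ 2) (U t))
    (hFU : ∀ (J : Finset ℤ) t, ∑ k ∈ J, ‖F k t‖ ^ 2 ≤ M ^ 2 * U t)
    (hUB : ∀ t, U t ≤ B ^ 2) (t : ℝ) : U t = 0 := by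
  have hB0 : 0 ≤ B := (norm_nonneg _).trans (hB 0 0)
  have hN' : (1 : ℝ) ≤ N := by exact_mod_cast hN
  have hpi := Real.pi_pos
  have hpi3 := Real.pi_gt_three
  -- `ω₁ = 2πN` is the largest low frequency, `ω₀ = 2π(N + 1)` the smallest high one, and `μ` is the
  -- midpoint of the gap, at distance `π` from both.
  set ω₁ : ℝ := 2 * Real.pi * N with hω₁
  set μ : ℝ := ω₁ + Real.pi with hμ
  set ω₀ : ℝ := μ + Real.pi with hω₀
  have hω₁p : 0 < ω₁ := by positivity
  -- The contraction: a growth bound for the `L²` norm on circles improves by the factor 2.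
  have step (Y : ℝ) (hY : 0 ≤ Y) (hYU : ∀ s, U s ≤ (Y * Real.exp (μ * |s|)) ^ 2) (s : ℝ) :
      U s ≤ (Y / 2 * Real.exp (μ * |s|)) ^ 2 := by
    refine hasSum_le_of_sum_le (hU s) fun J => ?_
    set S : ℝ := ∑ k ∈ J, ‖A k s‖ ^ 2 with hS
    have hS0 : 0 ≤ S := Finset.sum_nonneg fun k _ => by positivity
    -- An `ℓ²` estimate by duality: the weights are the values `‖A k s‖` at the frozen time `s`, and
    -- Cauchy-Schwarz turns the `ℓ²` bound on the forcing into a weighted `ℓ¹` bound at every time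
    -- `r`.
    have hsub (J' : Finset ℤ) (hJ' : J' ⊆ J) (r : ℝ) :
        ∑ k ∈ J', ‖A k s‖ * ‖F k r‖ ≤ (√S * M * Y) * Real.exp (μ * |r|) := by
      have h1 : ∑ k ∈ J', ‖A k s‖ ^ 2 ≤ S :=
        Finset.sum_le_sum_of_subset_of_nonneg hJ' fun k _ _ => by positivity
      have h2 : ∑ k ∈ J', ‖F k r‖ ^ 2 ≤ (M * (Y * Real.exp (μ * |r|))) ^ 2 := by
        rw [mul_pow]
        exact (hFU J' r).trans (mul_le_mul_of_nonneg_left (hYU r) (by positivity))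
      calc _ ≤ √(∑ k ∈ J', ‖A k s‖ ^ 2) * √(∑ k ∈ J', ‖F k r‖ ^ 2) :=
            Real.sum_mul_le_sqrt_mul_sqrt _ _ _
        _ ≤ √S * (M * (Y * Real.exp (μ * |r|))) := by
            refine mul_le_mul (Real.sqrt_le_sqrt h1) ?_ (Real.sqrt_nonneg _) (Real.sqrt_nonneg _)
            exact Real.sqrt_le_iff.2 ⟨by positivity, h2⟩
        _ = _ := by ring
    have hlow := sum_lowModes_le (J := J.filter fun k : ℤ => |k| ≤ N) (c := fun k => ‖A k s‖)
      (ω := fun k => 2 * Real.pi * k) (μ := μ) (fun k => norm_nonneg _) (fun k _ => hF k)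
      (fun k _ => h k) (fun k hk => (h0 k (Finset.mem_filter.1 hk).2).1)
      (fun k hk => (h0 k (Finset.mem_filter.1 hk).2).2) hω₁p (fun k hk => by
        rw [abs_mul, abs_of_pos (by positivity : 0 < 2 * Real.pi), hω₁]
        have := (Finset.mem_filter.1 hk).2
        gcongr
        exact_mod_cast this) hpi hμ (hsub _ (Finset.filter_subset _ _)) s
    have hhigh := sum_highModes_le (J := J.filter fun k : ℤ => ¬ |k| ≤ N) (c := fun k => ‖A k s‖)
      (ω := fun k => 2 * Real.pi * k) (μ := μ) (ω₀ := ω₀) (fun k => norm_nonneg _)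
      (fun k _ => hF k) (fun k _ => h k) hB (by positivity) (fun k hk => by
        rw [abs_mul, abs_of_pos (by positivity : 0 < 2 * Real.pi), hω₀, hμ, hω₁]
        have h2 := (Finset.mem_filter.1 hk).2
        have h3 : (N : ℤ) + 1 ≤ |k| := by omega
        have h4 : (N : ℝ) + 1 ≤ |(k : ℝ)| := by exact_mod_cast h3
        nlinarith) hpi (by positivity) hω₀ (hsub _ (Finset.filter_subset _ _)) s
    set E := Real.exp (μ * |s|)
    have hE : 0 < E := Real.exp_pos _
    -- The low modes contribute the constant `2 M / (2π² N)`, the high modes at most half of that.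
    -- The total `3 M / (2π² N)` is at most `1/2`, since `M ≤ N` and `3 ≤ π²`.
    have hsum : S ≤ √S * (Y / 2 * E) := by
      have e : S = ∑ k ∈ J.filter (fun k : ℤ => |k| ≤ N), ‖A k s‖ * ‖A k s‖ +
          ∑ k ∈ J.filter (fun k : ℤ => ¬ |k| ≤ N), ‖A k s‖ * ‖A k s‖ := by
        rw [Finset.sum_filter_add_sum_filter_not, hS]
        simp only [sq]
      have hG0 : 0 ≤ √S * M * Y := by positivity
      have h5 : √S * M * Y / (ω₀ * Real.pi) ≤ √S * M * Y / (ω₁ * Real.pi) := by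
        refine div_le_div_of_nonneg_left hG0 (by positivity) ?_
        exact mul_le_mul_of_nonneg_right (by linarith) hpi.le
      have h6 : 3 * (√S * M * Y) / (ω₁ * Real.pi) ≤ √S * (Y / 2) := by
        rw [div_le_iff₀ (by positivity)]
        have h7 : 3 * M ≤ Real.pi * Real.pi * N := by nlinarith
        calc 3 * (√S * M * Y) = √S * Y * (3 * M) := by ring
          _ ≤ √S * Y * (Real.pi * Real.pi * N) := mul_le_mul_of_nonneg_left h7 (by positivity)
          _ = _ := by rw [hω₁]; ring
      calc S ≤ 2 * (√S * M * Y) / (ω₁ * Real.pi) * E + √S * M * Y / (ω₀ * Real.pi) * E :=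
            e.le.trans (add_le_add hlow hhigh)
        _ ≤ 2 * (√S * M * Y) / (ω₁ * Real.pi) * E + √S * M * Y / (ω₁ * Real.pi) * E := by
            gcongr
        _ = 3 * (√S * M * Y) / (ω₁ * Real.pi) * E := by ring
        _ ≤ √S * (Y / 2) * E := mul_le_mul_of_nonneg_right h6 hE.le
        _ = _ := by ring
    have hsq := Real.mul_self_sqrt hS0
    have hle : √S ≤ Y / 2 * E := by
      rcases (Real.sqrt_nonneg S).eq_or_lt with h8 | h8
      · rw [← h8]; positivity
      · refine le_of_mul_le_mul_left ?_ h8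
        rwa [hsq]
    calc S = √S ^ 2 := (Real.sq_sqrt hS0).symm
      _ ≤ _ := pow_le_pow_left₀ (Real.sqrt_nonneg _) hle 2
  -- The iteration starts with the uniform bound `B`, which is weaker than any decay or growth
  -- condition with positive `μ`.
  have iter (n : ℕ) : ∀ s, U s ≤ (B * (1 / 2) ^ n * Real.exp (μ * |s|)) ^ 2 := by
    induction n with
    | zero =>
      intro s
      refine (hUB s).trans (pow_le_pow_left₀ hB0 ?_ 2)
      rw [pow_zero, mul_one]
      exact le_mul_of_one_le_right hB0 (Real.one_le_exp (by positivity))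
    | succ n ih =>
      intro s
      refine (step _ (by positivity) ih s).trans_eq ?_
      rw [pow_succ]
      ring
  refine le_antisymm ?_ ((hU t).nonneg fun k => by positivity)
  have hlim : Tendsto (fun n : ℕ => (B * (1 / 2) ^ n * Real.exp (μ * |t|)) ^ 2) atTop (𝓝 0) := by
    have h9 := tendsto_pow_atTop_nhds_zero_of_lt_one (r := (1 / 2 : ℝ)) (by norm_num) (by norm_num)
    simpa using ((h9.const_mul B).mul_const (Real.exp (μ * |t|))).pow 2
  exact ge_of_tendsto hlim (Eventually.of_forall fun n => iter n t)

/-! ### Parseval's identity and unique continuation -/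

theorem fourierCoeffOn_vertical (u : ℂ → ℂ) (k : ℤ) (x : ℝ) :
    fourierCoeffOn (zero_lt_one' ℝ) (fun y : ℝ => u (x + y * I)) k =
      circleCoeff u (2 * Real.pi * k) x := by
  rw [fourierCoeffOn_eq_integral, circleCoeff]
  simp only [sub_zero, div_one, one_smul]
  refine intervalIntegral.integral_congr fun y _ => ?_
  have : (fourier (-k) ((y : ℝ) : AddCircle (1 - 0 : ℝ)) : ℂ) = character (2 * Real.pi * k) y := by
    rw [fourier_coe_apply, character]
    congr 1
    push_cast
    ring
  simp only [smul_eq_mul]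
  rw [mul_comm, ← this]

/-- Parseval's identity on a circle of length 1; it carries the pointwise inequality between `f` and
`u` over to the modes. -/
theorem hasSum_sq_circleCoeff {u : ℂ → ℂ} {B : ℝ} (hum : Measurable u) (hub : ∀ z, ‖u z‖ ≤ B)
    (x : ℝ) : HasSum (fun k : ℤ => ‖circleCoeff u (2 * Real.pi * k) x‖ ^ 2)
      (∫ y in (0 : ℝ)..1, ‖u (x + y * I)‖ ^ 2) := by
  have h := hasSum_sq_fourierCoeffOn (f := fun y : ℝ => u (x + y * I)) (zero_lt_one' ℝ)
    (MemLp.of_bound (hum.comp (measurable_vertical x)).aestronglyMeasurable B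
      (Eventually.of_forall fun _ => hub _))
  simpa only [fourierCoeffOn_vertical, sub_zero, inv_one, one_smul] using h

theorem intervalIntegrable_sq_vertical {u : ℂ → ℂ} {B : ℝ} (hum : Measurable u)
    (hub : ∀ z, ‖u z‖ ≤ B) (x a b : ℝ) :
    IntervalIntegrable (fun y : ℝ => ‖u (x + y * I)‖ ^ 2) volume a b := by
  rw [intervalIntegrable_iff]
  refine Measure.integrableOn_of_bounded (M := B ^ 2) (by simp)
    ((hum.comp (measurable_vertical x)).norm.pow_const 2).aestronglyMeasurable
    (Eventually.of_forall fun y => ?_)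
  rw [norm_pow, norm_norm]
  exact pow_le_pow_left₀ (norm_nonneg _) (hub _) 2

/-- Unique continuation from the Cauchy data of the low Fourier modes. -/
theorem eq_zero_of_cauchyData {D : Set ℂ} {u f : ℂ → ℂ} {B M : ℝ} {N : ℕ} (hN : 0 < N)
    (hM : 0 ≤ M) (hMN : M ≤ N)
    (hD : ∀ K : Set ℂ, IsCompact K → (K ∩ D).Finite) (hum : Measurable u) (hfm : Measurable f)
    (hub : ∀ z, ‖u z‖ ≤ B) (hfu : ∀ z, ‖f z‖ ≤ M * ‖u z‖) (hu : ∀ z ∉ D, ContDiffAt ℝ 2 u z)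
    (hf : ∀ z ∉ D, ContinuousAt f z) (huf : ∀ z ∉ D, flatLaplacian u z = f z)
    (hup : Function.Periodic u I) (hfp : Function.Periodic f I)
    (h0 : ∀ k : ℤ, |k| ≤ N → circleCoeff u (2 * Real.pi * k) 0 = 0 ∧
      deriv (circleCoeff u (2 * Real.pi * k)) 0 = 0) : ∀ z ∉ D, u z = 0 := by
  have hB0 : 0 ≤ B := (norm_nonneg _).trans (hub 0)
  have hfb (z : ℂ) : ‖f z‖ ≤ M * B := (hfu z).trans (mul_le_mul_of_nonneg_left (hub z) hM)
  set B' := max B (M * B)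
  have hode := fun k : ℤ => circleCoeff_ode (B := B') hD hum hfm
    (fun z => (hub z).trans (le_max_left _ _)) (fun z => (hfb z).trans (le_max_right _ _))
    hu hf huf hup hfp k
  choose hFc A' hA' using hode
  have hU (t : ℝ) : ∫ y in (0 : ℝ)..1, ‖u (t + y * I)‖ ^ 2 = 0 := by
    refine eq_zero_of_lowModes (A := fun k => circleCoeff u (2 * Real.pi * k)) (A' := A')
      (F := fun k => circleCoeff f (2 * Real.pi * k))
      (U := fun t => ∫ y in (0 : ℝ)..1, ‖u (t + y * I)‖ ^ 2) (B := B) hN hM hMN hA' hFc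
      (fun k t => norm_circleCoeff_le hub _ t) (fun k hk => ?_)
      (fun t => hasSum_sq_circleCoeff hum hub t) (fun J t => ?_) (fun t => ?_) t
    · rw [← (hA' k 0).1.deriv]
      exact h0 k hk
    · refine (sum_le_hasSum J (fun k _ => by positivity)
        (hasSum_sq_circleCoeff hfm hfb t)).trans ?_
      rw [← intervalIntegral.integral_const_mul]
      refine intervalIntegral.integral_mono_on zero_le_one
        (intervalIntegrable_sq_vertical hfm hfb t 0 1)
        ((intervalIntegrable_sq_vertical hum hub t 0 1).const_mul _) fun y _ => ?_
      rw [← mul_pow]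
      exact pow_le_pow_left₀ (norm_nonneg _) (hfu _) 2
    · calc ∫ y in (0 : ℝ)..1, ‖u (t + y * I)‖ ^ 2 ≤ ∫ y in (0 : ℝ)..1, B ^ 2 := by
            refine intervalIntegral.integral_mono_on zero_le_one
              (intervalIntegrable_sq_vertical hum hub t 0 1) intervalIntegrable_const fun y _ => ?_
            exact pow_le_pow_left₀ (norm_nonneg _) (hub _) 2
        _ = B ^ 2 := by simp
  -- So far `u` vanishes almost everywhere on every vertical circle; continuity off `D` has to turn
  -- this into vanishing at `z`.
  intro z hz
  by_contra hne
  set w : ℝ → ℝ := fun y => ‖u (z.re + y * I)‖ ^ 2 with hw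
  have hwp : Function.Periodic w 1 := fun y => by
    simp only [hw]
    rw [← hup (z.re + y * I)]
    congr 3
    push_cast
    ring
  -- The period is recentred so that `z.im` is an interior point of the interval of integration.
  have hi : ∫ y in (z.im - 1 / 2)..(z.im - 1 / 2 + 1), w y = 0 := by
    rw [hwp.intervalIntegral_add_eq (z.im - 1 / 2) 0, zero_add]
    exact hU z.re
  rw [intervalIntegral.integral_of_le (by linarith)] at hi
  have hint := intervalIntegrable_sq_vertical hum hub z.re (z.im - 1 / 2) (z.im - 1 / 2 + 1)
  rw [intervalIntegrable_iff, uIoc_of_le (by linarith)] at hint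
  have hae := (setIntegral_eq_zero_iff_of_nonneg_ae
    (Eventually.of_forall fun y => sq_nonneg _) hint).1 hi
  rw [EventuallyEq, ae_restrict_iff' measurableSet_Ioc] at hae
  have hzeq : (z.re + z.im * I : ℂ) = z := re_add_im z
  have hcont : ContinuousAt (fun y : ℝ => u (z.re + y * I)) z.im := by
    refine ContinuousAt.comp (f := fun y : ℝ => (z.re + y * I : ℂ)) ?_ (by fun_prop)
    rw [hzeq]
    exact (hu z hz).continuousAt
  have hnhds : ∀ᶠ y : ℝ in 𝓝 z.im, u (z.re + y * I) ≠ 0 ∧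
      y ∈ Ioc (z.im - 1 / 2) (z.im - 1 / 2 + 1) := by
    refine (hcont.eventually_ne (by rwa [hzeq])).and ?_
    exact Ioc_mem_nhds (by linarith) (by linarith)
  refine (Measure.measure_pos_of_mem_nhds volume hnhds).ne' (measure_mono_null ?_ hae)
  rintro y ⟨h1, h2⟩ h3
  exact h1 (by simpa using h3 h2)

/-! ### Finite dimension from the differential inequality -/

theorem measurable_of_eqOn_zero {D : Set ℂ} (hD : IsClosed D) {u : ℂ → ℂ}
    (h0 : ∀ z ∈ D, u z = 0) (hc : ∀ z ∉ D, ContinuousAt u z) : Measurable u := by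
  classical
  have : u = D.piecewise (fun _ => 0) u := by
    funext z
    by_cases hz : z ∈ D
    · rw [piecewise_eq_of_mem _ _ _ hz, h0 z hz]
    · rw [piecewise_eq_of_notMem _ _ _ hz]
  rw [this]
  exact ContinuousOn.measurable_piecewise continuousOn_const
    (fun z hz => (hc z hz).continuousWithinAt) hD.measurableSet

theorem dirDeriv_periodic {u : ℂ → ℂ} {c : ℂ} (hu : Function.Periodic u c) (v : ℂ) :
    Function.Periodic (dirDeriv v u) c := by
  intro z
  unfold dirDeriv
  rw [← fderiv_comp_add_right, hu.funext]

theorem flatLaplacian_periodic {u : ℂ → ℂ} {c : ℂ} (hu : Function.Periodic u c) :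
    Function.Periodic (flatLaplacian u) c := fun z => by
  simp only [flatLaplacian, dirDeriv_periodic (dirDeriv_periodic hu _) _ z]

theorem circleCoeff_add {u w : ℂ → ℂ} {B B' : ℝ} (hum : Measurable u) (hub : ∀ z, ‖u z‖ ≤ B)
    (hwm : Measurable w) (hwb : ∀ z, ‖w z‖ ≤ B') (ω : ℝ) :
    circleCoeff (u + w) ω = circleCoeff u ω + circleCoeff w ω := by
  funext x
  simp only [circleCoeff, Pi.add_apply, add_mul]
  exact intervalIntegral.integral_add (intervalIntegrable_circle hum hub ω x 0 1)
    (intervalIntegrable_circle hwm hwb ω x 0 1)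

theorem circleCoeff_smul (c : ℝ) (u : ℂ → ℂ) (ω : ℝ) :
    circleCoeff (c • u) ω = c • circleCoeff u ω := by
  funext x
  simp only [circleCoeff, Pi.smul_apply, smul_mul_assoc]
  exact intervalIntegral.integral_smul _ _

/-- A space of bounded functions on the cylinder, with isolated singularities, that satisfy the
differential inequality `|Δ u| ≤ M |u|` is finite-dimensional. -/
theorem finiteDimensional_of_laplacian_le {W : Type*} [AddCommGroup W] [Module ℝ W]
    (T : W →ₗ[ℝ] (ℂ → ℂ)) {D : Set ℂ} (hD : ∀ K : Set ℂ, IsCompact K → (K ∩ D).Finite)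
    (hDc : IsClosed D) (hDp : ∀ z, z + I ∈ D ↔ z ∈ D) {M : ℝ}
    (h0 : ∀ w, ∀ z ∈ D, T w z = 0) (hb : ∀ w, ∃ B : ℝ, ∀ z, ‖T w z‖ ≤ B)
    (hT : ∀ w, ∀ z ∉ D, ContDiffAt ℝ 2 (T w) z) (hp : ∀ w, Function.Periodic (T w) I)
    (hM : ∀ w, ∀ z ∉ D, ‖flatLaplacian (T w) z‖ ≤ M * ‖T w z‖)
    (hinj : ∀ w, (∀ z ∉ D, T w z = 0) → w = 0) : FiniteDimensional ℝ W := by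
  classical
  obtain ⟨N, hN⟩ := exists_nat_ge (max M 1)
  have hN0 : 0 < N := by
    have : (1 : ℝ) ≤ N := (le_max_right _ _).trans hN
    exact_mod_cast this
  -- With value 0 on `D`, where `T w` vanishes too, the inequality `‖f‖ ≤ max M 1 * ‖T w‖` holds at
  -- every point of the plane.
  let f : W → ℂ → ℂ := fun w z => if z ∈ D then 0 else flatLaplacian (T w) z
  have hDo : IsOpen Dᶜ := hDc.isOpen_compl
  have hfe (w : W) {z : ℂ} (hz : z ∉ D) : f w =ᶠ[𝓝 z] flatLaplacian (T w) := by
    filter_upwards [hDo.mem_nhds hz] with s hs using if_neg hs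
  have hfc (w : W) (z : ℂ) (hz : z ∉ D) : ContinuousAt (f w) z := by
    refine ContinuousAt.congr ?_ (hfe w hz).symm
    have (v : ℂ) : ContinuousAt (dirDeriv v (dirDeriv v (T w))) z :=
      (contDiffAt_dirDeriv (m := 0) (contDiffAt_dirDeriv (m := 1) (hT w z hz) (by norm_num))
        (by norm_num)).continuousAt
    exact (this 1).add (this I)
  have hTm (w : W) : Measurable (T w) :=
    measurable_of_eqOn_zero hDc (h0 w) fun z hz => (hT w z hz).continuousAt
  have hfm (w : W) : Measurable (f w) :=
    measurable_of_eqOn_zero hDc (fun z hz => if_pos hz) (hfc w)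
  have hfM (w : W) (z : ℂ) : ‖f w z‖ ≤ max M 1 * ‖T w z‖ := by
    by_cases hz : z ∈ D
    · simp only [f, if_pos hz, norm_zero]
      positivity
    · simp only [f, if_neg hz]
      exact (hM w z hz).trans (mul_le_mul_of_nonneg_right (le_max_left _ _) (norm_nonneg _))
  have hfp (w : W) : Function.Periodic (f w) I := fun z => by
    simp only [f, hDp, flatLaplacian_periodic (hp w) z]
  have hdiff (w : W) (k : ℤ) : DifferentiableAt ℝ (circleCoeff (T w) (2 * Real.pi * k)) 0 := by
    obtain ⟨B, hB⟩ := hb w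
    obtain ⟨-, a', ha'⟩ := circleCoeff_ode (B := max B (max M 1 * B)) hD (hTm w) (hfm w)
      (fun z => (hB z).trans (le_max_left _ _))
      (fun z => ((hfM w z).trans (mul_le_mul_of_nonneg_left (hB z) (by positivity))).trans
        (le_max_right _ _))
      (hT w) (hfc w) (fun z hz => (if_neg hz).symm) (hp w) (hfp w) k
    exact (ha' 0).1.differentiableAt
  -- The Cauchy data at `x = 0` of the `2N + 1` low modes. Linearity in the derivative needs the
  -- coefficients to be differentiable, which comes from their differential equation.
  let Φ : W →ₗ[ℝ] (Finset.Icc (-(N : ℤ)) N → ℂ × ℂ) :=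
    { toFun := fun w k => (circleCoeff (T w) (2 * Real.pi * (k : ℤ)) 0,
        deriv (circleCoeff (T w) (2 * Real.pi * (k : ℤ))) 0)
      map_add' := fun w w' => by
        obtain ⟨B, hB⟩ := hb w
        obtain ⟨B', hB'⟩ := hb w'
        funext k
        rw [map_add, circleCoeff_add (hTm w) hB (hTm w') hB', deriv_add (hdiff w k) (hdiff w' k)]
        rfl
      map_smul' := fun c w => by
        funext k
        rw [map_smul, circleCoeff_smul, deriv_const_smul _ (hdiff w k)]
        rfl }
  refine FiniteDimensional.of_injective Φ ((injective_iff_map_eq_zero Φ).2 fun w hw => ?_)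
  refine hinj w ?_
  obtain ⟨B, hB⟩ := hb w
  refine eq_zero_of_cauchyData hN0 (by positivity) hN hD (hTm w) (hfm w) hB (hfM w) (hT w)
    (hfc w) (fun z hz => (if_neg hz).symm) (hp w) (hfp w) fun k hk => ?_
  have := congrFun hw ⟨k, Finset.mem_Icc.2 (abs_le.1 hk)⟩
  exact ⟨congrArg Prod.fst this, congrArg Prod.snd this⟩

/-! ### The bound for the spherical derivative -/

/-- The third coordinate of the Gauss map. -/
def gaussHeight (g : ℂ → ℂ) (z : ℂ) : ℝ := gaussMap g z 2

theorem gaussHeight_of_pole {g : ℂ → ℂ} {z : ℂ} (h : meromorphicOrderAt g z < 0) :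
    gaussHeight g z = 1 := by
  simp [gaussHeight, gaussMap, sphereValue, h, stereo]

theorem gaussHeight_of_nonneg {g : ℂ → ℂ} {z : ℂ} (h : 0 ≤ meromorphicOrderAt g z) :
    gaussHeight g z = (‖g z‖ ^ 2 - 1) / (‖g z‖ ^ 2 + 1) := by
  simp only [gaussHeight, gaussMap, sphereValue, not_lt.2 h, if_false]
  rfl

/-- Near every point the Gauss map of a meromorphic function stays away from one of the poles of
the sphere. -/
theorem exists_gaussHeight_bound {g : ℂ → ℂ} {z : ℂ} (hg : MeromorphicNFAt g z) :
    ∃ r > 0, (∀ w ∈ Metric.ball z r, gaussHeight g w ≤ 1 / 4) ∨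
      ∀ w ∈ Metric.ball z r, -1 / 4 ≤ gaussHeight g w := by
  -- The thresholds `±1/4` leave room for an error `1/4` under uniform convergence; the Cauchy
  -- estimate needs only `±1/2`.
  suffices h : (∀ᶠ w in 𝓝 z, gaussHeight g w ≤ 1 / 4) ∨
      ∀ᶠ w in 𝓝 z, -1 / 4 ≤ gaussHeight g w by
    rcases h with h | h <;> obtain ⟨r, hr, h⟩ := Metric.eventually_nhds_iff_ball.1 h
    · exact ⟨r, hr, Or.inl h⟩
    · exact ⟨r, hr, Or.inr h⟩
  rcases lt_or_ge (meromorphicOrderAt g z) 0 with ho | ho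
  · refine Or.inr ?_
    have h1 : ∀ᶠ w in 𝓝[≠] z, 1 ≤ ‖g w‖ :=
      (tendsto_norm_cobounded_atTop.comp
        (tendsto_cobounded_of_meromorphicOrderAt_neg ho)).eventually_ge_atTop 1
    rw [eventually_nhdsWithin_iff] at h1
    filter_upwards [h1] with w hw
    rcases lt_or_ge (meromorphicOrderAt g w) 0 with hw' | hw'
    · rw [gaussHeight_of_pole hw']; norm_num
    · have hne : w ≠ z := by
        rintro rfl
        exact absurd ho (not_lt.2 hw')
      have h2 := hw hne
      rw [gaussHeight_of_nonneg hw']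
      refine le_trans (by norm_num) (div_nonneg (by nlinarith) (by positivity) :
        0 ≤ (‖g w‖ ^ 2 - 1) / (‖g w‖ ^ 2 + 1))
  · have ha := hg.meromorphicOrderAt_nonneg_iff_analyticAt.1 ho
    have he : ∀ᶠ w in 𝓝 z, gaussHeight g w = (‖g w‖ ^ 2 - 1) / (‖g w‖ ^ 2 + 1) := by
      filter_upwards [ha.eventually_analyticAt] with w hw
      exact gaussHeight_of_nonneg (hw.meromorphicNFAt.meromorphicOrderAt_nonneg_iff_analyticAt.2 hw)
    have hc : ContinuousAt (fun w => (‖g w‖ ^ 2 - 1) / (‖g w‖ ^ 2 + 1)) z := by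
      have := ha.continuousAt.norm.pow 2
      exact (this.sub continuousAt_const).div (this.add continuousAt_const) (by positivity)
    rcases le_total ((‖g z‖ ^ 2 - 1) / (‖g z‖ ^ 2 + 1)) 0 with h | h
    · left
      filter_upwards [he, hc.eventually_lt_const (lt_of_le_of_lt h (by norm_num : (0 : ℝ) < 1 / 4))]
        with w h1 h2
      rw [h1]; exact h2.le
    · right
      filter_upwards [he, hc.eventually_const_lt (lt_of_lt_of_le (by norm_num : -1 / 4 < (0 : ℝ)) h)]
        with w h1 h2
      rw [h1]; exact h2.le

/-- Cauchy's estimate on the circle of radius `r / 2`, with `‖f‖ ≤ 2`. -/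
theorem norm_deriv_le_of_bounded {f : ℂ → ℂ} {z : ℂ} {r : ℝ} (hr : 0 < r)
    (hf : ∀ w ∈ Metric.ball z r, AnalyticAt ℂ f w) (hb : ∀ w ∈ Metric.ball z r, ‖f w‖ ^ 2 ≤ 3) :
    ‖deriv f z‖ ≤ 4 / r := by
  have hsub : Metric.closedBall z (r / 2) ⊆ Metric.ball z r :=
    Metric.closedBall_subset_ball (by linarith)
  have hd : DifferentiableOn ℂ f (Metric.closedBall z (r / 2)) := fun w hw =>
    (hf w (hsub hw)).differentiableAt.differentiableWithinAt
  have := norm_deriv_le_of_forall_mem_sphere_norm_le (C := 2) (half_pos hr)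
    (hd.diffContOnCl_ball subset_rfl) fun w hw => by
      have := hb w (hsub (Metric.sphere_subset_closedBall hw))
      nlinarith [norm_nonneg (f w)]
  refine this.trans_eq ?_
  field_simp
  norm_num

/-- At a pole `deriv` takes its default value 0, so the bound for the spherical derivative is
trivially true there. -/
theorem deriv_eq_zero_of_pole {g : ℂ → ℂ} {z : ℂ} (h : meromorphicOrderAt g z < 0) :
    deriv g z = 0 := by
  refine deriv_zero_of_not_differentiableAt fun hd => ?_
  have h1 : Tendsto (fun w => ‖g w‖) (𝓝[≠] z) atTop :=
    tendsto_norm_cobounded_atTop.comp (tendsto_cobounded_of_meromorphicOrderAt_neg h)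
  exact not_tendsto_nhds_of_tendsto_atTop h1 _
    (hd.continuousAt.norm.tendsto.mono_left nhdsWithin_le_nhds)

/-- A Cauchy estimate for the spherical derivative. -/
theorem norm_deriv_le_of_gaussHeight {g : ℂ → ℂ} (hg : MeromorphicNFOn g univ) {z : ℂ} {r : ℝ}
    (hr : 0 < r) (h : (∀ w ∈ Metric.ball z r, gaussHeight g w ≤ 1 / 2) ∨
      ∀ w ∈ Metric.ball z r, -1 / 2 ≤ gaussHeight g w) :
    ‖deriv g z‖ ≤ 4 / r * (1 + ‖g z‖ ^ 2) := by
  have hr4 : 0 < 4 / r := by positivity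
  rcases h with h | h
  -- Height at most `1/2` excludes poles and means `‖g‖² ≤ 3`.
  · have ho (w : ℂ) (hw : w ∈ Metric.ball z r) : 0 ≤ meromorphicOrderAt g w := by
      by_contra hlt
      have := h w hw
      rw [gaussHeight_of_pole (not_le.1 hlt)] at this
      norm_num at this
    refine (norm_deriv_le_of_bounded hr (fun w hw =>
      (hg (mem_univ w)).meromorphicOrderAt_nonneg_iff_analyticAt.1 (ho w hw)) fun w hw => ?_).trans
      (le_mul_of_one_le_right hr4.le (by nlinarith [norm_nonneg (g z)]))
    have := h w hw
    rw [gaussHeight_of_nonneg (ho w hw), div_le_iff₀ (by positivity)] at this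
    linarith
  · rcases lt_or_ge (meromorphicOrderAt g z) 0 with hz | hz
    · rw [deriv_eq_zero_of_pole hz, norm_zero]
      positivity
    -- Height at least `-1/2` means `‖1/g‖² ≤ 3`. Cauchy's estimate for `1/g` bounds `‖g'‖ / ‖g‖²`,
    -- which suffices.
    have hinv (w : ℂ) : MeromorphicNFAt g⁻¹ w := (hg (mem_univ w)).inv
    have ho (w : ℂ) (hw : w ∈ Metric.ball z r) (hw0 : 0 ≤ meromorphicOrderAt g w) :
        g w ≠ 0 ∧ ‖(g w)⁻¹‖ ^ 2 ≤ 3 := by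
      have h1 := h w hw
      rw [gaussHeight_of_nonneg hw0, le_div_iff₀ (by positivity)] at h1
      have h2 : 1 / 3 ≤ ‖g w‖ ^ 2 := by linarith
      refine ⟨fun h0 => ?_, ?_⟩
      · rw [h0] at h2
        norm_num at h2
      · rw [norm_inv, inv_pow]
        exact inv_le_of_inv_le₀ (by norm_num) (by linarith)
    have hord (w : ℂ) (hw : w ∈ Metric.ball z r) : meromorphicOrderAt g w ≤ 0 := by
      rcases lt_or_ge (meromorphicOrderAt g w) 0 with hw0 | hw0
      · exact hw0.le
      · exact ((hg (mem_univ w)).meromorphicOrderAt_eq_zero_iff.2 (ho w hw hw0).1).le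
    have ha (w : ℂ) (hw : w ∈ Metric.ball z r) : AnalyticAt ℂ g⁻¹ w := by
      refine (hinv w).meromorphicOrderAt_nonneg_iff_analyticAt.1 ?_
      rw [meromorphicOrderAt_inv]
      have := hord w hw
      revert this
      cases meromorphicOrderAt g w with
      | top => simp
      | coe n => norm_cast; omega
    have hb (w : ℂ) (hw : w ∈ Metric.ball z r) : ‖g⁻¹ w‖ ^ 2 ≤ 3 := by
      rcases lt_or_ge (meromorphicOrderAt g w) 0 with hw0 | hw0
      · have : g⁻¹ w = 0 := by
          by_contra hne
          have h3 := (hinv w).meromorphicOrderAt_eq_zero_iff.2 hne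
          rw [meromorphicOrderAt_inv] at h3
          revert h3 hw0
          cases meromorphicOrderAt g w with
          | top => simp
          | coe n => norm_cast; omega
        rw [this]
        norm_num
      · exact (ho w hw hw0).2
    have hd := norm_deriv_le_of_bounded hr ha hb
    have hz0 := (ho z (Metric.mem_ball_self hr) hz).1
    have hgd := ((hg (mem_univ z)).meromorphicOrderAt_nonneg_iff_analyticAt.1 hz).differentiableAt
    have hpos : 0 < ‖g z‖ ^ 2 := by positivity
    rw [(hgd.hasDerivAt.inv hz0).deriv, norm_div, norm_neg, norm_pow, div_le_iff₀ hpos] at hd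
    refine hd.trans ?_
    gcongr
    linarith

theorem toCyl_eq_toCyl_iff {z w : ℂ} : toCyl z = toCyl w ↔ ∃ n : ℤ, w = z + n * I := by
  rw [toCyl, toCyl, QuotientAddGroup.eq, AddSubgroup.mem_zmultiples_iff]
  refine exists_congr fun n => ?_
  rw [zsmul_eq_mul]
  constructor <;> intro h
  · rw [h]; ring
  · rw [h]; ring

/-- A compact subset of the cylinder is covered by the image of a disc. Representatives in the strip
`0 ≤ Im ≤ 1` share the real part with a point of that disc, hence stay bounded. -/
theorem tendsto_toCyl_cocompact {z : ℕ → ℂ} (hz : Tendsto z atTop (cocompact ℂ))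
    (him : ∀ k, (z k).im ∈ Icc (0 : ℝ) 1) :
    Tendsto (fun k => toCyl (z k)) atTop (cocompact Cylinder) := by
  rw [hasBasis_cocompact.tendsto_right_iff]
  intro K hK
  have hopen : ∀ n : ℕ, IsOpen (toCyl '' Metric.ball 0 n) := fun n =>
    QuotientAddGroup.isOpenMap_coe _ Metric.isOpen_ball
  obtain ⟨n, hn⟩ := hK.elim_directed_cover (fun n : ℕ => toCyl '' Metric.ball 0 n) hopen
    (fun p _ => by
      obtain ⟨w, rfl⟩ := QuotientAddGroup.mk_surjective p
      obtain ⟨n, hn⟩ := exists_nat_gt ‖w‖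
      exact mem_iUnion.2 ⟨n, w, by simpa using hn, rfl⟩)
    (monotone_nat_of_le_succ fun n => image_mono (Metric.ball_subset_ball (by simp))).directed_le
  have hfar := hz.eventually (isCompact_closedBall (0 : ℂ) (n + 1)).compl_mem_cocompact
  filter_upwards [hfar] with k hk hkK
  obtain ⟨w, hw, hwz⟩ := hn hkK
  obtain ⟨m, hm⟩ := toCyl_eq_toCyl_iff.1 hwz
  refine hk ?_
  have hre : (z k).re = w.re := by rw [hm]; simp
  rw [Metric.mem_closedBall, dist_zero_right]
  have h1 : |w.re| ≤ n := (abs_re_le_norm w).trans (mem_ball_zero_iff.1 hw |>.le)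
  have h2 : |(z k).im| ≤ 1 := abs_le.2 ⟨by linarith [(him k).1], (him k).2⟩
  have := norm_le_abs_re_add_abs_im (z k)
  rw [hre] at this
  linarith

/-- The spherical derivative of a quasiperiodic function is bounded. -/
theorem IsQuasiperiodic.exists_deriv_bound {g : ℂ → ℂ} (hg : IsQuasiperiodic g) :
    ∃ C : ℝ, 0 ≤ C ∧ ∀ z, ‖deriv g z‖ ≤ C * (1 + ‖g z‖ ^ 2) := by
  have hNF := hg.isMeromorphic.meromorphic
  have hper := hg.isMeromorphic.periodic
  by_contra! hcon
  have hz (k : ℕ) : ∃ z : ℂ, z.im ∈ Icc (0 : ℝ) 1 ∧ k * (1 + ‖g z‖ ^ 2) < ‖deriv g z‖ := by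
    obtain ⟨z, hz⟩ := hcon k (by positivity)
    have hdper : Function.Periodic (deriv g) I := fun w => by
      rw [← deriv_comp_add_const, hper.funext]
    refine ⟨z - ⌊z.im⌋ * I, ?_, ?_⟩
    · simp only [sub_im, mul_im, intCast_re, I_im, mul_one, intCast_im, I_re, mul_zero, add_zero]
      exact ⟨by linarith [Int.floor_le z.im], by linarith [Int.lt_floor_add_one z.im]⟩
    · rw [hper.sub_int_mul_eq, hdper.sub_int_mul_eq]
      exact hz
  choose z him hz using hz
  -- A fixed radius on which the Gauss map avoids a polar cap bounds the spherical derivative by `4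
  -- / r` along a subsequence, against its growth beyond `k`.
  have finish (s : ℕ → ℕ) (hs : StrictMono s) (r : ℝ) (hr : 0 < r)
      (h : ∀ᶠ k in atTop, (∀ w ∈ Metric.ball (z (s k)) r, gaussHeight g w ≤ 1 / 2) ∨
        ∀ w ∈ Metric.ball (z (s k)) r, -1 / 2 ≤ gaussHeight g w) : False := by
    obtain ⟨n, hn⟩ := exists_nat_gt (4 / r)
    obtain ⟨k, hk, hkn⟩ := (h.and (eventually_ge_atTop n)).exists
    have h1 := (hz (s k)).trans_le (norm_deriv_le_of_gaussHeight hNF hr hk)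
    have h2 := lt_of_mul_lt_mul_right h1 (by positivity)
    have h3 : (n : ℝ) ≤ s k := by exact_mod_cast hkn.trans (hs.le_apply)
    linarith
  -- If the points diverge, the limit of the translates controls the Gauss map near them; otherwise
  -- a subsequence converges to some `a` and `g` itself does.
  by_cases hcc : Tendsto z atTop (cocompact ℂ)
  · obtain ⟨s, hs, G, hG, -, hlim⟩ := hg.limits z (tendsto_toCyl_cocompact hcc him)
    obtain ⟨r, hr, hr'⟩ := exists_gaussHeight_bound (hG.meromorphic (mem_univ 0))
    rw [Metric.tendstoLocallyUniformly_iff] at hlim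
    obtain ⟨t, ht, hclose⟩ := hlim (1 / 4) (by norm_num) 0
    obtain ⟨r₂, hr₂, hball⟩ := Metric.mem_nhds_iff.1 ht
    refine finish s hs (min r r₂) (lt_min hr hr₂) ?_
    filter_upwards [hclose] with k hk
    have hcl (w : ℂ) (hw : w ∈ Metric.ball (z (s k)) (min r r₂)) :
        w - z (s k) ∈ Metric.ball (0 : ℂ) r ∧
          |gaussHeight G (w - z (s k)) - gaussHeight g w| < 1 / 4 := by
      rw [Metric.mem_ball, dist_eq_norm, lt_min_iff] at hw
      refine ⟨by simpa using hw.1, ?_⟩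
      have h1 := hk (w - z (s k)) (hball (by simpa using hw.2))
      rw [sub_add_cancel, dist_eq_norm] at h1
      exact (PiLp.norm_apply_le (gaussMap G (w - z (s k)) - gaussMap g w) 2).trans_lt h1
    rcases hr' with h | h
    · refine Or.inl fun w hw => ?_
      obtain ⟨h1, h2⟩ := hcl w hw
      have h3 := h _ h1
      rw [abs_lt] at h2
      linarith
    · refine Or.inr fun w hw => ?_
      obtain ⟨h1, h2⟩ := hcl w hw
      have h3 := h _ h1
      rw [abs_lt] at h2
      linarith
  · rw [hasBasis_cocompact.tendsto_right_iff] at hcc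
    push Not at hcc
    obtain ⟨K, hK, hfreq⟩ := hcc
    obtain ⟨a, -, s, hs, hlim⟩ := hK.tendsto_subseq' (x := z)
      (hfreq.mono fun k hk => not_not.1 hk)
    obtain ⟨r, hr, hr'⟩ := exists_gaussHeight_bound (hNF (mem_univ a))
    refine finish s hs (r / 2) (half_pos hr) ?_
    filter_upwards [hlim.eventually (Metric.ball_mem_nhds a (half_pos hr))] with k hk
    have hsub : Metric.ball (z (s k)) (r / 2) ⊆ Metric.ball a r := by
      refine Metric.ball_subset_ball' ?_
      have : dist (z (s k)) a < r / 2 := hk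
      linarith
    rcases hr' with h | h
    · exact Or.inl fun w hw => (h w (hsub hw)).trans (by norm_num)
    · exact Or.inr fun w hw => le_trans (by norm_num) (h w (hsub hw))

/-! ### Lifting to the plane and the discreteness of the ends -/

theorem toCyl_add_I (z : ℂ) : toCyl (z + I) = toCyl z :=
  (toCyl_eq_toCyl_iff.2 ⟨1, by simp⟩).symm

theorem dist_toCyl_le (z w : ℂ) : dist (toCyl z) (toCyl w) ≤ dist z w := by
  rw [dist_eq_norm, dist_eq_norm]
  exact QuotientAddGroup.norm_mk_le_norm (S := AddSubgroup.zmultiples I) (m := z - w)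

theorem lift_periodic {F : Type*} [Zero F] {E : Set Cylinder} (f : ↥Eᶜ → F) :
    Function.Periodic (lift f) I := by
  classical
  intro z
  change (fun p : Cylinder => if h : p ∈ Eᶜ then f ⟨p, h⟩ else 0) (toCyl (z + I)) = _
  rw [toCyl_add_I]
  rfl

/-- The zeros and poles of a quasiperiodic function are uniformly separated. -/
theorem IsQuasiperiodic.exists_separation {g : ℂ → ℂ} (hg : IsQuasiperiodic g) :
    ∃ ε > 0, (toCyl ⁻¹' zerosAndPoles g).Pairwise fun z w => ε ≤ dist z w := by
  obtain ⟨C, hC, hsep, -⟩ := hg.spacing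
  -- `C` separates points over different points of the cylinder; two lifts of the same point differ
  -- by a non-zero multiple of `i`.
  refine ⟨min C 1, lt_min hC one_pos, fun z hz w hw hne => ?_⟩
  by_cases h : toCyl z = toCyl w
  · obtain ⟨n, hn⟩ := toCyl_eq_toCyl_iff.1 h
    refine (min_le_right _ _).trans ?_
    have hn0 : n ≠ 0 := by
      rintro rfl
      exact hne (by simp [hn])
    rw [hn, dist_eq_norm]
    simp only [sub_add_cancel_left, norm_neg, norm_mul, norm_intCast, norm_I, mul_one]
    exact_mod_cast Int.one_le_abs hn0
  · exact (min_le_left _ _).trans ((hsep _ hz _ hw h).trans (dist_toCyl_le z w))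

/-- An accumulation point would have two distinct points of `D` within `ε / 2` of it. -/
theorem finite_inter_of_separated {D : Set ℂ} {ε : ℝ} (hε : 0 < ε)
    (hD : D.Pairwise fun z w => ε ≤ dist z w) {K : Set ℂ} (hK : IsCompact K) :
    (K ∩ D).Finite := by
  by_contra hinf
  obtain ⟨x, -, hx⟩ := Set.Infinite.exists_accPt_of_subset_isCompact hinf hK inter_subset_left
  rw [accPt_iff_frequently] at hx
  obtain ⟨y, ⟨hyx, -, hyD⟩, hy⟩ :=
    (hx.and_eventually (Metric.ball_mem_nhds x (half_pos hε))).exists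
  obtain ⟨w, ⟨-, -, hwD⟩, hw⟩ :=
    (hx.and_eventually (Metric.ball_mem_nhds x
      (lt_min (half_pos hε) (dist_pos.2 hyx)))).exists
  -- Choosing `w` closer to `x` than `y` forces the two points to be distinct.
  have hw' : dist w x < min (ε / 2) (dist y x) := hw
  have hy' : dist y x < ε / 2 := hy
  have hne : y ≠ w := by
    rintro rfl
    exact (hw'.trans_le (min_le_right _ _)).false
  have h1 := hD hyD hwD hne
  have h2 := hw'.trans_le (min_le_left _ _)
  have h3 := dist_triangle_right y w x
  linarith

theorem analyticAt_of_notMem_zerosAndPoles {g : ℂ → ℂ} (hg : MeromorphicNFOn g univ) {z : ℂ}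
    (hz : toCyl z ∉ zerosAndPoles g) : AnalyticAt ℂ g z ∧ g z ≠ 0 := by
  have h : ¬ (sphereValue g z = ((0 : ℂ) : OnePoint ℂ) ∨ sphereValue g z = OnePoint.infty) :=
    fun h => hz ⟨z, h, rfl⟩
  rw [not_or] at h
  have ho : 0 ≤ meromorphicOrderAt g z := by
    by_contra hlt
    exact h.2 (if_pos (not_le.1 hlt))
  refine ⟨(hg (mem_univ z)).meromorphicOrderAt_nonneg_iff_analyticAt.1 ho, fun h0 => h.1 ?_⟩
  rw [sphereValue, if_neg (not_lt.2 ho), h0]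

/-! ### The curvature from the Weierstrass data -/

/-- The derivative of the coefficients of the Weierstrass form. -/
def weierstrassDeriv (g : ℂ → ℂ) (z : ℂ) : Fin 3 → ℂ :=
  ![1 / 2 * (-deriv g z / g z ^ 2 - deriv g z), I / 2 * (-deriv g z / g z ^ 2 + deriv g z), 0]

theorem hasDerivAt_weierstrassForm {g : ℂ → ℂ} {z : ℂ} (hg : DifferentiableAt ℂ g z)
    (h0 : g z ≠ 0) (j : Fin 3) :
    HasDerivAt (fun w => weierstrassForm g w j) (weierstrassDeriv g z j) z := by
  have h1 := hg.hasDerivAt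
  have h2 : HasDerivAt (fun w => (g w)⁻¹) (-deriv g z / g z ^ 2) z := h1.inv h0
  fin_cases j
  · exact (h2.sub h1).const_mul (1 / 2)
  · exact (h2.add h1).const_mul (I / 2)
  · exact hasDerivAt_const z (1 : ℂ)

theorem fderiv_apply_of_hasFDerivAt {Y : ℂ → EuclideanSpace ℝ (Fin 3)} {L : Fin 3 → ℂ →L[ℝ] ℝ}
    {z : ℂ} (h : ∀ j, HasFDerivAt (fun w => Y w j) (L j) z) (v : ℂ) (j : Fin 3) :
    fderiv ℝ Y z v j = L j v := by
  have hd : DifferentiableAt ℝ Y z :=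
    differentiableAt_euclidean.2 fun j => (h j).differentiableAt
  have h1 : HasFDerivAt (fun w => Y w j)
      ((EuclideanSpace.proj j : EuclideanSpace ℝ (Fin 3) →L[ℝ] ℝ).comp (fderiv ℝ Y z)) z :=
    (EuclideanSpace.proj j : EuclideanSpace ℝ (Fin 3) →L[ℝ] ℝ).hasFDerivAt.comp z hd.hasFDerivAt
  rw [(h j).unique h1]
  rfl

/-- The first and second derivatives of an immersion with Weierstrass form `Ψ`. -/
theorem weierstrass_derivatives {g : ℂ → ℂ} {Y : ℂ → EuclideanSpace ℝ (Fin 3)} {z : ℂ}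
    (hY : ∀ᶠ w in 𝓝 z, ∀ j, HasFDerivAt (fun w => Y w j)
      (reCLM ∘L (weierstrassForm g w j • ContinuousLinearMap.id ℝ ℂ)) w)
    (hg : DifferentiableAt ℂ g z) (h0 : g z ≠ 0) (j : Fin 3) :
    partialX Y z j = (weierstrassForm g z j).re ∧
    partialY Y z j = -(weierstrassForm g z j).im ∧
    partialX (partialX Y) z j = (weierstrassDeriv g z j).re ∧
    partialY (partialX Y) z j = -(weierstrassDeriv g z j).im ∧
    partialY (partialY Y) z j = -(weierstrassDeriv g z j).re := by
  have hx : ∀ᶠ w in 𝓝 z, ∀ j, partialX Y w j = (weierstrassForm g w j).re := by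
    filter_upwards [hY] with w hw j
    rw [partialX, fderiv_apply_of_hasFDerivAt hw]
    simp
  have hy : ∀ᶠ w in 𝓝 z, ∀ j, partialY Y w j = -(weierstrassForm g w j).im := by
    filter_upwards [hY] with w hw j
    rw [partialY, fderiv_apply_of_hasFDerivAt hw]
    simp
  have hΨ (j : Fin 3) : HasFDerivAt (fun w => weierstrassForm g w j)
      (weierstrassDeriv g z j • ContinuousLinearMap.id ℝ ℂ) z := by
    refine ((hasDerivAt_weierstrassForm hg h0 j).hasFDerivAt.restrictScalars ℝ).congr_fderiv ?_
    ext
    simp [mul_comm]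
  have hxx (j : Fin 3) : HasFDerivAt (fun w => partialX Y w j)
      (reCLM ∘L (weierstrassDeriv g z j • ContinuousLinearMap.id ℝ ℂ)) z :=
    (reCLM.hasFDerivAt.comp z (hΨ j)).congr_of_eventuallyEq
      (by filter_upwards [hx] with w hw using hw j)
  have hyy (j : Fin 3) : HasFDerivAt (fun w => partialY Y w j)
      (-(imCLM ∘L (weierstrassDeriv g z j • ContinuousLinearMap.id ℝ ℂ))) z :=
    (imCLM.hasFDerivAt.comp z (hΨ j)).neg.congr_of_eventuallyEq
      (by filter_upwards [hy] with w hw using hw j)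
  refine ⟨hx.self_of_nhds j, hy.self_of_nhds j, ?_, ?_, ?_⟩
  · rw [partialX, fderiv_apply_of_hasFDerivAt hxx]
    simp
  · rw [partialY, fderiv_apply_of_hasFDerivAt hxx]
    simp
  · rw [partialY, fderiv_apply_of_hasFDerivAt hyy]
    simp

/-- The Gaussian curvature of a minimal immersion in terms of its Weierstrass data `(g, dz)`. -/
theorem gaussCurvature_mul_conformalFactor_sq {g : ℂ → ℂ} {Y : ℂ → EuclideanSpace ℝ (Fin 3)}
    {z : ℂ} (hY : ∀ᶠ w in 𝓝 z, ∀ j, HasFDerivAt (fun w => Y w j)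
      (reCLM ∘L (weierstrassForm g w j • ContinuousLinearMap.id ℝ ℂ)) w)
    (hg : DifferentiableAt ℂ g z) (h0 : g z ≠ 0) :
    0 < conformalFactor Y z ∧ gaussCurvature Y z * conformalFactor Y z ^ 2 =
      -(4 * ‖deriv g z‖ ^ 2 / (1 + ‖g z‖ ^ 2) ^ 2) := by
  have hd := weierstrass_derivatives hY hg h0
  obtain ⟨x1, y1, xx1, xy1, yy1⟩ := hd 0
  obtain ⟨x2, y2, xx2, xy2, yy2⟩ := hd 1
  obtain ⟨x3, y3, xx3, xy3, yy3⟩ := hd 2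
  set x := (g z).re with hx
  set y := (g z).im with hy
  set a := (deriv g z).re with ha
  set b := (deriv g z).im with hb
  set R := x ^ 2 + y ^ 2 with hR
  have hns : normSq (g z) = R := by rw [normSq_apply, hR]; ring
  have hRpos : 0 < R := by rw [← hns]; exact normSq_pos.2 h0
  have hgR : ‖g z‖ ^ 2 = R := by rw [← hns, normSq_eq_norm_sq]
  have hdR : ‖deriv g z‖ ^ 2 = a ^ 2 + b ^ 2 := by
    rw [← normSq_eq_norm_sq, normSq_apply]; ring
  have hinvre : ((g z)⁻¹).re = x / R := by rw [inv_re, hns]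
  have hinvim : ((g z)⁻¹).im = -y / R := by rw [inv_im, hns]
  have hq : deriv g z / g z ^ 2 = deriv g z * ((g z)⁻¹ * (g z)⁻¹) := by
    field_simp
  have hqre : (deriv g z / g z ^ 2).re = (a * (x ^ 2 - y ^ 2) + 2 * b * x * y) / R ^ 2 := by
    rw [hq]
    simp only [mul_re, mul_im, hinvre, hinvim]
    field_simp
    ring
  have hqim : (deriv g z / g z ^ 2).im = (b * (x ^ 2 - y ^ 2) - 2 * a * x * y) / R ^ 2 := by
    rw [hq]
    simp only [mul_re, mul_im, hinvre, hinvim]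
    field_simp
    ring
  set α := (a * (x ^ 2 - y ^ 2) + 2 * b * x * y) / R ^ 2 with hα
  set β := (b * (x ^ 2 - y ^ 2) - 2 * a * x * y) / R ^ 2 with hβ
  have hI2re (w : ℂ) : (I / 2 * w).re = -w.im / 2 := by
    rw [div_mul_eq_mul_div, Complex.div_ofNat_re]; simp
  have hI2im (w : ℂ) : (I / 2 * w).im = w.re / 2 := by
    rw [div_mul_eq_mul_div, Complex.div_ofNat_im]; simp
  have h2re (w : ℂ) : (1 / 2 * w).re = w.re / 2 := by
    rw [div_mul_eq_mul_div, Complex.div_ofNat_re]; simp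
  have h2im (w : ℂ) : (1 / 2 * w).im = w.im / 2 := by
    rw [div_mul_eq_mul_div, Complex.div_ofNat_im]; simp
  have w0 : weierstrassForm g z 0 = 1 / 2 * ((g z)⁻¹ - g z) := rfl
  have w1 : weierstrassForm g z 1 = I / 2 * ((g z)⁻¹ + g z) := rfl
  have w2 : weierstrassForm g z 2 = 1 := rfl
  have d0 : weierstrassDeriv g z 0 = 1 / 2 * (-(deriv g z / g z ^ 2) - deriv g z) := by
    rw [← neg_div]; rfl
  have d1 : weierstrassDeriv g z 1 = I / 2 * (-(deriv g z / g z ^ 2) + deriv g z) := by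
    rw [← neg_div]; rfl
  have d2 : weierstrassDeriv g z 2 = 0 := rfl
  simp only [w0, h2re, h2im, sub_re, sub_im, hinvre, hinvim] at x1 y1
  simp only [w1, hI2re, hI2im, add_re, add_im, hinvre, hinvim] at x2 y2
  simp only [w2, one_re, one_im] at x3 y3
  simp only [d0, h2re, h2im, sub_re, sub_im, neg_re, neg_im, hqre, hqim] at xx1 xy1 yy1
  simp only [d1, hI2re, hI2im, add_re, add_im, neg_re, neg_im, hqre, hqim] at xx2 xy2 yy2
  simp only [d2, zero_re, zero_im] at xx3 xy3 yy3
  -- With `R = ‖g‖²`, the tangent vectors are `(x d, y d, 1)` and `(y s, -x s, 0)`.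
  set s := (1 + R) / (2 * R) with hs
  set d := (1 - R) / (2 * R) with hd'
  have X1 : partialX Y z 0 = x * d := by rw [x1, hd']; field_simp; ring
  have X2 : partialX Y z 1 = y * d := by rw [x2, hd']; field_simp; ring
  have X3 : partialX Y z 2 = 1 := x3
  have Y1 : partialY Y z 0 = y * s := by rw [y1, hs]; field_simp; ring
  have Y2 : partialY Y z 1 = -(x * s) := by rw [y2, hs]; field_simp; ring
  have Y3 : partialY Y z 2 = 0 := by rw [y3, neg_zero]
  have inn (u v : EuclideanSpace ℝ (Fin 3)) : inner ℝ u v = u 0 * v 0 + u 1 * v 1 + u 2 * v 2 := by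
    rw [PiLp.inner_apply, Fin.sum_univ_three]
    simp [mul_comm]
  set n : EuclideanSpace ℝ (Fin 3) :=
    WithLp.toLp 2 (crossProduct (WithLp.ofLp (partialX Y z)) (WithLp.ofLp (partialY Y z))) with hn
  have n0 : n 0 = x * s := by
    have : n 0 = partialX Y z 1 * partialY Y z 2 - partialX Y z 2 * partialY Y z 1 := by
      simp [hn, cross_apply]
    rw [this, X2, X3, Y2, Y3]; ring
  have n1 : n 1 = y * s := by
    have : n 1 = partialX Y z 2 * partialY Y z 0 - partialX Y z 0 * partialY Y z 2 := by
      simp [hn, cross_apply]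
    rw [this, X1, X3, Y1, Y3]; ring
  have n2 : n 2 = -(R * d * s) := by
    have : n 2 = partialX Y z 0 * partialY Y z 1 - partialX Y z 1 * partialY Y z 0 := by
      simp [hn, cross_apply]
    rw [this, X1, X2, Y1, Y2, hR]; ring
  -- `W` is the square of the conformal factor; it is also the length of the normal `n`.
  set W := (1 + R) ^ 2 / (4 * R) with hW
  have hWpos : 0 < W := by positivity
  have hXX : inner ℝ (partialX Y z) (partialX Y z) = W := by
    rw [inn, X1, X2, X3, hW, hd']
    have : x * ((1 - R) / (2 * R)) * (x * ((1 - R) / (2 * R))) +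
        y * ((1 - R) / (2 * R)) * (y * ((1 - R) / (2 * R))) + 1 * 1 =
        R * ((1 - R) / (2 * R)) ^ 2 + 1 := by rw [hR]; ring
    rw [this]
    field_simp
    ring
  have hYY : inner ℝ (partialY Y z) (partialY Y z) = W := by
    rw [inn, Y1, Y2, Y3, hW]
    have : y * s * (y * s) + -(x * s) * -(x * s) + 0 * 0 = R * s ^ 2 := by rw [hR]; ring
    rw [this, hs]
    field_simp
    norm_num
  have hXY : inner ℝ (partialX Y z) (partialY Y z) = 0 := by
    rw [inn, X1, X2, Y1, Y2, Y3]
    ring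
  have hnn : ‖n‖ ^ 2 = W ^ 2 := by
    rw [← real_inner_self_eq_norm_sq, inn, n0, n1, n2]
    have : x * s * (x * s) + y * s * (y * s) + -(R * d * s) * -(R * d * s) =
        R * s ^ 2 * (1 + R * d ^ 2) := by rw [hR]; ring
    rw [this, hs, hd', hW]
    field_simp
    ring
  have hlam : conformalFactor Y z ^ 2 = W := by
    rw [conformalFactor, ← real_inner_self_eq_norm_sq, hXX]
  have hlam0 : 0 < conformalFactor Y z := by
    have : 0 ≤ conformalFactor Y z := norm_nonneg _
    refine this.lt_of_ne fun h => ?_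
    rw [← h] at hlam
    norm_num at hlam
    exact hWpos.ne hlam
  refine ⟨hlam0, ?_⟩
  have hN (v : EuclideanSpace ℝ (Fin 3)) : inner ℝ v (unitNormal Y z) = ‖n‖⁻¹ * inner ℝ v n := by
    rw [unitNormal]
    exact real_inner_smul_right _ _ _
  set e : ℝ := inner ℝ (partialX (partialX Y) z) n with he
  set m : ℝ := inner ℝ (partialY (partialX Y) z) n with hm
  -- The components of the immersion are harmonic, so the second fundamental form is trace-free and
  -- its determinant is `-(e² + m²)`.
  have hyyn : inner ℝ (partialY (partialY Y) z) n = -e := by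
    rw [he, inn, inn, xx1, xx2, xx3, yy1, yy2, yy3]
    ring
  have e_eq : e * R = -(s * (1 + R) * (a * x + b * y)) / 2 := by
    have h1 : α * x - β * y = (a * x + b * y) / R := by
      rw [hα, hβ]
      have : a * (x ^ 2 - y ^ 2) * x + 2 * b * x * y * x - (b * (x ^ 2 - y ^ 2) * y -
        2 * a * x * y * y) = (a * x + b * y) * R := by rw [hR]; ring
      field_simp
      linear_combination this
    have h2 : (α * x - β * y) * R = a * x + b * y := by rw [h1]; field_simp
    rw [he, inn, xx1, xx2, xx3, n0, n1, n2]
    linear_combination -(s / 2) * h2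
  have m_eq : m * R = s * (1 + R) * (b * x - a * y) / 2 := by
    have h1 : β * x + α * y = (b * x - a * y) / R := by
      rw [hα, hβ]
      have : b * (x ^ 2 - y ^ 2) * x - 2 * a * x * y * x + (a * (x ^ 2 - y ^ 2) * y +
        2 * b * x * y * y) = (b * x - a * y) * R := by rw [hR]; ring
      field_simp
      linear_combination this
    have h2 : (β * x + α * y) * R = b * x - a * y := by rw [h1]; field_simp
    rw [hm, inn, xy1, xy2, xy3, n0, n1, n2]
    linear_combination (s / 2) * h2
  have hem : (e ^ 2 + m ^ 2) * R = s ^ 2 * (1 + R) ^ 2 * (a ^ 2 + b ^ 2) / 4 := by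
    have h1 : (e ^ 2 + m ^ 2) * R * R =
        s ^ 2 * (1 + R) ^ 2 * ((a ^ 2 + b ^ 2) * R) / 4 := by
      have h2 : (a * x + b * y) ^ 2 + (b * x - a * y) ^ 2 = (a ^ 2 + b ^ 2) * R := by
        rw [hR]; ring
      rw [← h2]
      linear_combination (e * R - s * (1 + R) * (a * x + b * y) / 2) * e_eq +
        (m * R + s * (1 + R) * (b * x - a * y) / 2) * m_eq
    refine mul_right_cancel₀ hRpos.ne' ?_
    rw [h1]
    ring
  have hnp : 0 < ‖n‖ ^ 2 := by rw [hnn]; positivity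
  -- Two factors `W` come from normalizing `n` twice, two more from the determinant of the first
  -- fundamental form.
  have hK : gaussCurvature Y z = -(e ^ 2 + m ^ 2) / W ^ 4 := by
    rw [gaussCurvature, hN, hN, hN, hXX, hYY, hXY, hyyn, ← he, ← hm]
    have : ‖n‖⁻¹ * e * (‖n‖⁻¹ * -e) - (‖n‖⁻¹ * m) ^ 2 = -(e ^ 2 + m ^ 2) / ‖n‖ ^ 2 := by
      have : ‖n‖ ≠ 0 := fun h => by rw [h] at hnp; norm_num at hnp
      field_simp
      ring
    rw [this, hnn]
    field_simp
    ring
  have hem' : e ^ 2 + m ^ 2 = s ^ 2 * (1 + R) ^ 2 * (a ^ 2 + b ^ 2) / 4 / R := by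
    rw [← hem]
    field_simp
  rw [hK, hlam, hgR, hdR, hem', hW, hs]
  field_simp
  ring

/-- The Jacobi equation as a differential inequality for the flat Laplacian. -/
theorem exists_laplacian_bound {E : Set Cylinder} {X : ↥Eᶜ → EuclideanSpace ℝ (Fin 3)}
    (hX : IsQuasiperiodicRiemannType E X) : ∃ M : ℝ, ∀ v : ↥Eᶜ → ℝ, IsJacobiFunction X v →
      ∀ z, toCyl z ∉ E → |Laplacian.laplacian (lift v) z| ≤ M * |lift v z| := by
  obtain ⟨g, hg, rfl, hd⟩ := hX
  have hq := hg.memW.quasiperiodic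
  obtain ⟨C, hC, hgC⟩ := hq.exists_deriv_bound
  obtain ⟨ε, hε, hsep⟩ := hq.exists_separation
  have hopen : IsOpen (toCyl ⁻¹' zerosAndPoles g)ᶜ :=
    (Metric.isClosed_of_pairwise_le_dist hε hsep).isOpen_compl
  -- Multiplied by the square of the conformal factor, `2 K` becomes `-8` times the square of the
  -- spherical derivative, and the latter is at most `C`.
  refine ⟨8 * C ^ 2, fun v hv z hz => ?_⟩
  obtain ⟨ha, h0⟩ := analyticAt_of_notMem_zerosAndPoles hq.isMeromorphic.meromorphic hz
  have hY : ∀ᶠ w in 𝓝 z, ∀ j, HasFDerivAt (fun w => lift X w j)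
      (reCLM ∘L (weierstrassForm g w j • ContinuousLinearMap.id ℝ ℂ)) w := by
    filter_upwards [hopen.mem_nhds hz] with w hw using hd w hw
  obtain ⟨hlam, hK⟩ := gaussCurvature_mul_conformalFactor_sq hY ha.differentiableAt h0
  have hJ := (hv z hz).2
  rw [jacobiOperator, sub_eq_zero, div_eq_iff (by positivity)] at hJ
  have hΔ : Laplacian.laplacian (lift v) z =
      -(8 * (‖deriv g z‖ / (1 + ‖g z‖ ^ 2)) ^ 2) * lift v z := by
    rw [hJ, div_pow]
    linear_combination 2 * lift v z * hK
  have hle : ‖deriv g z‖ / (1 + ‖g z‖ ^ 2) ≤ C := by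
    rw [div_le_iff₀ (by positivity)]
    exact hgC z
  rw [hΔ, abs_mul, abs_neg, abs_of_nonneg (by positivity)]
  gcongr

/-! ### Application to bounded Jacobi functions -/

/-- The complex-valued lift to the plane of bounded Jacobi functions. -/
def liftLinearMap {E : Set Cylinder} (X : ↥Eᶜ → EuclideanSpace ℝ (Fin 3)) :
    ↥(boundedJacobiFunctions X) →ₗ[ℝ] (ℂ → ℂ) where
  toFun v z := ((lift (v : ↥Eᶜ → ℝ) z : ℝ) : ℂ)
  map_add' u v := by
    funext z
    simp [lift_add]
  map_smul' c v := by
    funext z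
    simp [lift_smul]

theorem finiteDimensional_boundedJacobiFunctions {E : Set Cylinder}
    {X : ↥Eᶜ → EuclideanSpace ℝ (Fin 3)} (hX : IsQuasiperiodicRiemannType E X) :
    FiniteDimensional ℝ ↥(boundedJacobiFunctions X) := by
  obtain ⟨M, hM⟩ := exists_laplacian_bound hX
  obtain ⟨g, hg, rfl, -⟩ := hX
  obtain ⟨ε, hε, hsep⟩ := hg.memW.quasiperiodic.exists_separation
  refine finiteDimensional_of_laplacian_le (liftLinearMap X) (D := toCyl ⁻¹' zerosAndPoles g)
    (M := M) (fun K hK => finite_inter_of_separated hε hsep hK)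
    (Metric.isClosed_of_pairwise_le_dist hε hsep) (fun z => ?_) (fun v z hz => ?_) (fun v => ?_)
    (fun v z hz => contDiffAt_ofReal_comp (v.2.1 z hz).1) (fun v z => ?_) (fun v z hz => ?_)
    fun v hv => ?_
  · rw [mem_preimage, mem_preimage, toCyl_add_I]
  · change ((lift (v : ↥(zerosAndPoles g)ᶜ → ℝ) z : ℝ) : ℂ) = 0
    rw [lift, dif_neg (fun h => h hz), ofReal_zero]
  · obtain ⟨B, hB⟩ := v.2.2
    refine ⟨max B 0, fun z => ?_⟩
    change ‖((lift (v : ↥(zerosAndPoles g)ᶜ → ℝ) z : ℝ) : ℂ)‖ ≤ _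
    rw [norm_real, Real.norm_eq_abs, lift]
    split_ifs
    · exact (hB _).trans (le_max_left _ _)
    · simp
  · exact congrArg ((↑) : ℝ → ℂ) (lift_periodic (v : ↥(zerosAndPoles g)ᶜ → ℝ) z)
  · change ‖flatLaplacian (fun w => ((lift (v : ↥(zerosAndPoles g)ᶜ → ℝ) w : ℝ) : ℂ)) z‖ ≤
      M * ‖((lift (v : ↥(zerosAndPoles g)ᶜ → ℝ) z : ℝ) : ℂ)‖
    rw [flatLaplacian_ofReal (v.2.1 z hz).1, norm_real, norm_real]
    exact hM v v.2.1 z hz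
  -- Every point of the surface has a lift off `D`, so a Jacobi function whose lift vanishes there
  -- is zero.
  · refine Subtype.ext (funext fun p => ?_)
    obtain ⟨z, hz⟩ := QuotientAddGroup.mk_surjective (p : Cylinder)
    have hz' : toCyl z = p := hz
    have hzE : toCyl z ∉ zerosAndPoles g := by
      rw [hz']
      exact p.2
    have h1 : ((lift (v : ↥(zerosAndPoles g)ᶜ → ℝ) z : ℝ) : ℂ) = 0 := hv z hzE
    rw [ofReal_eq_zero, lift, dif_pos (show toCyl z ∈ (zerosAndPoles g)ᶜ from hzE)] at h1
    have hp : (⟨toCyl z, hzE⟩ : ↥(zerosAndPoles g)ᶜ) = p := Subtype.ext hz'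
    rw [hp] at h1
    exact h1

end RiemannType

end

theorem mainTheorem6 (E : Set RiemannType.Cylinder) (X : ↥Eᶜ → EuclideanSpace ℝ (Fin 3))
    (hX : RiemannType.IsQuasiperiodicRiemannType E X) :
    FiniteDimensional ℝ ↥(RiemannType.boundedJacobiFunctions X) := by
  exact RiemannType.finiteDimensional_boundedJacobiFunctions hX
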